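/- **The game.** A secret is a pair $(z,\pi)$ with $z\in\{0,1\}^n$ and $\pi$ a permutation of $[n]$. A query $x\in\{0,1\}^n$ is answered by $f(x)=f_{z,\pi}(x)=\max\{i\in[0..n] : z_{\pi(j)}=x_{\pi(j)}\text{ for all }j\le i\}$. A deterministic strategy is a tree of outdegree $n+1$ with a query at each node; on input $(z,\pi)$ it needs $t$ queries if $t$ is least such that $(z,\pi)$ is the only secret consistent with the first $t$ answers. A randomized strategy is a probability distribution over deterministic strategies; its complexity is the maximum over all $(z,\pi)$ of the expected number of queries needed. The randomized query complexity of the game is the infimum of the complexities of all randomized strategies. **The multi-level strategy.** Fix an integer $d\ge 4$, a real $c$ with $(1-1/k)^{ck}\le 1/2$ for all integers $k\ge1$, and $q=q(n)\le n$ with $n-q=\Theta(n/\log n)$. Put $\alpha_i=\lceil\log_2 n\rceil^{2^{i-1}}$, $m_i=\lceil n/\alpha_i^d\rceil$, and let $t$ be maximal with $\alpha_t^d\le n$. The strategy keeps candidate sets $V_1,\dots,V_n$ (initially all $[n]$), a counter $s$ (initially $0$), and strings $x,y$ with their scores; initially $x=0^n$, $y=1^n$, swapped if $f(x)>0$. "Flipping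 $I$ in $x$" means complementing the entries of $x$ in the positions in $I$. * *RandBinSearch*$(x,s+1,V,m)$: while $|V|>m$, choose $F\subseteq V$ uniformly of size $\lceil|V|/2\rceil$, query the string obtained from $x$ by flipping $F$, and replace $V$ by $V\setminus F$ if the score is $s$ and by $F$ otherwise. Return $V$. * *ReductionStep*$(k,J,m,x)$: delete from $J$ all $j$ with $|V_j|\le m$. While $J\neq\emptyset$: let $l=|J|$ and $o=0$, and repeat the following trial until $o\ge ck$ and $|J|\le l/2$; then replace $k$ by $\lceil k/2\rceil$. Trial: choose independently uniform subsets $F_j\subseteq V_j$ of size $\lceil|V_j|/k\rceil$, $j\in J$, and query the string $y'$ obtained from $x$ by flipping $\bigcup_{j\in J}F_j$. If $f(y')\ge\max J$, increase $o$ by one and replace $V_j$ by $V_j\setminus F_j$ for all $j\in J$; otherwise set $V_{f(y')+1}:=F_{f(y')+1}$ and replace $V_j$ by $V_j\setminus F_j$ for $j\in J$, $j\le f(y')$. Then delete from $J$ all $j$ with $|V_j|\le m$. * *SizeReduction*$(k,J,m,x)$: with $M=\max_{j\in J}|V_j|$, call *ReductionStep*$(k,J,\lceil M/k^i\rceil,x)$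 for $i=1,\dots,\max(0,\lceil\log_k(M/m)\rceil)$. * *Advance*$(\ell)$: start with $J=\emptyset$. While $|J|\le\alpha_\ell$, do the following. If $\ell=1$: let $V_{s+1}$ be the result of *RandBinSearch*$(x,s+1,[n]\setminus\bigcup_{j\le s}V_j,m_1)$, increase $s$ by one, put $J'=\{s\}$ and $x:=y$. If $\ell>1$: let $J'$ be the result of *Advance*$(\ell-1)$ and call *SizeReduction*$(\alpha_{\ell-1},J',m_\ell,x)$. In both cases add $J'$ to $J$, create $y$ from $x$ by flipping $[n]\setminus\bigcup_{j\le s}V_j$, and query $y$. If $f(x),f(y)$ are both $>s$ or both $=s$, this is a failure on level $\ell$: leave the loop. Otherwise swap $x,y$ if $f(x)>s$. Return $J$. * *First phase*: start with $J=\emptyset$. While $|J|<q$: let $J'$ be the result of *Advance*$(t)$, call *SizeReduction*$(\alpha_t,J',1,x)$, add $J'$ to $J$; if that call of *Advance*$(t)$ ended by a failure, create $y$ from $x$ again by flipping $[n]\setminus\bigcup_{j\le s}V_j$, query $y$, and swap $x,y$ if $f(x)>s$. * *Second phase*: while $s<n$, let $U=[n]\setminus\bigcup_{j\le s}V_j$,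 query $x$, flip $U$ in $x$ if $f(x)>s$, let $V_{s+1}$ be the result of *RandBinSearch*$(x,s+1,U,1)$, flip $V_{s+1}$ in $x$, and increase $s$ by one. The queries caused by failures are: for each failure, the query by which it is detected and all queries of the call of *SizeReduction* that is applied to the set returned by the failed call of *Advance*, together with the query that renews $y$ after a failure on level $t$. **Theorem.** 1. The randomized query complexity of the game with $n$ positions is $O(n\log\log n)$. 2. For every $d\ge4$ the number of levels satisfies $t=\Theta(\log\log n)$. For all $d,c,q$ as above there is a constant $C$ such that for all sufficiently large $n$ and every secret $(z,\pi)$: * the first phase always terminates, after a number of loop iterations bounded independently of $(z,\pi)$, and then $V_j=\{\pi(j)\}$ and $x_{\pi(j)}=z_{\pi(j)}$ for all $j\le q$; that is, it has identified $\pi(1),\dots,\pi(q)$ and $z_{\pi(1)},\dots,z_{\pi(q)}$; * its expected number of queries is at most $C\,n\log\log n$; * the expected number of its queries that are caused by failures is at most $C\,n$; * both phases together always terminate in the same sense and then $V_j=\{\pi(j)\}$ for all $j\in[n]$ and $x=z$; that is, they identify $(z,\pi)$; * their expected number of queries exceeds that of the first phase by at most $C\,n$, and is at most $C\,n\log\log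 n$. -/

import Mathlib

open Filter Asymptotics MeasureTheory
open scoped ENNReal

noncomputable section

namespace PermMastermind

/-! ### The game -/

/-- A query (and also a target string): a bit string of length `n`. -/
abbrev BitString (n : ℕ) := Fin n → Bool

/-- The score `f_{z,π}(x)`: the largest `i ∈ [0..n]` such that `z` and `x` agree in the first `i`
positions of the order given by `π`. Positions are numbered `0, …, n - 1`. -/
def score {n : ℕ} (z : BitString n) (π : Equiv.Perm (Fin n)) (x : BitString n) : Fin (n + 1) :=
  ⟨Nat.findGreatest (fun i => ∀ j : Fin n, (j : ℕ) < i → z (π j) = x (π j)) n,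
    Nat.lt_succ_of_le (Nat.findGreatest_le n)⟩

/-! ### Deterministic and randomized strategies, randomized query complexity -/

/-- A deterministic strategy: a tree of outdegree `n + 1` with a query at every node. A node is
given by the list of the scores received on the way from the root to it. -/
abbrev DetStrategy (n : ℕ) := List (Fin (n + 1)) → BitString n

/-- The list of the first `t` scores when the secret is `(z, π)`. -/
def DetStrategy.scores {n : ℕ} (T : DetStrategy n) (z : BitString n) (π : Equiv.Perm (Fin n)) :
    ℕ → List (Fin (n + 1))
  | 0 => []
  | t + 1 => DetStrategy.scores T z π t ++ [score z π (T (DetStrategy.scores T z π t))]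

/-- After `t` queries `(z, π)` is the only secret that is consistent with all the answers. -/
def DetStrategy.Identified {n : ℕ} (T : DetStrategy n) (z : BitString n)
    (π : Equiv.Perm (Fin n)) (t : ℕ) : Prop :=
  ∀ (z' : BitString n) (π' : Equiv.Perm (Fin n)),
    (∀ i < t, score z' π' (T (DetStrategy.scores T z π i)) =
      score z π (T (DetStrategy.scores T z π i))) → z' = z ∧ π' = π

/-- The number of queries that the strategy needs to identify `(z, π)` (`∞` if it never does). -/
def DetStrategy.queriesNeeded {n : ℕ} (T : DetStrategy n) (z : BitString n)
    (π : Equiv.Perm (Fin n)) : ℝ≥0∞ :=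
  ⨅ (t : ℕ) (_ : DetStrategy.Identified T z π t), (t : ℝ≥0∞)

/-- The complexity of a randomized strategy, i.e. of a probability distribution over deterministic
strategies: the worst case over all secrets of the expected number of queries needed. -/
def complexity {n : ℕ} (μ : Measure (DetStrategy n)) : ℝ≥0∞ :=
  ⨆ (z : BitString n) (π : Equiv.Perm (Fin n)), ∫⁻ T, DetStrategy.queriesNeeded T z π ∂μ

/-- The randomized query complexity of the game with `n` positions. -/
def randomizedQueryComplexity (n : ℕ) : ℝ≥0∞ :=
  ⨅ (μ : Measure (DetStrategy n)) (_ : IsProbabilityMeasure μ), complexity μ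

/-! ### Randomized query programs

The language in which the multi-level strategy is written. A program has no access to the secret
other than through the answers to its queries. -/

/-- A randomized program that may query the score of bit strings and returns a value in `α`.
`abort` is reached exactly when a loop exceeds the iteration bound with which it was started, or
when a nonexistent position is accessed. -/
inductive Prog (n : ℕ) (α : Type) : Type
  /-- return a value -/
  | done (a : α) : Prog n α
  /-- no result -/
  | abort : Prog n α
  /-- query `x` and continue with the score; `tag` is a mark used only to classify queries when
  they are counted -/
  | query (tag : Bool) (x : BitString n) (next : Fin (n + 1) → Prog n α) : Prog n α
  /-- choose an element of `S` uniformly at random -/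
  | sample (S : Finset (Fin n → Finset (Fin n)))
      (next : (Fin n → Finset (Fin n)) → Prog n α) : Prog n α

/-- Sequential composition. -/
def Prog.bind {n : ℕ} {α β : Type} : Prog n α → (α → Prog n β) → Prog n β
  | .done a, g => g a
  | .abort, _ => .abort
  | .query tag x next, g => .query tag x fun r => Prog.bind (next r) g
  | .sample S next, g => .sample S fun F => Prog.bind (next F) g

instance (n : ℕ) : Monad (Prog n) where
  pure := Prog.done
  bind := Prog.bind

/-- Query `x` and return the score. -/
def ask {n : ℕ} (tag : Bool) (x : BitString n) : Prog n ℕ :=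
  .query tag x fun r => .done (r : ℕ)

/-- Uniform distribution on a nonempty finite set of families (for the empty set, which is never
sampled from, a point mass). -/
def uniformOn {n : ℕ} (S : Finset (Fin n → Finset (Fin n))) : PMF (Fin n → Finset (Fin n)) :=
  open Classical in
  if h : S.Nonempty then PMF.uniformOfFinset S h else PMF.pure fun _ => ∅

/-- The joint distribution of the result of a program (`none` if it aborts), the number of all
queries made, and the number of queries made that carry the tag `true`. -/
def Prog.run {n : ℕ} {α : Type} (z : BitString n) (π : Equiv.Perm (Fin n)) :
    Prog n α → PMF (Option α × ℕ × ℕ)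
  | .done a => PMF.pure (some a, 0, 0)
  | .abort => PMF.pure (none, 0, 0)
  | .query tag x next =>
      (Prog.run z π (next (score z π x))).map fun ω =>
        (ω.1, ω.2.1 + 1, if tag then ω.2.2 + 1 else ω.2.2)
  | .sample S next => (uniformOn S).bind fun F => Prog.run z π (next F)

/-- The expectation of a nonnegative quantity. -/
def expectation {β : Type} (p : PMF β) (g : β → ℝ≥0∞) : ℝ≥0∞ := ∑' b, p b * g b

/-- The expected number of queries made by a program. -/
def Prog.expectedQueries {n : ℕ} {α : Type} (P : Prog n α) (z : BitString n)
    (π : Equiv.Perm (Fin n)) : ℝ≥0∞ :=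
  expectation (Prog.run z π P) fun ω => (ω.2.1 : ℝ≥0∞)

/-- With certainty the program ends with a result, and the result satisfies `Q`. -/
def Prog.AlwaysReturns {n : ℕ} {α : Type} (P : Prog n α) (z : BitString n)
    (π : Equiv.Perm (Fin n)) (Q : α → Prop) : Prop :=
  ∀ ω ∈ (Prog.run z π P).support, ∃ a, ω.1 = some a ∧ Q a

/-! ### The multi-level strategy -/

/-- The bit string obtained from `x` by flipping the entries in the positions in `I`. -/
def flipBits {n : ℕ} (x : BitString n) (I : Finset (Fin n)) : BitString n :=
  fun i => if i ∈ I then !(x i) else x i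

/-- All families `F` with `F j` a subset of `V j` of size `r j` for `j ∈ J` (and `F j` empty for
the other `j`). A uniformly random such family consists of independent uniformly random subsets. -/
def families {n : ℕ} (J : Finset (Fin n)) (V : Fin n → Finset (Fin n)) (r : Fin n → ℕ) :
    Finset (Fin n → Finset (Fin n)) :=
  Fintype.piFinset fun j => if j ∈ J then (V j).powersetCard (r j) else {∅}

/-- The variables of the strategy. -/
structure State (n : ℕ) where
  /-- `V j` is the candidate set for `π j` -/
  V : Fin n → Finset (Fin n)
  /-- the positions `0, …, s - 1` have been treated -/
  s : ℕ
  x : BitString n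
  /-- the score of `x`, as it was answered -/
  fx : ℕ
  y : BitString n
  /-- the score of `y`, as it was answered -/
  fy : ℕ
  /-- the number of failures so far (never used by the strategy) -/
  failures : ℕ

/-- The union of the candidate sets of the first `s` positions. -/
def State.covered {n : ℕ} (σ : State n) : Finset (Fin n) :=
  (Finset.univ.filter fun j : Fin n => (j : ℕ) < σ.s).biUnion σ.V

/-- Exchange `x` and `y` if `f(x) > s`. -/
def State.orient {n : ℕ} (σ : State n) : State n :=
  if σ.s < σ.fx then { σ with x := σ.y, fx := σ.fy, y := σ.x, fy := σ.fx } else σ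

/-- Random binary search: `x` has score `s`, and `V` is a candidate set for position `s` (the
first position in which `x` is wrong). While `V` has more than `m` elements, flip a random half of
it. The first argument bounds the number of iterations. -/
def randBinSearch {n : ℕ} (x : BitString n) (s : Fin n) (m : ℕ) :
    ℕ → Finset (Fin n) → Prog n (Finset (Fin n))
  | 0, _ => .abort
  | N + 1, V =>
    if m < V.card then do
      let F ← Prog.sample (families {s} (fun _ => V) fun _ => V.card ⌈/⌉ 2) .done
      let r ← ask false (flipBits x (F s))
      randBinSearch x s m N (if r = (s : ℕ) then V \ F s else F s)
    else pure V

/-- The inner loop of `reductionStep`: repeat trials until there were at least `c * k` off-trials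
and at most half of the `l` indices with which the loop started are left. Here `o` counts the
off-trials; a trial is an off-trial if the score exceeds every (zero-based) index in `J`. -/
def reductionTrials {n : ℕ} (tag : Bool) (c : ℝ) (x : BitString n) (m k l : ℕ) :
    ℕ → ℕ → Finset (Fin n) → (Fin n → Finset (Fin n)) →
      Prog n (Finset (Fin n) × (Fin n → Finset (Fin n)))
  | 0, _, _, _ => .abort
  | N + 1, o, J, V => do
    let F ← Prog.sample (families J V fun j => (V j).card ⌈/⌉ k) .done
    let r ← ask tag (flipBits x (J.biUnion F))
    let o' : ℕ := if ∀ j ∈ J, (j : ℕ) < r then o + 1 else o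
    let V' : Fin n → Finset (Fin n) :=
      if ∀ j ∈ J, (j : ℕ) < r then
        fun j => if j ∈ J then V j \ F j else V j
      else
        fun j =>
          if (j : ℕ) = r then F j
          else if j ∈ J ∧ (j : ℕ) < r then V j \ F j
          else V j
    let J' : Finset (Fin n) := J.filter fun j => m < (V' j).card
    if c * (k : ℝ) ≤ (o' : ℝ) ∧ 2 * J'.card ≤ l then
      pure (J', V')
    else
      reductionTrials tag c x m k l N o' J' V'

/-- The outer loop of `reductionStep`; `k` is halved after each phase. `N₀` bounds the number of
iterations of each inner loop. -/
def reductionPhases {n : ℕ} (tag : Bool) (c : ℝ) (x : BitString n) (m N₀ : ℕ) :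
    ℕ → ℕ → Finset (Fin n) → (Fin n → Finset (Fin n)) → Prog n (Fin n → Finset (Fin n))
  | 0, _, _, _ => .abort
  | N + 1, k, J, V =>
    if J.Nonempty then do
      let w ← reductionTrials tag c x m k J.card N₀ 0 J V
      reductionPhases tag c x m N₀ N (k ⌈/⌉ 2) w.1 w.2
    else pure V

/-- Reduce the sizes of the candidate sets `V j`, `j ∈ J`, from at most `k * m` to at most `m`. -/
def reductionStep {n : ℕ} (N : ℕ) (tag : Bool) (c : ℝ) (k : ℕ) (J : Finset (Fin n)) (m : ℕ)
    (x : BitString n) (V : Fin n → Finset (Fin n)) : Prog n (Fin n → Finset (Fin n)) :=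
  reductionPhases tag c x m N N k (J.filter fun j => m < (V j).card) V

/-- Rounds number `i, …, i + rounds - 1` of `sizeReduction`. -/
def sizeReductionRounds {n : ℕ} (N : ℕ) (tag : Bool) (c : ℝ) (k : ℕ) (J : Finset (Fin n)) (M : ℕ)
    (x : BitString n) :
    (rounds : ℕ) → (i : ℕ) → (Fin n → Finset (Fin n)) → Prog n (Fin n → Finset (Fin n))
  | 0, _, V => pure V
  | rounds + 1, i, V => do
    let V' ← reductionStep N tag c k J (M ⌈/⌉ k ^ i) x V
    sizeReductionRounds N tag c k J M x rounds (i + 1) V'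

/-- Reduce the sizes of the candidate sets `V j`, `j ∈ J`, to at most `m`, by `⌈log_k (M / m)⌉`
calls of `reductionStep`, the `i`-th of them with target size `⌈M / k ^ i⌉`, where `M` is the
largest of the sizes. -/
def sizeReduction {n : ℕ} (N : ℕ) (tag : Bool) (c : ℝ) (k : ℕ) (J : Finset (Fin n)) (m : ℕ)
    (x : BitString n) (V : Fin n → Finset (Fin n)) : Prog n (Fin n → Finset (Fin n)) :=
  sizeReductionRounds N tag c k J (J.sup fun j => (V j).card) x
    ⌈Real.logb k (((J.sup fun j => (V j).card : ℕ) : ℝ) / (m : ℝ))⌉₊ 1 V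

/-- The capacity `α_i = ⌈log₂ n⌉ ^ (2 ^ (i - 1))` of level `i ≥ 1`. -/
def capacity (n i : ℕ) : ℕ := Nat.clog 2 n ^ 2 ^ (i - 1)

/-- The number `t` of levels: the largest `t` with `α_t ^ d ≤ n`. -/
def numLevels (d n : ℕ) : ℕ := Nat.findGreatest (fun i => capacity n i ^ d ≤ n) n

/-- The size `⌈n / α_i ^ d⌉` to which candidate sets are reduced on level `i`. -/
def targetSize (d n i : ℕ) : ℕ := n ⌈/⌉ capacity n i ^ d

/-- The loop of a call of `advance`. While at most `cap` indices have been collected, `fill`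
provides new ones, `y` is created from `x` by flipping everything outside the candidate sets of the
treated positions, and `y` is queried. If the scores of `x` and `y` are both larger than `s` or
both equal to `s`, this is a failure and the loop stops. The result is the set of the collected
indices, whether the loop ended by a failure, and the new state. -/
def advanceLoop {n : ℕ} (cap : ℕ) (fill : State n → Prog n (Finset (Fin n) × State n)) :
    ℕ → Finset (Fin n) → State n → Prog n (Finset (Fin n) × Bool × State n)
  | 0, _, _ => .abort
  | N + 1, J, σ =>
    if J.card ≤ cap then do
      let w ← fill σ
      let y' := flipBits w.2.x (Finset.univ \ w.2.covered)
      let r ← ask false y'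
      let σ' : State n := { w.2 with y := y', fy := r }
      if (σ'.s < σ'.fx ∧ σ'.s < σ'.fy) ∨ (σ'.fx = σ'.s ∧ σ'.fy = σ'.s) then
        pure (J ∪ w.1, true, { σ' with failures := σ'.failures + 1 })
      else
        advanceLoop cap fill N (J ∪ w.1) σ'.orient
    else pure (J, false, σ)

/-- One step on level 1: determine the candidate set of position `s` by random binary search in
the complement of the previous candidate sets, increase `s`, and replace `x` by `y`. -/
def fillOne {n : ℕ} (N d : ℕ) (σ : State n) : Prog n (Finset (Fin n) × State n) :=
  if h : σ.s < n then do
    let W ← randBinSearch σ.x ⟨σ.s, h⟩ (targetSize d n 1) N (Finset.univ \ σ.covered)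
    pure ({⟨σ.s, h⟩},
      { σ with V := Function.update σ.V ⟨σ.s, h⟩ W, s := σ.s + 1, x := σ.y, fx := σ.fy })
  else .abort

/-- `advance N d c l` works on level `l`: it collects about `α_l` new indices whose candidate sets
have size at most `⌈n / α_l ^ d⌉`, or fewer of them if a failure occurs. The queries of a size
reduction that follows a failed call on the level below carry the tag `true`. -/
def advance {n : ℕ} (N d : ℕ) (c : ℝ) :
    ℕ → State n → Prog n (Finset (Fin n) × Bool × State n)
  | 0, _ => .abort
  | 1, σ => advanceLoop (capacity n 1) (fillOne N d) N ∅ σ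
  | l + 2, σ =>
    advanceLoop (capacity n (l + 2))
      (fun τ => do
        let w ← advance N d c (l + 1) τ
        let V' ← sizeReduction N w.2.1 c (capacity n (l + 1)) w.1 (targetSize d n (l + 2))
          w.2.2.x w.2.2.V
        pure (w.1, { w.2.2 with V := V' }))
      N ∅ σ

/-- The main loop of the first phase. If the call of `advance` ended by a failure, then, after the
candidate sets have been reduced to singletons, `y` is created from `x` anew, so that again one of
the two has score `s` and the other one a larger score. -/
def phaseOneLoop {n : ℕ} (N d : ℕ) (c : ℝ) (q : ℕ) :
    ℕ → Finset (Fin n) → State n → Prog n (State n)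
  | 0, _, _ => .abort
  | fuel + 1, J, σ =>
    if J.card < q then do
      let w ← advance N d c (numLevels d n) σ
      let V' ← sizeReduction N w.2.1 c (capacity n (numLevels d n)) w.1 1 w.2.2.x w.2.2.V
      let σ₁ : State n := { w.2.2 with V := V' }
      if w.2.1 then do
        let y' := flipBits σ₁.x (Finset.univ \ σ₁.covered)
        let r ← ask true y'
        let σ₂ : State n := { σ₁ with y := y', fy := r }
        phaseOneLoop N d c q fuel (J ∪ w.1) σ₂.orient
      else
        phaseOneLoop N d c q fuel (J ∪ w.1) σ₁
    else pure σ

/-- The first phase, with `d` the exponent in the target sizes, `c` the constant in the stopping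
rule of `reductionTrials`, and `q` the score that is to be achieved. Each loop is given at most `N`
iterations; the program aborts if some loop needs more. -/
def phaseOne (n : ℕ) (N d : ℕ) (c : ℝ) (q : ℕ) : Prog n (State n) := do
  let r₀ ← ask false (fun _ : Fin n => false)
  let r₁ ← ask false (fun _ : Fin n => true)
  let σ : State n :=
    { V := fun _ => Finset.univ, s := 0, x := fun _ => false, fx := r₀,
      y := fun _ => true, fy := r₁, failures := 0 }
  phaseOneLoop N d c q N ∅ σ.orient

/-- The second phase: the remaining positions are determined one after the other, each by binary
search for a single element among the positions not yet used. -/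
def phaseTwo {n : ℕ} (N : ℕ) : ℕ → State n → Prog n (State n)
  | 0, _ => .abort
  | fuel + 1, σ =>
    if h : σ.s < n then do
      let U := Finset.univ \ σ.covered
      let r ← ask false σ.x
      let x' := if σ.s < r then flipBits σ.x U else σ.x
      let W ← randBinSearch x' ⟨σ.s, h⟩ 1 N U
      phaseTwo N fuel
        { σ with V := Function.update σ.V ⟨σ.s, h⟩ W, s := σ.s + 1, x := flipBits x' W }
    else pure σ

/-- The complete strategy: the first phase followed by the second. -/
def multiLevel (n : ℕ) (N d : ℕ) (c : ℝ) (q : ℕ) : Prog n (State n) := do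
  let σ ← phaseOne n N d c q
  phaseTwo N N σ

/-- The state shows the images under `π` of the first `q` positions (their candidate sets are
singletons) and the entries of `z` there (they are those of `x`). -/
def Knows {n : ℕ} (z : BitString n) (π : Equiv.Perm (Fin n)) (q : ℕ) (σ : State n) : Prop :=
  ∀ j : Fin n, (j : ℕ) < q → σ.V j = {π j} ∧ σ.x (π j) = z (π j)

/-- The expected number of queries that the first phase spends on failures: one for each failure
(the query by which it is detected), the queries of the size reduction that is applied to the set
of indices returned by the failed call, and the renewal of `y` after a failure on the last level. -/
def expectedFailureQueries (n : ℕ) (N d : ℕ) (c : ℝ) (q : ℕ) (z : BitString n)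
    (π : Equiv.Perm (Fin n)) : ℝ≥0∞ :=
  expectation (Prog.run z π (phaseOne n N d c q)) fun ω =>
    (ω.2.2 : ℝ≥0∞) + ((ω.1.elim 0 State.failures : ℕ) : ℝ≥0∞)

end PermMastermind

end

namespace PermMastermind

/-! ### A calculus of expected costs -/

/-! The proof is an amortized analysis with a potential that does not increase in expectation under
any random choice of the strategy. If failures are left aside, a treated position costs O(log log n)
queries in the binary search of level 1 and O(1) expected queries on each of the t = O(log log n)
levels. Indeed α_{l+1} = α_l², so consecutive target sizes differ by a factor of about α_l^d, a size
reduction with base α_l has at most d rounds, and a round for the index set J costs O(α_l + |J|),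
which is O(|J|) when more than α_l indices were collected. For a round, the disjoint candidate sets
are tested in parallel: a trial with |J| sets fails to finish one of them with probability at most k
/ (k + |J|) (`card_off_le`), and `trialBudget` converts this into an expected number of trials.

A failure at position s means that π(s) lies in the candidate set V_j of an earlier position j; on
level l it is charged O(α_l). The probability of a failure is never computed. Instead, every wrong
element of V_j holds the share 1 / (|V_j| - 1). By symmetry the expected share of a fixed element
does not grow when V_j is refined by a random subset (`sum_share_refine_le`,
`sum_share_afterTrial_le`). The potential adds up the shares of π(s'), s' ≥ s, in the sets V_j, j <
s, with weights 27n / (α_1 + s' - j)³. The target sizes are such that weight times share is at least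
α_l whenever V_j contains π(s) at a check on level l (`Large.capacity_mul_le`), so the potential
pays for the failure (`potential_add_le`). One position may fail on every level, whence the factor t
+ 1, of which each level consumes one unit. A new candidate set is cut from order n / log n elements
at least, so its initial shares are O(log n / n), and it brings in a potential of order t · (log n /
n) · (n / log² n) = O(1). Hence failures cost O(n) in total.

The calculus `Bd` combines certain termination, a postcondition, and a bound for expected cost plus
terminal potential. A term `- slope * s` in the terminal cost charges expenses to treated positions.
The price `κ` of a query stays a parameter: price 1 everywhere counts all queries, and price 1 on
tagged queries only counts those due to failures. The second phase needs O(log n) queries for each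
of Θ(n / log n) positions at most. Finally, drawing all random choices in advance turns the program
into a distribution over decision trees (`randomizedQueryComplexity_le`). -/

/-- The expected value of the sum of the costs of all queries (a query with mark `tag` costs
`κ tag`) and of `g` at the result, for the secret `(z, π)`. -/
noncomputable def wp {n : ℕ} {α : Type} (κ : Bool → ℝ) (z : BitString n)
    (π : Equiv.Perm (Fin n)) : Prog n α → (α → ℝ) → ℝ
  | .done a, g => g a
  | .abort, _ => 0
  | .query tag x next, g => κ tag + wp κ z π (next (score z π x)) g
  | .sample S next, g => (∑ F ∈ S, wp κ z π (next F) g) / S.card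

/-- For the secret `(z, π)` the program always returns a result, which satisfies `Q`, and it never
samples from the empty set. -/
def Sure {n : ℕ} {α : Type} (z : BitString n) (π : Equiv.Perm (Fin n)) :
    Prog n α → (α → Prop) → Prop
  | .done a, Q => Q a
  | .abort, _ => False
  | .query _ x next, Q => Sure z π (next (score z π x)) Q
  | .sample S next, Q => S.Nonempty ∧ ∀ F ∈ S, Sure z π (next F) Q

/-- `P` always returns a result in `Q`, and its expected cost with terminal cost `g` is at
most `v`. -/
structure Bd {n : ℕ} {α : Type} (κ : Bool → ℝ) (z : BitString n) (π : Equiv.Perm (Fin n))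
    (P : Prog n α) (Q : α → Prop) (g : α → ℝ) (v : ℝ) : Prop where
  sure : Sure z π P Q
  le : wp κ z π P g ≤ v

section calculus

variable {n : ℕ} {α β : Type} {κ : Bool → ℝ} {z : BitString n} {π : Equiv.Perm (Fin n)}

theorem wp_bind (P : Prog n α) (k : α → Prog n β) (g : β → ℝ) :
    wp κ z π (P.bind k) g = wp κ z π P fun a => wp κ z π (k a) g := by
  induction P with
  | done a => rfl
  | abort => rfl
  | query tag x next ih => simp only [Prog.bind, wp, ih]
  | sample S next ih => simp only [Prog.bind, wp, ih]

theorem Sure.bind {P : Prog n α} {k : α → Prog n β} {Q : α → Prop} {R : β → Prop}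
    (hP : Sure z π P Q) (hk : ∀ a, Q a → Sure z π (k a) R) : Sure z π (P.bind k) R := by
  induction P with
  | done a => exact hk a hP
  | abort => exact hP.elim
  | query tag x next ih => exact ih _ hP
  | sample S next ih => exact ⟨hP.1, fun F hF => ih F (hP.2 F hF)⟩

theorem Sure.mono {P : Prog n α} {Q R : α → Prop} (hP : Sure z π P Q) (h : ∀ a, Q a → R a) :
    Sure z π P R := by
  induction P with
  | done a => exact h a hP
  | abort => exact hP
  | query tag x next ih => exact ih _ hP
  | sample S next ih => exact ⟨hP.1, fun F hF => ih F (hP.2 F hF)⟩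

theorem Sure.wp_le {P : Prog n α} {Q : α → Prop} {g h : α → ℝ} (hP : Sure z π P Q)
    (hgh : ∀ a, Q a → g a ≤ h a) : wp κ z π P g ≤ wp κ z π P h := by
  induction P with
  | done a => exact hgh a hP
  | abort => exact le_rfl
  | query tag x next ih => exact add_le_add le_rfl (ih _ hP)
  | sample S next ih =>
    simp only [wp]
    gcongr with F hF
    exact ih F (hP.2 F hF)

/-- An aborted run has terminal cost `0` whatever `g` is, so a constant can be pulled out only where
abortion is excluded. -/
theorem Sure.wp_add_const {P : Prog n α} {Q : α → Prop} (hP : Sure z π P Q) (g : α → ℝ) (e : ℝ) :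
    wp κ z π P (fun a => g a + e) = wp κ z π P g + e := by
  induction P with
  | done a => rfl
  | abort => exact hP.elim
  | query tag x next ih => simp only [wp, ih _ hP, add_assoc]
  | sample S next ih =>
    simp only [wp]
    rw [Finset.sum_congr rfl fun F hF => ih F (hP.2 F hF), Finset.sum_add_distrib,
      Finset.sum_const, nsmul_eq_mul, add_div, mul_div_cancel_left₀]
    exact_mod_cast hP.1.card_pos.ne'

theorem Bd.done {a : α} {Q : α → Prop} {g : α → ℝ} {v : ℝ} (hQ : Q a) (hv : g a ≤ v) :
    Bd κ z π (.done a) Q g v := ⟨hQ, hv⟩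

/-- The rule of amortized analysis: the terminal cost `h` of the first part is the amount with which
the second part has to get by, so potentials telescope along a program. -/
theorem Bd.bind {P : Prog n α} {k : α → Prog n β} {Q : α → Prop} {R : β → Prop}
    {g : β → ℝ} {h : α → ℝ} {v : ℝ} (hP : Bd κ z π P Q h v)
    (hk : ∀ a, Q a → Bd κ z π (k a) R g (h a)) : Bd κ z π (P.bind k) R g v :=
  ⟨hP.sure.bind fun a ha => (hk a ha).sure, by
    rw [wp_bind]
    exact (hP.sure.wp_le fun a ha => (hk a ha).le).trans hP.le⟩

theorem Bd.query {tag : Bool} {x : BitString n} {next : Fin (n + 1) → Prog n α} {Q : α → Prop}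
    {g : α → ℝ} {v : ℝ} (h : Bd κ z π (next (score z π x)) Q g (v - κ tag)) :
    Bd κ z π (.query tag x next) Q g v :=
  ⟨h.sure, by have := h.le; simp only [wp]; linarith⟩

theorem Bd.ask {tag : Bool} {x : BitString n} {k : ℕ → Prog n α} {Q : α → Prop}
    {g : α → ℝ} {v : ℝ} (h : Bd κ z π (k (score z π x)) Q g (v - κ tag)) :
    Bd κ z π ((ask tag x).bind k) Q g v := Bd.query h

theorem Bd.sample {S : Finset (Fin n → Finset (Fin n))}
    {next : (Fin n → Finset (Fin n)) → Prog n α} {Q : α → Prop}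
    {g : α → ℝ} {v : ℝ} {u : (Fin n → Finset (Fin n)) → ℝ} (hS : S.Nonempty)
    (h : ∀ F ∈ S, Bd κ z π (next F) Q g (u F)) (hv : ∑ F ∈ S, u F ≤ S.card * v) :
    Bd κ z π (.sample S next) Q g v :=
  ⟨⟨hS, fun F hF => (h F hF).sure⟩, by
    have hpos : (0 : ℝ) < S.card := by exact_mod_cast hS.card_pos
    simp only [wp]
    rw [div_le_iff₀ hpos, mul_comm]
    exact (Finset.sum_le_sum fun F hF => (h F hF).le).trans hv⟩

theorem Bd.mono {P : Prog n α} {Q R : α → Prop} {g h : α → ℝ} {v w : ℝ}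
    (hP : Bd κ z π P Q h v) (hQ : ∀ a, Q a → R a) (hg : ∀ a, Q a → g a ≤ h a) (hv : v ≤ w) :
    Bd κ z π P R g w :=
  ⟨hP.sure.mono hQ, ((hP.sure.wp_le hg).trans hP.le).trans hv⟩

theorem Bd.add_const {P : Prog n α} {Q : α → Prop} {g : α → ℝ} {v : ℝ}
    (hP : Bd κ z π P Q g v) (e : ℝ) : Bd κ z π P Q (fun a => g a + e) (v + e) :=
  ⟨hP.sure, by rw [hP.sure.wp_add_const]; linarith [hP.le]⟩

theorem Sure.wp_nonneg {P : Prog n α} {Q : α → Prop} {g : α → ℝ} (hκ : ∀ tag, 0 ≤ κ tag)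
    (hP : Sure z π P Q) (hg : ∀ a, Q a → 0 ≤ g a) : 0 ≤ wp κ z π P g := by
  induction P with
  | done a => exact hg a hP
  | abort => exact le_rfl
  | query tag x next ih => exact add_nonneg (hκ tag) (ih _ hP)
  | sample S next ih =>
    exact div_nonneg (Finset.sum_nonneg fun F hF => ih F (hP.2 F hF)) (Nat.cast_nonneg _)

end calculus

/-! ### Expectations -/

section expectation

variable {β γ : Type}

theorem expectation_pure (b : β) (g : β → ℝ≥0∞) : expectation (PMF.pure b) g = g b := by
  classical
  unfold expectation
  rw [tsum_eq_single b]
  · simp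
  · intro b' hb'
    simp [PMF.pure_apply, hb']

theorem expectation_bind (p : PMF β) (f : β → PMF γ) (g : γ → ℝ≥0∞) :
    expectation (p.bind f) g = expectation p fun b => expectation (f b) g := by
  unfold expectation
  simp only [PMF.bind_apply, ← ENNReal.tsum_mul_right, ← ENNReal.tsum_mul_left, mul_assoc]
  rw [ENNReal.tsum_comm]

theorem expectation_map (p : PMF β) (f : β → γ) (g : γ → ℝ≥0∞) :
    expectation (p.map f) g = expectation p fun b => g (f b) := by
  simp only [PMF.map, expectation_bind, Function.comp, expectation_pure]

theorem expectation_add (p : PMF β) (g h : β → ℝ≥0∞) :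
    expectation p (fun b => g b + h b) = expectation p g + expectation p h := by
  simp only [expectation, mul_add, ENNReal.tsum_add]

theorem expectation_const (p : PMF β) (e : ℝ≥0∞) : expectation p (fun _ => e) = e := by
  simp only [expectation, ENNReal.tsum_mul_right, p.tsum_coe, one_mul]

theorem expectation_mono (p : PMF β) {g h : β → ℝ≥0∞} (hgh : ∀ b ∈ p.support, g b ≤ h b) :
    expectation p g ≤ expectation p h := by
  refine ENNReal.tsum_le_tsum fun b => ?_
  by_cases hb : b ∈ p.support
  · exact mul_le_mul_right (hgh b hb) _
  · simp [(PMF.apply_eq_zero_iff p b).2 hb]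

theorem uniformOn_of_nonempty {n : ℕ} {S : Finset (Fin n → Finset (Fin n))} (hS : S.Nonempty) :
    uniformOn S = PMF.uniformOfFinset S hS := by
  simp [uniformOn, hS]

theorem expectation_uniformOn {n : ℕ} {S : Finset (Fin n → Finset (Fin n))} (hS : S.Nonempty)
    (g : (Fin n → Finset (Fin n)) → ℝ≥0∞) :
    expectation (uniformOn S) g = (∑ F ∈ S, g F) / S.card := by
  classical
  rw [uniformOn_of_nonempty hS]
  unfold expectation
  rw [tsum_eq_sum (s := S)]
  · rw [ENNReal.div_eq_inv_mul, Finset.mul_sum]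
    refine Finset.sum_congr rfl fun F hF => ?_
    rw [PMF.uniformOfFinset_apply_of_mem hS hF]
  · intro F hF
    rw [PMF.uniformOfFinset_apply_of_notMem hS hF, zero_mul]

end expectation

/-! ### From the calculus to the distribution of runs -/

section run

variable {n : ℕ} {α : Type} {z : BitString n} {π : Equiv.Perm (Fin n)}

theorem Sure.alwaysReturns {P : Prog n α} {Q : α → Prop} (hP : Sure z π P Q) :
    P.AlwaysReturns z π Q := by
  unfold Prog.AlwaysReturns
  induction P with
  | done a =>
    intro ω hω
    simp only [Prog.run, PMF.support_pure, Set.mem_singleton_iff] at hω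
    exact ⟨a, by rw [hω], hP⟩
  | abort => exact hP.elim
  | query tag x next ih =>
    intro ω hω
    simp only [Prog.run, PMF.support_map, Set.mem_image] at hω
    obtain ⟨ω', hω', rfl⟩ := hω
    exact ih _ hP ω' hω'
  | sample S next ih =>
    intro ω hω
    simp only [Prog.run, PMF.mem_support_bind_iff] at hω
    obtain ⟨F, hF, hω⟩ := hω
    rw [uniformOn_of_nonempty hP.1, PMF.mem_support_uniformOfFinset_iff] at hF
    exact ih F (hP.2 F hF) ω hω

/-- Connects `wp` with actual runs. A query costs `a`, and `b` more if it is tagged, so one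
recursion serves for the number of all queries as well as for the number of tagged ones. -/
theorem Sure.expectation_run {P : Prog n α} {Q : α → Prop} (hP : Sure z π P Q) {a b : ℝ}
    (ha : 0 ≤ a) (hb : 0 ≤ b) {g : α → ℝ} (hg : ∀ x, 0 ≤ g x) :
    expectation (P.run z π) (fun ω => ENNReal.ofReal a * (ω.2.1 : ℝ≥0∞) +
      ENNReal.ofReal b * (ω.2.2 : ℝ≥0∞) + ω.1.elim 0 fun x => ENNReal.ofReal (g x)) =
    ENNReal.ofReal (wp (fun tag => a + if tag then b else 0) z π P g) := by
  have hκ : ∀ tag : Bool, 0 ≤ a + if tag then b else 0 := fun tag => by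
    split_ifs <;> linarith
  induction P with
  | done x => simp [Prog.run, expectation_pure, wp]
  | abort => exact hP.elim
  | query tag x next ih =>
    have hP' : Sure z π (next (score z π x)) Q := hP
    simp only [Prog.run, expectation_map, wp]
    rw [ENNReal.ofReal_add (hκ tag) (hP'.wp_nonneg hκ fun a _ => hg a), ← ih _ hP,
      ← expectation_const (Prog.run z π (next (score z π x)))
        (ENNReal.ofReal (a + if tag then b else 0)), ← expectation_add]
    congr 1
    funext ω
    rw [ENNReal.ofReal_add ha (by split_ifs <;> linarith)]
    cases tag
    · simp; ring
    · simp; ring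
  | sample S next ih =>
    simp only [Prog.run, expectation_bind, wp]
    rw [expectation_uniformOn hP.1, Finset.sum_congr rfl fun F hF => ih F (hP.2 F hF),
      ENNReal.ofReal_div_of_pos (by exact_mod_cast hP.1.card_pos), ENNReal.ofReal_natCast,
      ENNReal.ofReal_sum_of_nonneg]
    exact fun F hF => (hP.2 F hF).wp_nonneg hκ fun a _ => hg a

theorem Sure.expectedQueries_eq {P : Prog n α} {Q : α → Prop} (hP : Sure z π P Q) :
    P.expectedQueries z π = ENNReal.ofReal (wp (fun _ => 1) z π P fun _ => 0) := by
  have h := hP.expectation_run zero_le_one le_rfl (g := fun _ => 0) fun _ => le_rfl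
  have e : (fun tag : Bool => (1 : ℝ) + if tag then 0 else 0) = fun _ => 1 := by
    funext tag; simp
  rw [e] at h
  rw [← h]
  unfold Prog.expectedQueries
  congr 1
  funext ω
  rcases ω with ⟨_ | _, _, _⟩ <;> simp

end run

/-! ### Scores -/

section score

variable {n : ℕ} {z x : BitString n} {π : Equiv.Perm (Fin n)}

theorem le_score_iff {i : ℕ} (hi : i ≤ n) :
    i ≤ (score z π x : ℕ) ↔ ∀ j : Fin n, (j : ℕ) < i → z (π j) = x (π j) := by
  constructor
  · intro h j hj
    have := Nat.findGreatest_spec (P := fun i => ∀ j : Fin n, (j : ℕ) < i → z (π j) = x (π j))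
      (Nat.zero_le n) fun j hj => absurd hj (Nat.not_lt_zero _)
    exact this j (hj.trans_le h)
  · intro h
    exact Nat.le_findGreatest hi h

theorem lt_score_iff (j : Fin n) :
    (j : ℕ) < score z π x ↔ ∀ i : Fin n, i ≤ j → z (π i) = x (π i) := by
  rw [← Nat.succ_le_iff, le_score_iff (Nat.succ_le_of_lt j.2)]
  simp only [Nat.lt_succ_iff, Fin.le_def]

theorem score_eq_of_ne (j : Fin n) (h : ∀ i : Fin n, i < j → z (π i) = x (π i))
    (hj : z (π j) ≠ x (π j)) : (score z π x : ℕ) = j := by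
  refine le_antisymm ?_ ((le_score_iff j.2.le).2 fun i hi => h i hi)
  by_contra hlt
  exact hj ((lt_score_iff j).1 (not_le.1 hlt) j le_rfl)

theorem flipBits_of_mem {I : Finset (Fin n)} {i : Fin n} (h : i ∈ I) :
    flipBits x I i = !(x i) := by simp [flipBits, h]

theorem flipBits_of_notMem {I : Finset (Fin n)} {i : Fin n} (h : i ∉ I) :
    flipBits x I i = x i := by simp [flipBits, h]

/-- Nothing before position `s` is touched, so the score only reveals whether the wrong bit at `π s`
was corrected. -/
theorem score_flipBits_eq_iff {s : Fin n} {F : Finset (Fin n)}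
    (hx : ∀ j : Fin n, j < s → z (π j) = x (π j)) (hs : z (π s) ≠ x (π s))
    (hF : ∀ j : Fin n, j < s → π j ∉ F) :
    (score z π (flipBits x F) : ℕ) = s ↔ π s ∉ F := by
  have hlow : ∀ j : Fin n, j < s → z (π j) = flipBits x F (π j) := fun j hj => by
    rw [flipBits_of_notMem (hF j hj), hx j hj]
  constructor
  · intro h hmem
    have : (s : ℕ) < score z π (flipBits x F) := by
      rw [lt_score_iff]
      intro i hi
      rcases hi.lt_or_eq with hi | rfl
      · exact hlow i hi
      · rw [flipBits_of_mem hmem]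
        revert hs
        cases z (π i) <;> cases x (π i) <;> simp
    omega
  · intro h
    refine score_eq_of_ne s hlow ?_
    rwa [flipBits_of_notMem h]

end score

/-! ### Random halving of a candidate set -/

/-- The weight of the point `p` in the candidate set `V` of which `a` is the true element: the
weight `1` is distributed evenly among the other elements. -/
noncomputable def share {n : ℕ} (a p : Fin n) (V : Finset (Fin n)) : ℝ :=
  if p ∈ V ∧ p ≠ a then 1 / ((V.card : ℝ) - 1) else 0

/-- What remains of `V` when it is known whether its true element `a` is in `A`. -/
def refine {n : ℕ} (a : Fin n) (V A : Finset (Fin n)) : Finset (Fin n) :=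
  if a ∈ A then A else V \ A

section share

variable {n : ℕ} {a p q : Fin n} {V A : Finset (Fin n)}

theorem share_nonneg : 0 ≤ share a p V := by
  unfold share
  split_ifs with h
  · have : (1 : ℝ) ≤ V.card := by exact_mod_cast Finset.card_pos.2 ⟨p, h.1⟩
    exact div_nonneg zero_le_one (by linarith)
  · exact le_rfl

theorem mem_refine (ha : a ∈ V) : a ∈ refine a V A := by
  unfold refine
  split_ifs with h
  · exact h
  · exact Finset.mem_sdiff.2 ⟨ha, h⟩

theorem refine_subset (hA : A ⊆ V) : refine a V A ⊆ V := by
  unfold refine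
  split_ifs with h
  · exact hA
  · exact Finset.sdiff_subset

theorem share_map (e : Equiv.Perm (Fin n)) (he : e a = a) :
    share a (e p) (V.map e.toEmbedding) = share a p V := by
  have h1 : e p ∈ V.map e.toEmbedding ↔ p ∈ V := by simp
  have h2 : e p = a ↔ p = a := by rw [← e.injective.eq_iff (a := p), he]
  simp only [share, h1, ne_eq, h2, Finset.card_map]

theorem refine_map (e : Equiv.Perm (Fin n)) (he : e a = a) (hV : V.map e.toEmbedding = V) :
    refine a V (A.map e.toEmbedding) = (refine a V A).map e.toEmbedding := by
  have h1 : a ∈ A.map e.toEmbedding ↔ a ∈ A := by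
    conv_lhs => rw [← he]
    simp
  unfold refine
  simp only [h1]
  split_ifs
  · rfl
  · rw [Finset.map_sdiff, hV]

theorem map_swap_eq (hp : p ∈ V) (hq : q ∈ V) :
    V.map (Equiv.swap p q).toEmbedding = V := by
  refine Finset.eq_of_subset_of_card_le ?_ (by simp)
  intro i hi
  simp only [Finset.mem_map, Equiv.coe_toEmbedding] at hi
  obtain ⟨j, hj, rfl⟩ := hi
  rcases eq_or_ne j p with rfl | h1
  · simpa using hq
  rcases eq_or_ne j q with rfl | h2
  · simpa using hp
  rwa [Equiv.swap_apply_of_ne_of_ne h1 h2]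

/-- The transposition of `p` and `q` fixes `a` and `V` and permutes the subsets of a given size,
hence it carries one sum into the other. -/
theorem sum_share_eq (f : ℕ) (hp : p ∈ V) (hq : q ∈ V) (hpa : p ≠ a) (hqa : q ≠ a) :
    ∑ A ∈ V.powersetCard f, share a p (refine a V A) =
      ∑ A ∈ V.powersetCard f, share a q (refine a V A) := by
  set e := Equiv.swap p q
  have he : e a = a := Equiv.swap_apply_of_ne_of_ne hpa.symm hqa.symm
  have hV : V.map e.toEmbedding = V := map_swap_eq hp hq
  refine Finset.sum_equiv e.finsetCongr (fun A => ?_) fun A _ => ?_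
  · simp only [Finset.mem_powersetCard, Equiv.finsetCongr_apply, Finset.card_map]
    nth_rewrite 2 [← hV]
    rw [Finset.map_subset_map]
  · rw [Equiv.finsetCongr_apply, refine_map e he hV,
      ← share_map (p := p) (V := refine a V A) e he]
    simp [e]

/-- There is equality unless `W = {a}`, in which case all shares vanish. -/
theorem sum_share_le_one {W : Finset (Fin n)} (ha : a ∈ W) (hW : W ⊆ V) :
    ∑ q ∈ V.erase a, share a q W ≤ 1 := by
  have h : ∑ q ∈ V.erase a, share a q W = ∑ q ∈ W.erase a, 1 / ((W.card : ℝ) - 1) := by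
    refine (Finset.sum_subset_zero_on_sdiff (Finset.erase_subset_erase a hW) ?_ ?_).symm
    · intro q hq
      simp only [Finset.mem_sdiff, Finset.mem_erase, not_and] at hq
      have : ¬ (q ∈ W ∧ q ≠ a) := fun h => hq.2 h.2 h.1
      simp [share, this]
    · intro q hq
      simp only [Finset.mem_erase] at hq
      simp [share, hq.1, hq.2]
  have hcard : ((W.erase a).card : ℝ) = W.card - 1 := by
    rw [Finset.card_erase_of_mem ha, Nat.cast_sub (Finset.card_pos.2 ⟨a, ha⟩), Nat.cast_one]
  rw [h, Finset.sum_const, nsmul_eq_mul, hcard, mul_one_div]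
  exact div_self_le_one _

/-- The expected share of a point does not increase when a candidate set is tested against a
uniformly random subset of a given size. -/
theorem sum_share_refine_le (f : ℕ) (ha : a ∈ V) (p : Fin n) :
    ∑ A ∈ V.powersetCard f, share a p (refine a V A) ≤
      (V.powersetCard f).card * share a p V := by
  by_cases hp : p ∈ V ∧ p ≠ a
  · have hv : (1 : ℝ) < V.card := by
      exact_mod_cast Finset.one_lt_card.2 ⟨p, hp.1, a, ha, hp.2⟩
    -- By symmetry all elements of `V` other than `a` have the same sum of shares, and for each `A`
    -- their shares add up to at most `1`.
    have h1 : ((V.card : ℝ) - 1) * ∑ A ∈ V.powersetCard f, share a p (refine a V A) ≤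
        (V.powersetCard f).card := by
      have hc : ((V.erase a).card : ℝ) = V.card - 1 := by
        rw [Finset.card_erase_of_mem ha, Nat.cast_sub (Finset.card_pos.2 ⟨a, ha⟩), Nat.cast_one]
      rw [← hc, ← nsmul_eq_mul, ← Finset.sum_const]
      rw [Finset.sum_congr rfl fun q hq => sum_share_eq f hp.1 (Finset.mem_of_mem_erase hq) hp.2
        (Finset.ne_of_mem_erase hq), Finset.sum_comm, Finset.card_eq_sum_ones, Nat.cast_sum]
      refine Finset.sum_le_sum fun A hA => ?_
      rw [Nat.cast_one]
      exact sum_share_le_one (mem_refine ha) (refine_subset (Finset.mem_powersetCard.1 hA).1)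
    rw [share, if_pos hp, mul_one_div, le_div_iff₀ (by linarith)]
    linarith
  · have h0 : ∀ A ∈ V.powersetCard f, share a p (refine a V A) = 0 := fun A hA => by
      have : ¬ (p ∈ refine a V A ∧ p ≠ a) := fun h =>
        hp ⟨refine_subset (Finset.mem_powersetCard.1 hA).1 h.1, h.2⟩
      rw [share, if_neg this]
    rw [Finset.sum_eq_zero h0, share, if_neg hp, mul_zero]

end share

/-! ### Independent random subsets -/

section piFinset

variable {ι β : Type} [Fintype ι] [DecidableEq ι]

/-- Redrawing one coordinate preserves the uniform distribution: `(F, A) ↦ (update F j A, F j)` is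
an involution of the product set. -/
theorem sum_piFinset_update (t : ι → Finset β) (j : ι) (u : (ι → β) → ℝ) :
    ∑ F ∈ Fintype.piFinset t, ∑ A ∈ t j, u (Function.update F j A) =
      (t j).card * ∑ F ∈ Fintype.piFinset t, u F := by
  have h : ∑ w ∈ Fintype.piFinset t ×ˢ t j, u (Function.update w.1 j w.2) =
      ∑ w ∈ Fintype.piFinset t ×ˢ t j, u w.1 := by
    refine Finset.sum_nbij' (fun w => (Function.update w.1 j w.2, w.1 j))
      (fun w => (Function.update w.1 j w.2, w.1 j)) ?_ ?_ ?_ ?_ ?_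
    · rintro ⟨F, A⟩ h
      simp only [Finset.mem_product, Fintype.mem_piFinset] at h ⊢
      refine ⟨fun i => ?_, h.1 j⟩
      rcases eq_or_ne i j with rfl | hij
      · simpa using h.2
      · simpa [hij] using h.1 i
    · rintro ⟨F, A⟩ h
      simp only [Finset.mem_product, Fintype.mem_piFinset] at h ⊢
      refine ⟨fun i => ?_, h.1 j⟩
      rcases eq_or_ne i j with rfl | hij
      · simpa using h.2
      · simpa [hij] using h.1 i
    · rintro ⟨F, A⟩ -
      simp
    · rintro ⟨F, A⟩ -
      simp
    · rintro ⟨F, A⟩ -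
      simp
  rw [Finset.sum_product, Finset.sum_product] at h
  rw [h, Finset.mul_sum]
  exact Finset.sum_congr rfl fun F _ => by simp

/-- It suffices to compare the conditional expectations given all coordinates except `j`. -/
theorem sum_piFinset_le (t : ι → Finset β) (j : ι) (u v : (ι → β) → ℝ)
    (h : ∀ F ∈ Fintype.piFinset t, ∑ A ∈ t j, u (Function.update F j A) ≤
      ∑ A ∈ t j, v (Function.update F j A)) :
    ∑ F ∈ Fintype.piFinset t, u F ≤ ∑ F ∈ Fintype.piFinset t, v F := by
  rcases (t j).eq_empty_or_nonempty with h0 | h0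
  · have : Fintype.piFinset t = ∅ := Finset.eq_empty_of_forall_notMem fun F hF => by
      have := Fintype.mem_piFinset.1 hF j
      simp [h0] at this
    simp [this]
  · have hpos : (0 : ℝ) < (t j).card := by exact_mod_cast h0.card_pos
    refine le_of_mul_le_mul_left ?_ hpos
    rw [← sum_piFinset_update, ← sum_piFinset_update]
    exact Finset.sum_le_sum h

end piFinset

/-! ### Uniformly random families of subsets -/

section families

variable {n : ℕ} {J : Finset (Fin n)} {V F : Fin n → Finset (Fin n)} {r : Fin n → ℕ}

theorem families_nonempty (h : ∀ j ∈ J, r j ≤ (V j).card) : (families J V r).Nonempty := by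
  unfold families
  rw [Fintype.piFinset_nonempty]
  intro j
  split_ifs with hj
  · exact Finset.powersetCard_nonempty.2 (h j hj)
  · exact Finset.singleton_nonempty _

theorem subset_of_mem_families (hF : F ∈ families J V r) {j : Fin n} (hj : j ∈ J) :
    F j ⊆ V j ∧ (F j).card = r j := by
  have := Fintype.mem_piFinset.1 hF j
  rw [if_pos hj] at this
  exact Finset.mem_powersetCard.1 this

theorem sum_families_le {j : Fin n} (hj : j ∈ J) (u v : (Fin n → Finset (Fin n)) → ℝ)
    (h : ∀ F ∈ families J V r, ∑ A ∈ (V j).powersetCard (r j), u (Function.update F j A) ≤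
      ∑ A ∈ (V j).powersetCard (r j), v (Function.update F j A)) :
    ∑ F ∈ families J V r, u F ≤ ∑ F ∈ families J V r, v F := by
  refine sum_piFinset_le _ j u v fun F hF => ?_
  simp only [if_pos hj]
  exact h F hF

end families

theorem ceilDiv_pos {a b : ℕ} (hb : 0 < b) (ha : 0 < a) : 0 < a ⌈/⌉ b := by
  by_contra h
  have : a ⌈/⌉ b ≤ 0 := not_lt.1 h
  rw [ceilDiv_le_iff_le_mul hb] at this
  omega

theorem le_mul_ceilDiv {a b : ℕ} (hb : 0 < b) : a ≤ b * (a ⌈/⌉ b) :=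
  (ceilDiv_le_iff_le_mul hb).1 le_rfl

theorem ceilDiv_lt_self {a b : ℕ} (ha : 2 ≤ a) (hb : 2 ≤ b) : a ⌈/⌉ b < a := by
  have : a ⌈/⌉ b ≤ a - 1 := by
    rw [ceilDiv_le_iff_le_mul (by omega)]
    have : 2 * (a - 1) ≤ b * (a - 1) := Nat.mul_le_mul_right _ hb
    omega
  omega

/-! ### Random binary search -/

section binarySearch

variable {n : ℕ} {κ : Bool → ℝ} {z x : BitString n} {π : Equiv.Perm (Fin n)} {s : Fin n}

theorem card_refine_le {a : Fin n} {V A : Finset (Fin n)} (hA : A ⊆ V) (b : ℕ)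
    (h1 : A.card ≤ b) (h2 : V.card ≤ A.card + b) : (refine a V A).card ≤ b := by
  unfold refine
  split_ifs
  · exact h1
  · rw [Finset.card_sdiff_of_subset hA]
    omega

/-- Either answer leaves at most half of `V`, rounded up, so `D` queries suffice. The tested half is
uniformly random, so no expected share grows; this holds for every nonnegative combination `w` of
the shares. -/
theorem randBinSearch_bd (hκ : 0 ≤ κ false) (hx : ∀ j : Fin n, j < s → z (π j) = x (π j))
    (hs : z (π s) ≠ x (π s)) {m : ℕ} (hm : 1 ≤ m) {w : Fin n → ℝ} (hw : ∀ p, 0 ≤ w p) (N : ℕ) :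
    ∀ (V : Finset (Fin n)) (D : ℕ), V.card < N → V.card ≤ 2 ^ D * m → π s ∈ V →
      (∀ j : Fin n, j < s → π j ∉ V) →
      Bd κ z π (randBinSearch x s m N V) (fun W => W ⊆ V ∧ π s ∈ W ∧ W.card ≤ m)
        (fun W => ∑ p, w p * share (π s) p W)
        (D * κ false + ∑ p, w p * share (π s) p V) := by
  induction N with
  | zero => intro V D h; omega
  | succ N ih =>
    intro V D hN hD hmem hlow
    unfold randBinSearch
    by_cases hV : m < V.card
    · rw [if_pos hV]
      obtain ⟨D, rfl⟩ : ∃ D', D = D' + 1 := by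
        rcases D with _ | D
        · simp at hD; omega
        · exact ⟨D, rfl⟩
      have hf : V.card ⌈/⌉ 2 ≤ V.card := (ceilDiv_lt_self (by omega) le_rfl).le
      refine Bd.sample (u := fun F => (D + 1) * κ false +
        ∑ p, w p * share (π s) p (refine (π s) V (F s)))
        (families_nonempty fun j _ => hf) (fun F hF => ?_) ?_
      · have hFs := subset_of_mem_families hF (Finset.mem_singleton_self s)
        refine Bd.ask ?_
        have hr : (if ((score z π (flipBits x (F s)) : Fin (n + 1)) : ℕ) = (s : ℕ) then V \ F s
            else F s) = refine (π s) V (F s) := by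
          have := score_flipBits_eq_iff hx hs fun j hj h => hlow j hj (hFs.1 h)
          unfold refine
          by_cases h : π s ∈ F s
          · rw [if_neg (fun h' => (this.1 h') h), if_pos h]
          · rw [if_pos (this.2 h), if_neg h]
        rw [hr]
        have hsub := refine_subset (a := π s) hFs.1
        have hcard : (refine (π s) V (F s)).card ≤ V.card ⌈/⌉ 2 := by
          have := le_mul_ceilDiv (a := V.card) two_pos
          exact card_refine_le hFs.1 _ hFs.2.le (by omega)
        have hlt := ceilDiv_lt_self (a := V.card) (by omega) le_rfl
        refine (ih (refine (π s) V (F s)) D (by omega) ?_ (mem_refine hmem)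
          fun j hj h => hlow j hj (hsub h)).mono ?_ ?_ ?_
        · refine hcard.trans ((ceilDiv_le_iff_le_mul two_pos).2 (hD.trans_eq ?_))
          ring
        · exact fun W hW => ⟨hW.1.trans hsub, hW.2⟩
        · exact fun _ _ => le_rfl
        · linarith
      · rw [Finset.sum_add_distrib, Finset.sum_const, nsmul_eq_mul, mul_add, Nat.cast_succ]
        refine add_le_add le_rfl ?_
        rw [← nsmul_eq_mul, ← Finset.sum_const]
        refine sum_families_le (Finset.mem_singleton_self s) _ _ fun F _ => ?_
        simp only [Function.update_self]
        rw [Finset.sum_comm, Finset.sum_const, nsmul_eq_mul, Finset.mul_sum]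
        refine Finset.sum_le_sum fun p _ => ?_
        rw [← Finset.mul_sum, mul_left_comm]
        exact mul_le_mul_of_nonneg_left (sum_share_refine_le _ hmem p) (hw p)
    · rw [if_neg hV]
      refine Bd.done ⟨subset_rfl, hmem, not_lt.1 hV⟩ ?_
      have : 0 ≤ D * κ false := mul_nonneg (Nat.cast_nonneg _) hκ
      linarith

end binarySearch

/-! ### A single trial of a reduction step -/

/-- The sets `V j`, for `j < s`, are disjoint, and `V j` contains `π j`. -/
structure Cand {n : ℕ} (π : Equiv.Perm (Fin n)) (s : ℕ) (V : Fin n → Finset (Fin n)) : Prop where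
  mem : ∀ j : Fin n, (j : ℕ) < s → π j ∈ V j
  disj : ∀ i j : Fin n, (i : ℕ) < s → (j : ℕ) < s → i ≠ j → Disjoint (V i) (V j)

theorem Cand.of_subset {n : ℕ} {π : Equiv.Perm (Fin n)} {s : ℕ} {V V' : Fin n → Finset (Fin n)}
    (h : Cand π s V) (hmem : ∀ j : Fin n, (j : ℕ) < s → π j ∈ V' j) (hsub : ∀ j, V' j ⊆ V j) :
    Cand π s V' :=
  ⟨hmem, fun i j hi hj hij => (h.disj i j hi hj hij).mono (hsub i) (hsub j)⟩

/-- The candidate sets after a trial with the random sets `F j`, `j ∈ J`. -/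
def afterTrial {n : ℕ} (π : Equiv.Perm (Fin n)) (J : Finset (Fin n))
    (V F : Fin n → Finset (Fin n)) (j : Fin n) : Finset (Fin n) :=
  if j ∈ J ∧ ∀ i ∈ J, i < j → π i ∉ F i then refine (π j) (V j) (F j) else V j

/-- A nonnegative combination of shares. -/
noncomputable def potential {n : ℕ} (π : Equiv.Perm (Fin n)) (w : Fin n → Fin n → ℝ)
    (V : Fin n → Finset (Fin n)) : ℝ :=
  ∑ j, ∑ p, w j p * share (π j) p (V j)

section trial

variable {n : ℕ} {z x : BitString n} {π : Equiv.Perm (Fin n)} {s k : ℕ}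
  {J : Finset (Fin n)} {V F : Fin n → Finset (Fin n)} {r : Fin n → ℕ}

/-- Because the candidate sets are disjoint, `F j` cannot affect `π i` for another treated position
`i`; a joint query is thus a simultaneous test of all `j ∈ J`. -/
theorem mem_biUnion_iff (hV : Cand π s V) (hJ : ∀ j ∈ J, (j : ℕ) < s) (hF : ∀ j ∈ J, F j ⊆ V j)
    {i : Fin n} (hi : (i : ℕ) < s) : π i ∈ J.biUnion F ↔ i ∈ J ∧ π i ∈ F i := by
  rw [Finset.mem_biUnion]
  constructor
  · rintro ⟨j, hj, hij⟩
    rcases eq_or_ne i j with rfl | hne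
    · exact ⟨hj, hij⟩
    · exact (Finset.disjoint_left.1 (hV.disj i j hi (hJ j hj) hne) (hV.mem i hi)
        (hF j hj hij)).elim
  · exact fun h => ⟨i, h⟩

theorem lt_score_trial_iff (hx : ∀ j : Fin n, (j : ℕ) < s → z (π j) = x (π j)) (hV : Cand π s V)
    (hJ : ∀ j ∈ J, (j : ℕ) < s) (hF : ∀ j ∈ J, F j ⊆ V j) {j : Fin n} (hj : (j : ℕ) < s) :
    (j : ℕ) < score z π (flipBits x (J.biUnion F)) ↔ ∀ i ∈ J, i ≤ j → π i ∉ F i := by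
  rw [lt_score_iff]
  have key : ∀ i : Fin n, i ≤ j →
      (z (π i) = flipBits x (J.biUnion F) (π i) ↔ ¬ (i ∈ J ∧ π i ∈ F i)) := fun i hi => by
    have his : (i : ℕ) < s := lt_of_le_of_lt hi hj
    rw [← mem_biUnion_iff hV hJ hF his]
    by_cases h : π i ∈ J.biUnion F
    · rw [flipBits_of_mem h, hx i his]
      simp [h]
    · rw [flipBits_of_notMem h, hx i his]
      simp [h]
  constructor
  · intro h i hiJ hi hmem
    exact (key i hi).1 (h i hi) ⟨hiJ, hmem⟩
  · intro h i hi
    exact (key i hi).2 fun hh => h i hh.1 hi hh.2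

theorem offTrial_iff (hx : ∀ j : Fin n, (j : ℕ) < s → z (π j) = x (π j)) (hV : Cand π s V)
    (hJ : ∀ j ∈ J, (j : ℕ) < s) (hF : ∀ j ∈ J, F j ⊆ V j) :
    (∀ j ∈ J, (j : ℕ) < score z π (flipBits x (J.biUnion F))) ↔ ∀ i ∈ J, π i ∉ F i := by
  constructor
  · intro h i hi
    exact (lt_score_trial_iff hx hV hJ hF (hJ i hi)).1 (h i hi) i hi le_rfl
  · intro h j hj
    exact (lt_score_trial_iff hx hV hJ hF (hJ j hj)).2 fun i hi _ => h i hi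

theorem exists_score_eq (hx : ∀ j : Fin n, (j : ℕ) < s → z (π j) = x (π j)) (hV : Cand π s V)
    (hJ : ∀ j ∈ J, (j : ℕ) < s) (hF : ∀ j ∈ J, F j ⊆ V j) (h : ¬ ∀ i ∈ J, π i ∉ F i) :
    ∃ i ∈ J, π i ∈ F i ∧ (∀ j ∈ J, j < i → π j ∉ F j) ∧
      (score z π (flipBits x (J.biUnion F)) : ℕ) = i := by
  classical
  push Not at h
  obtain ⟨i₀, hi₀, hmem₀⟩ := h
  have hne : (J.filter fun i => π i ∈ F i).Nonempty := ⟨i₀, Finset.mem_filter.2 ⟨hi₀, hmem₀⟩⟩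
  obtain ⟨i, hi⟩ : ∃ i, i = (J.filter fun i => π i ∈ F i).min' hne := ⟨_, rfl⟩
  have hiJ := Finset.mem_filter.1 (hi ▸ Finset.min'_mem _ hne)
  have hmin : ∀ j ∈ J, j < i → π j ∉ F j := fun j hj hji hmem =>
    absurd (Finset.min'_le _ j (Finset.mem_filter.2 ⟨hj, hmem⟩)) (not_le.2 (hi ▸ hji))
  refine ⟨i, hiJ.1, hiJ.2, hmin, le_antisymm ?_ ?_⟩
  · by_contra hlt
    exact (lt_score_trial_iff hx hV hJ hF (hJ i hiJ.1)).1 (not_le.1 hlt) i hiJ.1 le_rfl hiJ.2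
  · rw [le_score_iff i.2.le]
    intro j hj
    have hjs : (j : ℕ) < s := hj.trans (hJ i hiJ.1)
    have := (lt_score_trial_iff hx hV hJ hF hjs).2 fun i' hi' hle =>
      hmin i' hi' (lt_of_le_of_lt hle hj)
    exact (lt_score_iff j).1 this j le_rfl

/-- The score is the first `i ∈ J` with `π i ∈ F i`, if there is one. Sets before it are known to
miss their `F j`, and about the sets after it nothing is learned. So the update computed from the
score agrees with `afterTrial`, which is phrased by means of the secret. -/
theorem trial_eq (hx : ∀ j : Fin n, (j : ℕ) < s → z (π j) = x (π j)) (hV : Cand π s V)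
    (hJ : ∀ j ∈ J, (j : ℕ) < s) (hF : ∀ j ∈ J, F j ⊆ V j) {ρ : ℕ}
    (hρ : ρ = score z π (flipBits x (J.biUnion F))) :
    (if ∀ j ∈ J, (j : ℕ) < ρ then
        fun j => if j ∈ J then V j \ F j else V j
      else
        fun j =>
          if (j : ℕ) = ρ then F j
          else if j ∈ J ∧ (j : ℕ) < ρ then V j \ F j
          else V j) = afterTrial π J V F := by
  funext j
  by_cases hoff : ∀ i ∈ J, π i ∉ F i
  · have h := (offTrial_iff hx hV hJ hF).2 hoff
    rw [← hρ] at h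
    rw [if_pos h]
    unfold afterTrial
    by_cases hj : j ∈ J
    · rw [if_pos hj, if_pos ⟨hj, fun i hi _ => hoff i hi⟩, refine, if_neg (hoff j hj)]
    · rw [if_neg hj, if_neg fun h => hj h.1]
  · have h := mt (offTrial_iff hx hV hJ hF).1 hoff
    obtain ⟨i, hi, hmem, hmin, hi'⟩ := exists_score_eq hx hV hJ hF hoff
    rw [← hρ] at h hi'
    rw [if_neg h, hi']
    unfold afterTrial
    by_cases hji : j = i
    · subst hji
      rw [if_pos rfl, if_pos ⟨hi, hmin⟩, refine, if_pos hmem]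
    · rw [if_neg fun h => hji (Fin.ext h)]
      by_cases hlt : j ∈ J ∧ (j : ℕ) < i
      · rw [if_pos hlt, if_pos ⟨hlt.1, fun i' hi' hlt' => hmin i' hi' (hlt'.trans hlt.2)⟩, refine,
          if_neg (hmin j hlt.1 hlt.2)]
      · rw [if_neg hlt, if_neg]
        rintro ⟨hj, hall⟩
        have hij : i < j := lt_of_le_of_ne (not_lt.1 fun h => hlt ⟨hj, h⟩) (Ne.symm hji)
        exact hall i hi hij hmem

theorem afterTrial_subset (hF : ∀ j ∈ J, F j ⊆ V j) (j : Fin n) : afterTrial π J V F j ⊆ V j := by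
  unfold afterTrial
  split_ifs with h
  · exact refine_subset (hF j h.1)
  · exact subset_rfl

theorem mem_afterTrial {j : Fin n} (h : π j ∈ V j) : π j ∈ afterTrial π J V F j := by
  unfold afterTrial
  split_ifs
  · exact mem_refine h
  · exact h

theorem afterTrial_of_notMem {j : Fin n} (h : j ∉ J) : afterTrial π J V F j = V j :=
  if_neg fun h' => h h'.1

theorem afterTrial_of_off (h : ∀ i ∈ J, π i ∉ F i) {j : Fin n} (hj : j ∈ J) :
    afterTrial π J V F j = V j \ F j := by
  rw [afterTrial, if_pos ⟨hj, fun i hi _ => h i hi⟩, refine, if_neg (h j hj)]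

/-- The set of the first index with `π i ∈ F i` is cut down to the small set `F i`; this is the
progress made by an on-trial. -/
theorem exists_afterTrial_eq (h : ¬ ∀ i ∈ J, π i ∉ F i) :
    ∃ j ∈ J, afterTrial π J V F j = F j := by
  classical
  push Not at h
  obtain ⟨i₀, hi₀, hmem₀⟩ := h
  have hne : (J.filter fun i => π i ∈ F i).Nonempty := ⟨i₀, Finset.mem_filter.2 ⟨hi₀, hmem₀⟩⟩
  obtain ⟨i, hi⟩ : ∃ i, i = (J.filter fun i => π i ∈ F i).min' hne := ⟨_, rfl⟩
  have hiJ := Finset.mem_filter.1 (hi ▸ Finset.min'_mem _ hne)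
  refine ⟨i, hiJ.1, ?_⟩
  rw [afterTrial, if_pos ⟨hiJ.1, fun j hj hji hmem =>
    absurd (Finset.min'_le _ j (Finset.mem_filter.2 ⟨hj, hmem⟩)) (not_le.2 (hi ▸ hji))⟩, refine,
    if_pos hiJ.2]

/-- Whether `V j` is refined depends only on the `F i` with `i < j`. Given these, `F j` is still
uniform, so the bound for a single refinement applies. -/
theorem sum_share_afterTrial_le (hmem : ∀ j ∈ J, π j ∈ V j) (j p : Fin n) :
    ∑ F ∈ families J V r, share (π j) p (afterTrial π J V F j) ≤
      (families J V r).card * share (π j) p (V j) := by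
  rw [← nsmul_eq_mul, ← Finset.sum_const]
  by_cases hj : j ∈ J
  · refine sum_families_le hj _ _ fun F _ => ?_
    by_cases hlow : ∀ i ∈ J, i < j → π i ∉ F i
    · have h : ∀ A, afterTrial π J V (Function.update F j A) j = refine (π j) (V j) A := by
        intro A
        rw [afterTrial, if_pos, Function.update_self]
        refine ⟨hj, fun i hi hij => ?_⟩
        rw [Function.update_of_ne hij.ne]
        exact hlow i hi hij
      simp only [h, Finset.sum_const, nsmul_eq_mul]
      exact sum_share_refine_le _ (hmem j hj) p
    · have h : ∀ A, afterTrial π J V (Function.update F j A) j = V j := by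
        intro A
        rw [afterTrial, if_neg]
        rintro ⟨-, h⟩
        refine hlow fun i hi hij => ?_
        have := h i hi hij
        rwa [Function.update_of_ne hij.ne] at this
      simp only [h]
      exact le_rfl
  · exact Finset.sum_le_sum fun F _ => by rw [afterTrial_of_notMem hj]

theorem sum_potential_afterTrial_le (hmem : ∀ j ∈ J, π j ∈ V j) {w : Fin n → Fin n → ℝ}
    (hw : ∀ j p, 0 ≤ w j p) :
    ∑ F ∈ families J V r, potential π w (afterTrial π J V F) ≤
      (families J V r).card * potential π w V := by
  unfold potential
  rw [Finset.sum_comm, Finset.mul_sum]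
  refine Finset.sum_le_sum fun j _ => ?_
  rw [Finset.sum_comm, Finset.mul_sum]
  refine Finset.sum_le_sum fun p _ => ?_
  rw [← Finset.mul_sum, mul_left_comm]
  exact mul_le_mul_of_nonneg_left (sum_share_afterTrial_le hmem j p) (hw j p)

/-- Since `(1 - 1/k) * (1 + 1/k) ≤ 1`, the power is at most `1 / (1 + 1/k) ^ l`, and Bernoulli's
inequality bounds this. -/
theorem pow_le_div_add (hk : 1 ≤ k) (l : ℕ) :
    (1 - 1 / (k : ℝ)) ^ l ≤ (k : ℝ) / (k + l) := by
  have hk' : (1 : ℝ) ≤ k := by exact_mod_cast hk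
  have h1 : (1 + 1 / (k : ℝ)) ^ l ≥ 1 + l * (1 / (k : ℝ)) :=
    one_add_mul_le_pow (by have : 0 ≤ 1 / (k : ℝ) := by positivity
                           linarith) l
  have h0 : 0 ≤ 1 - 1 / (k : ℝ) := by
    rw [sub_nonneg, div_le_one (by linarith)]; exact hk'
  have h2 : (1 - 1 / (k : ℝ)) ^ l * (1 + 1 / (k : ℝ)) ^ l ≤ 1 := by
    rw [← mul_pow]
    refine pow_le_one₀ (mul_nonneg h0 (by positivity)) ?_
    have : 0 ≤ (1 / (k : ℝ)) ^ 2 := by positivity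
    nlinarith
  have h3 : (1 - 1 / (k : ℝ)) ^ l * (1 + l * (1 / (k : ℝ))) ≤ 1 :=
    (mul_le_mul_of_nonneg_left h1 (pow_nonneg h0 l)).trans h2
  rw [le_div_iff₀ (by positivity)]
  have h4 : (k : ℝ) + l = k * (1 + l * (1 / (k : ℝ))) := by field_simp
  rw [h4]
  nlinarith

/-- Among the subsets of size `f` of `v` elements, the proportion of those that avoid a given
element is `1 - f / v`, and `f = ⌈v / k⌉` is at least `v / k`. -/
theorem choose_le (hk : 1 ≤ k) {v : ℕ} (hv : 1 ≤ v) :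
    (((v - 1).choose (v ⌈/⌉ k) : ℕ) : ℝ) ≤ (1 - 1 / (k : ℝ)) * (v.choose (v ⌈/⌉ k) : ℕ) := by
  have hle := le_mul_ceilDiv (a := v) (b := k) hk
  have hfv : v ⌈/⌉ k ≤ v := (ceilDiv_le_iff_le_mul hk).2 (Nat.le_mul_of_pos_left v hk)
  set f := v ⌈/⌉ k
  obtain ⟨u, rfl⟩ : ∃ u, v = u + 1 := ⟨v - 1, by omega⟩
  have h := Nat.choose_mul_succ_eq u f
  have hk' : (1 : ℝ) ≤ k := by exact_mod_cast hk
  have h' : ((u.choose f : ℕ) : ℝ) * (u + 1) = ((u + 1).choose f : ℕ) * ((u + 1 : ℝ) - f) := by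
    have := congrArg (Nat.cast (R := ℝ)) h
    push_cast [Nat.cast_sub hfv] at this
    exact this
  have hle' : ((u : ℝ) + 1) ≤ k * f := by exact_mod_cast hle
  rw [Nat.add_sub_cancel]
  have hpos : (0 : ℝ) < u + 1 := by positivity
  refine le_of_mul_le_mul_right ?_ hpos
  rw [h', mul_right_comm, mul_comm]
  refine mul_le_mul_of_nonneg_right ?_ (Nat.cast_nonneg _)
  have : ((u : ℝ) + 1) / k ≤ f := by
    rw [div_le_iff₀ (by linarith)]; linarith
  have e : (1 - 1 / (k : ℝ)) * (u + 1) = (u + 1) - (u + 1) / k := by ring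
  linarith

/-- In an off-trial each of the independent sets `F j` misses `π j`, which has probability at most
`1 - 1/k` for each `j ∈ J`. -/
theorem card_off_le (hk : 1 ≤ k) (hmem : ∀ j ∈ J, π j ∈ V j) :
    ((((families J V fun j => (V j).card ⌈/⌉ k).filter fun F => ∀ i ∈ J, π i ∉ F i).card : ℕ) : ℝ) ≤
      (k : ℝ) / (k + J.card) * (families J V fun j => (V j).card ⌈/⌉ k).card := by
  have h1 : ((families J V fun j => (V j).card ⌈/⌉ k).filter fun F => ∀ i ∈ J, π i ∉ F i) ⊆
      Fintype.piFinset fun j => if j ∈ J then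
        ((V j).erase (π j)).powersetCard ((V j).card ⌈/⌉ k) else {∅} := by
    intro F hF
    rw [Finset.mem_filter] at hF
    rw [Fintype.mem_piFinset]
    intro j
    have := Fintype.mem_piFinset.1 hF.1 j
    split_ifs at this ⊢ with hj
    · rw [Finset.mem_powersetCard] at this ⊢
      exact ⟨fun i hi => Finset.mem_erase.2 ⟨fun h => hF.2 j hj (h ▸ hi), this.1 hi⟩, this.2⟩
    · exact this
  have h2 : (((Fintype.piFinset fun j => if j ∈ J then
        ((V j).erase (π j)).powersetCard ((V j).card ⌈/⌉ k) else {∅}).card : ℕ) : ℝ) ≤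
      (1 - 1 / (k : ℝ)) ^ J.card * (families J V fun j => (V j).card ⌈/⌉ k).card := by
    unfold families
    rw [Fintype.card_piFinset, Fintype.card_piFinset, ← Finset.prod_const, Nat.cast_prod,
      Nat.cast_prod]
    have : ∏ _j ∈ J, (1 - 1 / (k : ℝ)) = ∏ j, if j ∈ J then (1 - 1 / (k : ℝ)) else 1 := by
      rw [Finset.prod_ite_mem, Finset.univ_inter]
    rw [this, ← Finset.prod_mul_distrib]
    refine Finset.prod_le_prod (fun _ _ => Nat.cast_nonneg _) fun j _ => ?_
    split_ifs with hj
    · rw [Finset.card_powersetCard, Finset.card_powersetCard,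
        Finset.card_erase_of_mem (hmem j hj)]
      exact choose_le hk (Finset.card_pos.2 ⟨_, hmem j hj⟩)
    · simp
  exact (Nat.cast_le.2 (Finset.card_le_card h1)).trans (h2.trans
    (mul_le_mul_of_nonneg_right (pow_le_div_add hk _) (Nat.cast_nonneg _)))

end trial

/-! ### Reduction steps -/

/-- The expected number of trials that are still to be made in a phase that started with `l`
indices, when there were `o` off-trials and `j` indices are left. -/
noncomputable def trialBudget (c : ℝ) (k l o j : ℕ) : ℝ :=
  ((⌈c * k⌉₊ - o : ℕ) : ℝ) + j + (1 + k / ((l / 2 : ℕ) + 1 : ℝ)) * ((j - l / 2 : ℕ) : ℝ)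

/-- `V'` arises from `V` by shrinking only sets with indices in `J`, and keeps the elements `π j`. -/
structure Shrinks {n : ℕ} (π : Equiv.Perm (Fin n)) (s : ℕ) (J : Finset (Fin n))
    (V V' : Fin n → Finset (Fin n)) : Prop where
  sub : ∀ j, V' j ⊆ V j
  mem : ∀ j : Fin n, (j : ℕ) < s → π j ∈ V' j
  eq : ∀ j ∉ J, V' j = V j

section reduction

variable {n : ℕ} {z x : BitString n} {π : Equiv.Perm (Fin n)} {s k m l : ℕ} {c : ℝ}
  {κ : Bool → ℝ} {tag : Bool}

theorem Shrinks.trans {J J' : Finset (Fin n)} {V V' V'' : Fin n → Finset (Fin n)}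
    (h : Shrinks π s J V V') (h' : Shrinks π s J' V' V'') (hJ : J' ⊆ J) :
    Shrinks π s J V V'' :=
  ⟨fun j => (h'.sub j).trans (h.sub j), h'.mem, fun j hj => by
    rw [h'.eq j fun hj' => hj (hJ hj'), h.eq j hj]⟩

theorem Shrinks.cand {J : Finset (Fin n)} {V V' : Fin n → Finset (Fin n)}
    (h : Shrinks π s J V V') (hV : Cand π s V) : Cand π s V' := hV.of_subset h.mem h.sub

theorem Shrinks.mono {J J' : Finset (Fin n)} {V V' : Fin n → Finset (Fin n)}
    (h : Shrinks π s J V V') (hJ : J ⊆ J') : Shrinks π s J' V V' :=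
  ⟨h.sub, h.mem, fun j hj => h.eq j fun hj' => hj (hJ hj')⟩

theorem Cand.shrinks {V : Fin n → Finset (Fin n)} (hV : Cand π s V) (J : Finset (Fin n)) :
    Shrinks π s J V V := ⟨fun _ => subset_rfl, hV.mem, fun _ _ => rfl⟩

theorem trialBudget_nonneg (o j : ℕ) : 0 ≤ trialBudget c k l o j := by
  unfold trialBudget; positivity

theorem trialBudget_mono {o o' j j' : ℕ} (ho : o ≤ o') (hj : j' ≤ j) :
    trialBudget c k l o' j' ≤ trialBudget c k l o j := by
  unfold trialBudget
  have h1 : ((⌈c * k⌉₊ - o' : ℕ) : ℝ) ≤ (⌈c * k⌉₊ - o : ℕ) := by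
    exact_mod_cast Nat.sub_le_sub_left ho _
  have h2 : (j' : ℝ) ≤ j := by exact_mod_cast hj
  have h3 : ((j' - l / 2 : ℕ) : ℝ) ≤ (j - l / 2 : ℕ) := by
    exact_mod_cast Nat.sub_le_sub_right hj _
  gcongr

theorem trialBudget_succ_le {o j : ℕ} (h : o < ⌈c * k⌉₊) :
    1 + trialBudget c k l (o + 1) j ≤ trialBudget c k l o j := by
  unfold trialBudget
  have : ((⌈c * k⌉₊ - o : ℕ) : ℝ) = (⌈c * k⌉₊ - (o + 1) : ℕ) + 1 := by
    have : ⌈c * k⌉₊ - o = (⌈c * k⌉₊ - (o + 1)) + 1 := by omega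
    exact_mod_cast this
  linarith

theorem trialBudget_pred_le {o j : ℕ} (h : 1 ≤ j) :
    1 + trialBudget c k l o (j - 1) ≤ trialBudget c k l o j := by
  have h0 : trialBudget c k l o (j - 1) + 1 ≤ trialBudget c k l o j := by
    unfold trialBudget
    have h3 : ((j - 1 - l / 2 : ℕ) : ℝ) ≤ (j - l / 2 : ℕ) := by
      exact_mod_cast Nat.sub_le_sub_right (Nat.sub_le _ _) _
    have h4 : ((j - 1 : ℕ) : ℝ) = j - 1 := by push_cast [Nat.cast_sub h]; ring
    have h5 : (1 + k / ((l / 2 : ℕ) + 1 : ℝ)) * ((j - 1 - l / 2 : ℕ) : ℝ) ≤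
      (1 + k / ((l / 2 : ℕ) + 1 : ℝ)) * ((j - l / 2 : ℕ) : ℝ) := by gcongr
    linarith
  linarith

theorem trialBudget_pred_le' {o j : ℕ} (h : l / 2 < j) :
    trialBudget c k l o (j - 1) + (1 + (1 + k / ((l / 2 : ℕ) + 1 : ℝ))) ≤
      trialBudget c k l o j := by
  unfold trialBudget
  have h3 : ((j - 1 - l / 2 : ℕ) : ℝ) = (j - l / 2 : ℕ) - 1 := by
    have : j - l / 2 = (j - 1 - l / 2) + 1 := by omega
    rw [this]; push_cast; ring
  have h4 : ((j - 1 : ℕ) : ℝ) = j - 1 := by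
    push_cast [Nat.cast_sub (show 1 ≤ j by omega)]; ring
  rw [h3, h4]
  linarith

/-- One trial reduces the expected remaining number of trials by one. -/
theorem sum_trialBudget_le {J : Finset (Fin n)} {V : Fin n → Finset (Fin n)}
    (hk : 1 ≤ k) (hmem : ∀ j ∈ J, π j ∈ V j) {o : ℕ}
    (hcont : ¬ (c * (k : ℝ) ≤ (o : ℝ) ∧ 2 * J.card ≤ l))
    (u : (Fin n → Finset (Fin n)) → ℝ)
    (hoff : ∀ F ∈ families J V (fun j => (V j).card ⌈/⌉ k), (∀ i ∈ J, π i ∉ F i) →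
      u F ≤ trialBudget c k l (o + 1) J.card)
    (hon : ∀ F ∈ families J V (fun j => (V j).card ⌈/⌉ k), (¬ ∀ i ∈ J, π i ∉ F i) →
      1 ≤ J.card ∧ u F ≤ trialBudget c k l o (J.card - 1)) :
    ∑ F ∈ families J V (fun j => (V j).card ⌈/⌉ k), (1 + u F) ≤
      (families J V (fun j => (V j).card ⌈/⌉ k)).card * trialBudget c k l o J.card := by
  classical
  set fam := families J V (fun j => (V j).card ⌈/⌉ k) with hfam
  -- When at most `l / 2` indices are left, the phase lacks only off-trials, and each trial consumes
  -- a unit of the off-trial term or of the index term. Otherwise off-trials get no credit, and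
  -- on-trials must release enough for them as well.
  rcases le_or_gt J.card (l / 2) with hle | hlt
  · have ho : o < ⌈c * k⌉₊ := by
      rw [Nat.lt_ceil]
      by_contra h
      exact hcont ⟨not_lt.1 h, by omega⟩
    rw [← nsmul_eq_mul, ← Finset.sum_const]
    refine Finset.sum_le_sum fun F hF => ?_
    by_cases h : ∀ i ∈ J, π i ∉ F i
    · linarith [hoff F hF h, trialBudget_succ_le (l := l) (j := J.card) ho]
    · obtain ⟨h1, h2⟩ := hon F hF h
      linarith [trialBudget_pred_le (c := c) (k := k) (l := l) (o := o) h1]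
  · set A : ℝ := 1 + (1 + k / ((l / 2 : ℕ) + 1 : ℝ)) with hA
    set T := trialBudget c k l o J.card
    have hpt : ∀ F ∈ fam, 1 + u F ≤
        (1 + T - A) + if ∀ i ∈ J, π i ∉ F i then A else 0 := fun F hF => by
      split_ifs with h
      · have h1 := hoff F hF h
        have h2 : trialBudget c k l (o + 1) J.card ≤ T := trialBudget_mono (Nat.le_succ _) le_rfl
        linarith
      · have h1 := (hon F hF h).2
        have h2 := trialBudget_pred_le' (c := c) (k := k) (o := o) hlt
        linarith
    refine (Finset.sum_le_sum hpt).trans ?_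
    rw [Finset.sum_add_distrib, Finset.sum_const, ← Finset.sum_filter, Finset.sum_const,
      nsmul_eq_mul, nsmul_eq_mul]
    have hc := card_off_le hk hmem
    rw [← hfam] at hc
    have hkpos : (0 : ℝ) < k := by exact_mod_cast hk
    have hJpos : (0 : ℝ) < J.card := by exact_mod_cast (by omega : 0 < J.card)
    have hApos : 0 ≤ A := by positivity
    have hc' := mul_le_mul_of_nonneg_right hc hApos
    -- An on-trial releases `A` and has probability at least `|J| / (k + |J|)`. It pays for one
    -- trial on average if `A ≥ 1 + k / |J|`, and here `|J| ≥ ⌊l / 2⌋ + 1`.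
    have hmain : 1 + (k : ℝ) / (k + J.card) * A ≤ A := by
      have h1 : (k : ℝ) / J.card ≤ k / ((l / 2 : ℕ) + 1 : ℝ) := by
        gcongr
        exact_mod_cast (by omega : l / 2 + 1 ≤ J.card)
      have h2 : (k : ℝ) / (k + J.card) = 1 - J.card / (k + J.card) := by
        field_simp; ring
      have h3 : 1 ≤ (J.card : ℝ) / (k + J.card) * A := by
        have h4 : 1 + (k : ℝ) / J.card ≤ A := by rw [hA]; linarith
        refine le_trans ?_ (mul_le_mul_of_nonneg_left h4 (by positivity))
        have h5 : (J.card : ℝ) / (k + J.card) * (1 + (k : ℝ) / J.card) = 1 := by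
          field_simp; ring
        exact h5.ge
      rw [h2]; linarith
    have hmain' := mul_le_mul_of_nonneg_left hmain (Nat.cast_nonneg (α := ℝ) fam.card)
    nlinarith

theorem card_sdiff_le {A V : Finset (Fin n)} (hA : A ⊆ V) (hk : 1 ≤ k)
    (hcard : A.card = V.card ⌈/⌉ k) :
    ((V \ A).card : ℝ) ≤ (1 - 1 / (k : ℝ)) * V.card := by
  rw [Finset.card_sdiff_of_subset hA, Nat.cast_sub (Finset.card_le_card hA), hcard]
  have h := le_mul_ceilDiv (a := V.card) (b := k) hk
  have hk' : (0 : ℝ) < k := by exact_mod_cast hk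
  have h' : (V.card : ℝ) ≤ k * (V.card ⌈/⌉ k : ℕ) := by exact_mod_cast h
  have : (V.card : ℝ) / k ≤ (V.card ⌈/⌉ k : ℕ) := by rw [div_le_iff₀ hk']; linarith
  have e : (1 - 1 / (k : ℝ)) * V.card = V.card - V.card / k := by ring
  linarith

theorem pow_le_half (hc : ∀ k : ℕ, 1 ≤ k → (1 - 1 / (k : ℝ)) ^ (c * (k : ℝ)) ≤ 1 / 2)
    (hk : 2 ≤ k) {o : ℕ} (ho : c * k ≤ o) : (1 - 1 / (k : ℝ)) ^ o ≤ 1 / 2 := by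
  have hk' : (2 : ℝ) ≤ k := by exact_mod_cast hk
  have h1 : 1 / (k : ℝ) ≤ 1 / 2 := by gcongr
  have h0 : 0 ≤ 1 / (k : ℝ) := by positivity
  rw [← Real.rpow_natCast]
  exact (Real.rpow_le_rpow_of_exponent_ge (by linarith) (by linarith) ho).trans
    (hc k (by omega))

/-- Termination is certain, not just almost sure: `∑ |V j| + (⌈c * k⌉ - o)` falls with every trial
that is followed by another one, because an off-trial shrinks all sets and an on-trial removes an
index. The removal rests on `|V j| ≤ k * m`, which makes `F j` have at most `m` elements. Each
off-trial multiplies the remaining sizes by at most `1 - 1/k`, so `c * k` of them halve the bound `k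
* m`. -/
theorem reductionTrials_bd (hκ : 0 ≤ κ tag)
    (hc : ∀ k : ℕ, 1 ≤ k → (1 - 1 / (k : ℝ)) ^ (c * (k : ℝ)) ≤ 1 / 2)
    (hx : ∀ j : Fin n, (j : ℕ) < s → z (π j) = x (π j)) (hk : 2 ≤ k) (hm : 1 ≤ m)
    {w : Fin n → Fin n → ℝ} (hw : ∀ j p, 0 ≤ w j p) (N : ℕ) :
    ∀ (o : ℕ) (J : Finset (Fin n)) (V : Fin n → Finset (Fin n)),
      Cand π s V → (∀ j ∈ J, (j : ℕ) < s) →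
      (∀ j ∈ J, m < (V j).card ∧ ((V j).card : ℝ) ≤ (1 - 1 / (k : ℝ)) ^ o * (k * m)) →
      (∀ j ∈ J, (V j).card ≤ k * m) →
      ¬ (c * (k : ℝ) ≤ (o : ℝ) ∧ 2 * J.card ≤ l) →
      ∑ j ∈ J, (V j).card + (⌈c * k⌉₊ - o) < N →
      Bd κ z π (reductionTrials tag c x m k l N o J V)
        (fun v => v.1 ⊆ J ∧ 2 * v.1.card ≤ l ∧ Shrinks π s J V v.2 ∧
          (∀ j ∈ J, j ∉ v.1 → (v.2 j).card ≤ m) ∧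
          ∀ j ∈ v.1, m < (v.2 j).card ∧ 2 * (v.2 j).card ≤ k * m)
        (fun v => potential π w v.2)
        (κ tag * trialBudget c k l o J.card + potential π w V) := by
  induction N with
  | zero => intro o J V _ _ _ _ _ h; omega
  | succ N ih =>
    intro o J V hV hJ hsize hkm hcont hN
    have hmemJ : ∀ j ∈ J, π j ∈ V j := fun j hj => hV.mem j (hJ j hj)
    have hk1 : 1 ≤ k := by omega
    set fam := families J V (fun j => (V j).card ⌈/⌉ k) with hfam
    set oo : (Fin n → Finset (Fin n)) → ℕ :=
      fun F => if ∀ i ∈ J, π i ∉ F i then o + 1 else o with hoo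
    set JJ : (Fin n → Finset (Fin n)) → Finset (Fin n) :=
      fun F => J.filter fun j => m < (afterTrial π J V F j).card with hJJ
    have hJJsub : ∀ F, JJ F ⊆ J := fun F => Finset.filter_subset _ _
    -- an on-trial removes an index
    have hon : ∀ F ∈ fam, (¬ ∀ i ∈ J, π i ∉ F i) → ∃ j ∈ J, j ∉ JJ F := by
      intro F hF h
      obtain ⟨j, hj, hjF⟩ := exists_afterTrial_eq (V := V) h
      refine ⟨j, hj, fun hj' => ?_⟩
      have h1 := (Finset.mem_filter.1 hj').2
      rw [hjF, (subset_of_mem_families hF hj).2] at h1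
      exact absurd ((ceilDiv_le_iff_le_mul hk1).2 (hkm j hj)) (not_le.2 h1)
    unfold reductionTrials
    refine Bd.sample (u := fun F => κ tag * (1 + trialBudget c k l (oo F) (JJ F).card) +
      potential π w (afterTrial π J V F)) (families_nonempty fun j hj =>
        (ceilDiv_lt_self (by have := (hsize j hj).1; omega) hk).le) (fun F hF => ?_) ?_
    · have hFs : ∀ j ∈ J, F j ⊆ V j := fun j hj => (subset_of_mem_families hF hj).1
      have hFc : ∀ j ∈ J, (F j).card = (V j).card ⌈/⌉ k :=
        fun j hj => (subset_of_mem_families hF hj).2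
      refine Bd.ask ?_
      rw [trial_eq hx hV hJ hFs rfl]
      simp only [offTrial_iff hx hV hJ hFs]
      change Bd κ z π (if c * (k : ℝ) ≤ (oo F : ℝ) ∧ 2 * (JJ F).card ≤ l then
        .done (JJ F, afterTrial π J V F) else
        reductionTrials tag c x m k l N (oo F) (JJ F) (afterTrial π J V F)) _ _ _
      have hsh : Shrinks π s J V (afterTrial π J V F) :=
        ⟨afterTrial_subset hFs, fun j hj => mem_afterTrial (hV.mem j hj),
          fun j hj => afterTrial_of_notMem hj⟩
      have hnot : ∀ j ∈ J, j ∉ JJ F → (afterTrial π J V F j).card ≤ m := fun j hj hj' =>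
        not_lt.1 fun h => hj' (Finset.mem_filter.2 ⟨hj, h⟩)
      have hsize' : ∀ j ∈ JJ F, m < (afterTrial π J V F j).card ∧
          ((afterTrial π J V F j).card : ℝ) ≤ (1 - 1 / (k : ℝ)) ^ oo F * (k * m) := by
        intro j hj
        have hjJ := hJJsub F hj
        refine ⟨(Finset.mem_filter.1 hj).2, ?_⟩
        by_cases h : ∀ i ∈ J, π i ∉ F i
        · simp only [hoo, if_pos h]
          rw [afterTrial_of_off h hjJ, pow_succ', mul_assoc]
          refine (card_sdiff_le (hFs j hjJ) hk1 (hFc j hjJ)).trans ?_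
          refine mul_le_mul_of_nonneg_left (hsize j hjJ).2 ?_
          rw [sub_nonneg, div_le_one (by positivity)]
          exact_mod_cast hk1
        · simp only [hoo, if_neg h]
          refine le_trans ?_ (hsize j hjJ).2
          exact_mod_cast Finset.card_le_card (hsh.sub j)
      by_cases hfinish : c * (k : ℝ) ≤ (oo F : ℝ) ∧ 2 * (JJ F).card ≤ l
      · rw [if_pos hfinish]
        refine Bd.done ⟨hJJsub F, hfinish.2, hsh, hnot, fun j hj => ⟨(hsize' j hj).1, ?_⟩⟩ ?_
        · have h1 := (hsize' j hj).2
          have h2 := mul_le_mul_of_nonneg_right (pow_le_half hc hk hfinish.1)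
            (by positivity : (0 : ℝ) ≤ k * m)
          have h3 : (2 : ℝ) * (afterTrial π J V F j).card ≤ k * m := by linarith
          exact_mod_cast h3
        · have := mul_nonneg hκ (trialBudget_nonneg (c := c) (k := k) (l := l) (oo F) (JJ F).card)
          simp only
          linarith
      · rw [if_neg hfinish]
        refine (ih (oo F) (JJ F) (afterTrial π J V F) (hsh.cand hV)
          (fun j hj => hJ j (hJJsub F hj)) hsize'
          (fun j hj => (Finset.card_le_card (hsh.sub j)).trans (hkm j (hJJsub F hj)))
          hfinish ?_).mono ?_ (fun _ _ => le_rfl) ?_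
        · by_cases h : ∀ i ∈ J, π i ∉ F i
          · simp only [hoo, if_pos h]
            -- The loop also runs on with an empty `J` while off-trials are missing; then only the
            -- second summand of the measure falls.
            rcases J.eq_empty_or_nonempty with hJe | hJne
            · have ho : o < ⌈c * k⌉₊ := by
                rw [Nat.lt_ceil]
                by_contra h
                exact hcont ⟨not_lt.1 h, by simp [hJe]⟩
              have hJJe : JJ F = ∅ := Finset.subset_empty.1 (hJe ▸ hJJsub F)
              rw [hJJe, Finset.sum_empty]
              rw [hJe, Finset.sum_empty] at hN
              omega
            · have h1 : ∑ j ∈ JJ F, (afterTrial π J V F j).card ≤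
                  ∑ j ∈ J, (afterTrial π J V F j).card :=
                Finset.sum_le_sum_of_subset (hJJsub F)
              have h2 : ∑ j ∈ J, (afterTrial π J V F j).card < ∑ j ∈ J, (V j).card := by
                refine Finset.sum_lt_sum_of_nonempty hJne fun j hj => ?_
                rw [afterTrial_of_off h hj, Finset.card_sdiff_of_subset (hFs j hj), hFc j hj]
                have h3 := (hsize j hj).1
                have h4 := ceilDiv_pos (b := k) hk1 (by omega : 0 < (V j).card)
                omega
              omega
          · simp only [hoo, if_neg h]
            obtain ⟨r, hr, hr'⟩ := hon F hF h
            have h1 : ∑ j ∈ JJ F, (afterTrial π J V F j).card ≤ ∑ j ∈ JJ F, (V j).card :=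
              Finset.sum_le_sum fun j _ => Finset.card_le_card (hsh.sub j)
            have h2 : ∑ j ∈ JJ F, (V j).card < ∑ j ∈ J, (V j).card :=
              Finset.sum_lt_sum_of_subset (hJJsub F) hr hr' (by have := (hsize r hr).1; omega)
                fun _ _ _ => Nat.zero_le _
            omega
        · rintro ⟨J', V'⟩ ⟨h1, h2, h3, h4, h5⟩
          refine ⟨h1.trans (hJJsub F), h2, hsh.trans h3 (hJJsub F), fun j hj hj' => ?_, h5⟩
          by_cases hjj : j ∈ JJ F
          · exact h4 j hjj hj'
          · exact (Finset.card_le_card (h3.sub j)).trans (hnot j hj hjj)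
        · linarith
    · rw [Finset.sum_add_distrib, ← Finset.mul_sum, mul_add, mul_left_comm]
      refine add_le_add (mul_le_mul_of_nonneg_left ?_ hκ) (sum_potential_afterTrial_le hmemJ hw)
      refine sum_trialBudget_le hk1 hmemJ hcont _ (fun F hF h => ?_) fun F hF h => ?_
      · simp only [hoo, if_pos h]
        exact trialBudget_mono le_rfl (Finset.card_le_card (hJJsub F))
      · obtain ⟨r, hr, hr'⟩ := hon F hF h
        have hlt : (JJ F).card < J.card :=
          Finset.card_lt_card ⟨hJJsub F, fun h => hr' (h hr)⟩
        simp only [hoo, if_neg h]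
        exact ⟨by omega, trialBudget_mono le_rfl (by omega)⟩

end reduction

/-! ### Phases, steps and rounds of a size reduction -/

section sizeReduction

variable {n : ℕ} {z x : BitString n} {π : Equiv.Perm (Fin n)} {s k m l : ℕ} {c : ℝ}
  {κ : Bool → ℝ} {tag : Bool}

theorem nonneg_of_pow_le_half
    (hc : ∀ k : ℕ, 1 ≤ k → (1 - 1 / (k : ℝ)) ^ (c * (k : ℝ)) ≤ 1 / 2) : 0 ≤ c := by
  by_contra hneg
  have h := hc 2 one_le_two
  have h1 : (1 : ℝ) ≤ (1 - 1 / ((2 : ℕ) : ℝ)) ^ (c * ((2 : ℕ) : ℝ)) :=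
    Real.one_le_rpow_of_pos_of_le_one_of_nonpos (by norm_num) (by norm_num)
      (by push_cast; linarith)
  linarith

theorem sum_card_le_sq (J : Finset (Fin n)) (V : Fin n → Finset (Fin n)) :
    ∑ j ∈ J, (V j).card ≤ n * n := by
  refine (Finset.sum_le_card_nsmul J _ n fun j _ => ?_).trans ?_
  · simpa using Finset.card_le_univ (V j)
  · rw [smul_eq_mul]
    exact Nat.mul_le_mul_right _ (by simpa using Finset.card_le_univ J)

/-- The form with `k - 1` is suited to summation over the phases, since `⌈k / 2⌉ - 1 ≤ (k - 1) / 2`.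
-/
theorem trialBudget_start_le (hc : 0 ≤ c) (hk : 2 ≤ k) :
    trialBudget c k l 0 l ≤ (2 * c + 4) * ((k : ℝ) - 1) + 2 * l := by
  unfold trialBudget
  have hk' : (2 : ℝ) ≤ k := by exact_mod_cast hk
  have h1 : ((⌈c * k⌉₊ - 0 : ℕ) : ℝ) ≤ c * k + 1 := by
    rw [Nat.sub_zero]; exact (Nat.ceil_lt_add_one (by positivity)).le
  have h2 : ((l - l / 2 : ℕ) : ℝ) ≤ (l / 2 : ℕ) + 1 := by
    exact_mod_cast (by omega : l - l / 2 ≤ l / 2 + 1)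
  have h3 : ((l / 2 : ℕ) : ℝ) ≤ l / 2 := by
    have : 2 * (l / 2) ≤ l := by omega
    have : (2 : ℝ) * (l / 2 : ℕ) ≤ l := by exact_mod_cast this
    linarith
  set h : ℝ := ((l / 2 : ℕ) : ℝ) with hh
  have h0 : 0 ≤ h := Nat.cast_nonneg _
  have h4 : (1 + k / (h + 1)) * ((l - l / 2 : ℕ) : ℝ) ≤ (1 + k / (h + 1)) * (h + 1) := by
    gcongr
  have h5 : (1 + k / (h + 1)) * (h + 1) = h + 1 + k := by field_simp
  have h6 : 0 ≤ c * ((k : ℝ) - 2) := mul_nonneg hc (by linarith)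
  have h7 : (0 : ℝ) ≤ l := Nat.cast_nonneg _
  nlinarith

/-- Both `k - 1` and the number of indices are at least halved by each phase, so the whole costs at
most twice the bound for the first phase. -/
theorem reductionPhases_bd (hκ : 0 ≤ κ tag)
    (hc : ∀ k : ℕ, 1 ≤ k → (1 - 1 / (k : ℝ)) ^ (c * (k : ℝ)) ≤ 1 / 2)
    (hx : ∀ j : Fin n, (j : ℕ) < s → z (π j) = x (π j)) (hm : 1 ≤ m)
    {w : Fin n → Fin n → ℝ} (hw : ∀ j p, 0 ≤ w j p) (N₀ N : ℕ) :
    ∀ (k : ℕ) (J : Finset (Fin n)) (V : Fin n → Finset (Fin n)), 1 ≤ k →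
      Cand π s V → (∀ j ∈ J, (j : ℕ) < s) → (∀ j ∈ J, m < (V j).card ∧ (V j).card ≤ k * m) →
      n * n + ⌈c * k⌉₊ < N₀ → J.card < N →
      Bd κ z π (reductionPhases tag c x m N₀ N k J V)
        (fun V' => Shrinks π s J V V' ∧ ∀ j ∈ J, (V' j).card ≤ m) (potential π w)
        (κ tag * ((4 * c + 8) * ((k : ℝ) - 1) + 4 * J.card) + potential π w V) := by
  have hc0 := nonneg_of_pow_le_half hc
  induction N with
  | zero => intro k J V _ _ _ _ _ h; omega
  | succ N ih =>
    intro k J V hk hV hJ hsize hN₀ hN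
    unfold reductionPhases
    by_cases hJne : J.Nonempty
    · rw [if_pos hJne]
      -- For `k = 1` the conditions `m < |V j| ≤ k * m` leave no index.
      have hk2 : 2 ≤ k := by
        obtain ⟨j, hj⟩ := hJne
        by_contra h
        have h1 := hsize j hj
        have : k = 1 := by omega
        subst this
        omega
      have hJpos := hJne.card_pos
      have hsum := sum_card_le_sq J V
      have htr := reductionTrials_bd (κ := κ) (tag := tag) (l := J.card) hκ hc hx hk2 hm hw N₀ 0 J V
        hV hJ (fun j hj => ⟨(hsize j hj).1, by
          rw [pow_zero, one_mul]; exact_mod_cast (hsize j hj).2⟩) (fun j hj => (hsize j hj).2)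
        (fun h => by omega) (by omega)
      refine Bd.bind ((htr.add_const
        (κ tag * ((2 * c + 4) * ((k : ℝ) - 1) + 2 * J.card))).mono
        (fun _ h => h) (fun _ _ => le_rfl) ?_) ?_
      · have h1 := mul_le_mul_of_nonneg_left (trialBudget_start_le (l := J.card) hc0 hk2) hκ
        nlinarith
      · rintro ⟨J', V'⟩ ⟨h1, h2, h3, h4, h5⟩
        have hk' : k ⌈/⌉ 2 ≤ k := (ceilDiv_lt_self hk2 le_rfl).le
        have hk2' : k ≤ 2 * (k ⌈/⌉ 2) := le_mul_ceilDiv two_pos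
        refine (ih (k ⌈/⌉ 2) J' V' (ceilDiv_pos two_pos hk) (h3.cand hV)
          (fun j hj => hJ j (h1 hj)) (fun j hj => ⟨(h5 j hj).1, ?_⟩) ?_ ?_).mono
          (fun V'' h => ⟨h3.trans h.1 h1, fun j hj => ?_⟩) (fun _ _ => le_rfl) ?_
        · have h6 := (h5 j hj).2
          have h7 : k * m ≤ 2 * (k ⌈/⌉ 2) * m := Nat.mul_le_mul_right _ hk2'
          simp only at h6 ⊢
          nlinarith
        · have : ⌈c * ((k ⌈/⌉ 2 : ℕ) : ℝ)⌉₊ ≤ ⌈c * k⌉₊ := by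
            refine Nat.ceil_mono (mul_le_mul_of_nonneg_left ?_ hc0)
            exact_mod_cast hk'
          omega
        · simp only at h2 ⊢
          omega
        · by_cases hj' : j ∈ J'
          · exact h.2 j hj'
          · exact (Finset.card_le_card (h.1.sub j)).trans (h4 j hj hj')
        · simp only at h2 ⊢
          rw [add_comm (potential π w V')]
          refine add_le_add (mul_le_mul_of_nonneg_left ?_ hκ) le_rfl
          have h6 : 2 * ((k ⌈/⌉ 2 : ℕ) : ℝ) ≤ k + 1 := by
            have : 2 * (k ⌈/⌉ 2) ≤ k + 1 := by
              rw [Nat.ceilDiv_eq_add_pred_div]; omega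
            exact_mod_cast this
          have h7 : 2 * (J'.card : ℝ) ≤ J.card := by exact_mod_cast h2
          nlinarith
    · rw [if_neg hJne]
      rw [Finset.not_nonempty_iff_eq_empty] at hJne
      subst hJne
      refine Bd.done ⟨hV.shrinks _, fun j hj => by simp at hj⟩ ?_
      have hk' : (1 : ℝ) ≤ k := by exact_mod_cast hk
      have : 0 ≤ κ tag * ((4 * c + 8) * ((k : ℝ) - 1) + 4 * (∅ : Finset (Fin n)).card) :=
        mul_nonneg hκ (add_nonneg (mul_nonneg (by linarith) (by linarith)) (by positivity))
      linarith

theorem reductionStep_bd (hκ : 0 ≤ κ tag)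
    (hc : ∀ k : ℕ, 1 ≤ k → (1 - 1 / (k : ℝ)) ^ (c * (k : ℝ)) ≤ 1 / 2)
    (hx : ∀ j : Fin n, (j : ℕ) < s → z (π j) = x (π j)) (hm : 1 ≤ m)
    {w : Fin n → Fin n → ℝ} (hw : ∀ j p, 0 ≤ w j p) {N : ℕ} {J : Finset (Fin n)}
    {V : Fin n → Finset (Fin n)} (hk : 1 ≤ k) (hV : Cand π s V) (hJ : ∀ j ∈ J, (j : ℕ) < s)
    (hsize : ∀ j ∈ J, (V j).card ≤ k * m) (hN : n * n + n + ⌈c * k⌉₊ < N) :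
    Bd κ z π (reductionStep N tag c k J m x V)
      (fun V' => Shrinks π s J V V' ∧ ∀ j ∈ J, (V' j).card ≤ m) (potential π w)
      (κ tag * ((4 * c + 8) * ((k : ℝ) + J.card)) + potential π w V) := by
  have hc0 := nonneg_of_pow_le_half hc
  unfold reductionStep
  set J' := J.filter fun j => m < (V j).card
  have hJ' : J' ⊆ J := Finset.filter_subset _ _
  have hcard : J'.card ≤ n := by simpa using Finset.card_le_univ J'
  refine (reductionPhases_bd hκ hc hx hm hw N N k J' V hk hV (fun j hj => hJ j (hJ' hj))
    (fun j hj => ⟨(Finset.mem_filter.1 hj).2, hsize j (hJ' hj)⟩) (by omega) (by omega)).mono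
    (fun V' h => ⟨h.1.mono hJ', fun j hj => ?_⟩) (fun _ _ => le_rfl) ?_
  · by_cases hj' : j ∈ J'
    · exact h.2 j hj'
    · rw [h.1.eq j hj']
      exact not_lt.1 fun h => hj' (Finset.mem_filter.2 ⟨hj, h⟩)
  · refine add_le_add (mul_le_mul_of_nonneg_left ?_ hκ) le_rfl
    have : (J'.card : ℝ) ≤ J.card := by exact_mod_cast Finset.card_le_card hJ'
    have h2 : (0 : ℝ) ≤ J.card := Nat.cast_nonneg _
    nlinarith [mul_nonneg hc0 h2]

theorem sizeReductionRounds_bd (hκ : 0 ≤ κ tag)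
    (hc : ∀ k : ℕ, 1 ≤ k → (1 - 1 / (k : ℝ)) ^ (c * (k : ℝ)) ≤ 1 / 2)
    (hx : ∀ j : Fin n, (j : ℕ) < s → z (π j) = x (π j))
    {w : Fin n → Fin n → ℝ} (hw : ∀ j p, 0 ≤ w j p) {N M : ℕ} {J : Finset (Fin n)}
    (hk : 1 ≤ k) (hM : 1 ≤ M) (hJ : ∀ j ∈ J, (j : ℕ) < s) (hN : n * n + n + ⌈c * k⌉₊ < N)
    (rounds : ℕ) :
    ∀ (i : ℕ) (V : Fin n → Finset (Fin n)), Cand π s V →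
      (∀ j ∈ J, (V j).card ≤ M ⌈/⌉ k ^ i) →
      Bd κ z π (sizeReductionRounds N tag c k J M x rounds (i + 1) V)
        (fun V' => Shrinks π s J V V' ∧ ∀ j ∈ J, (V' j).card ≤ M ⌈/⌉ k ^ (i + rounds))
        (potential π w)
        (rounds * (κ tag * ((4 * c + 8) * ((k : ℝ) + J.card))) + potential π w V) := by
  induction rounds with
  | zero =>
    intro i V hV hsize
    exact Bd.done ⟨hV.shrinks _, hsize⟩ (by simp)
  | succ rounds ih =>
    intro i V hV hsize
    have hstep : ∀ j ∈ J, (V j).card ≤ k * (M ⌈/⌉ k ^ (i + 1)) := fun j hj => by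
      refine (hsize j hj).trans ((ceilDiv_le_iff_le_mul (pow_pos hk i)).2 ?_)
      have := le_mul_ceilDiv (a := M) (pow_pos hk (i + 1))
      rwa [pow_succ, mul_assoc, ← pow_succ] at this
    refine Bd.bind (((reductionStep_bd hκ hc hx (ceilDiv_pos (pow_pos hk (i + 1)) hM) hw hk hV hJ
      hstep hN).add_const (rounds * (κ tag * ((4 * c + 8) * ((k : ℝ) + J.card))))).mono
      (fun _ h => h) (fun _ _ => le_rfl) ?_) ?_
    · push_cast
      linarith
    · rintro V' ⟨h1, h2⟩
      refine (ih (i + 1) V' (h1.cand hV) h2).mono (fun V'' h => ⟨h1.trans h.1 subset_rfl, ?_⟩)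
        (fun _ _ => le_rfl) (by rw [add_comm])
      have e : i + 1 + rounds = i + (rounds + 1) := by omega
      rw [e] at h
      exact h.2

/-- The number of rounds is at most `D` because the largest size `M` is at most `m * k ^ D`. That
`J` is nonempty makes `M` positive, so that the logarithm in the number of rounds is meaningful. -/
theorem sizeReduction_bd (hκ : 0 ≤ κ tag)
    (hc : ∀ k : ℕ, 1 ≤ k → (1 - 1 / (k : ℝ)) ^ (c * (k : ℝ)) ≤ 1 / 2)
    (hx : ∀ j : Fin n, (j : ℕ) < s → z (π j) = x (π j)) (hm : 1 ≤ m)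
    {w : Fin n → Fin n → ℝ} (hw : ∀ j p, 0 ≤ w j p) {N D : ℕ} {J : Finset (Fin n)}
    {V : Fin n → Finset (Fin n)} (hk : 2 ≤ k) (hV : Cand π s V) (hJ : ∀ j ∈ J, (j : ℕ) < s)
    (hJne : J.Nonempty) (hsize : ∀ j ∈ J, (V j).card ≤ m * k ^ D)
    (hN : n * n + n + ⌈c * k⌉₊ < N) :
    Bd κ z π (sizeReduction N tag c k J m x V)
      (fun V' => Shrinks π s J V V' ∧ ∀ j ∈ J, (V' j).card ≤ m) (potential π w)
      (κ tag * (D * ((4 * c + 8) * ((k : ℝ) + J.card))) + potential π w V) := by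
  have hc0 := nonneg_of_pow_le_half hc
  unfold sizeReduction
  set M := J.sup fun j => (V j).card with hMdef
  have hle : ∀ j ∈ J, (V j).card ≤ M := fun j hj =>
    Finset.le_sup (f := fun j => (V j).card) hj
  have hM : 1 ≤ M := by
    obtain ⟨j, hj⟩ := hJne
    exact (Nat.succ_le_of_lt (Finset.card_pos.2 ⟨_, hV.mem j (hJ j hj)⟩)).trans (hle j hj)
  have hMD : M ≤ m * k ^ D := Finset.sup_le hsize
  have hm' : (0 : ℝ) < m := by exact_mod_cast hm
  have hM' : (0 : ℝ) < M := by exact_mod_cast hM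
  have hk' : (1 : ℝ) < k := by exact_mod_cast (by omega : 1 < k)
  set R := ⌈Real.logb k ((M : ℝ) / (m : ℝ))⌉₊ with hR
  have hRD : R ≤ D := by
    rw [hR, Nat.ceil_le, Real.logb_le_iff_le_rpow hk' (by positivity), Real.rpow_natCast,
      div_le_iff₀ hm']
    rw [mul_comm]
    exact_mod_cast hMD
  have hRM : M ⌈/⌉ k ^ (0 + R) ≤ m := by
    rw [zero_add, ceilDiv_le_iff_le_mul (pow_pos (by omega) R)]
    have h1 : Real.logb k ((M : ℝ) / (m : ℝ)) ≤ R := Nat.le_ceil _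
    rw [Real.logb_le_iff_le_rpow hk' (by positivity), Real.rpow_natCast, div_le_iff₀ hm'] at h1
    exact_mod_cast h1
  refine (sizeReductionRounds_bd hκ hc hx hw (by omega) hM hJ hN R 0 V hV
    fun j hj => by simpa using hle j hj).mono
    (fun V' h => ⟨h.1, fun j hj => (h.2 j hj).trans hRM⟩) (fun _ _ => le_rfl) ?_
  refine add_le_add ?_ le_rfl
  rw [mul_left_comm]
  refine mul_le_mul_of_nonneg_left (mul_le_mul_of_nonneg_right ?_ (by positivity)) hκ
  exact_mod_cast hRD

end sizeReduction

/-! ### Capacities -/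

theorem capacity_zero (n : ℕ) : capacity n 0 = capacity n 1 := rfl

theorem capacity_succ (n : ℕ) {i : ℕ} (hi : 1 ≤ i) : capacity n (i + 1) = capacity n i ^ 2 := by
  obtain ⟨i, rfl⟩ : ∃ i', i = i' + 1 := ⟨i - 1, by omega⟩
  simp only [capacity, Nat.add_sub_cancel]
  rw [← pow_mul, pow_succ]

/-- The largest number of indices that a call of `advance` on level `i` returns. -/
def reach (n : ℕ) : ℕ → ℕ
  | 0 => 1
  | i + 1 => capacity n (i + 1) + reach n i

/-- The numerical assumptions under which the strategy is analyzed. -/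
structure Large (n d t q : ℕ) (B : ℝ) : Prop where
  two_le : 2 ≤ capacity n 1
  four_le : 4 ≤ d
  one_le : 1 ≤ t
  pow_le : capacity n t ^ d ≤ n
  lt_pow : n < capacity n (t + 1) ^ d
  pos : 0 < B
  room : ∀ s : ℕ, s ≤ q + reach n t →
    (s : ℝ) + 1 + 27 * n / (capacity n 1 : ℝ) ^ 3 + 1 / B ≤ n

/-- The weight of the candidate set of a position that was treated `δ` positions ago. -/
noncomputable def weight (n δ : ℕ) : ℝ := 27 * n / ((capacity n 1 : ℝ) + δ) ^ 3

section capacity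

variable {n d t q : ℕ} {B : ℝ}

theorem capacity_mono (h2 : 2 ≤ capacity n 1) {i j : ℕ} (hij : i ≤ j) :
    capacity n i ≤ capacity n j := by
  have h1 : 1 ≤ Nat.clog 2 n := by
    have : 2 ≤ Nat.clog 2 n := by simpa [capacity] using h2
    omega
  unfold capacity
  exact Nat.pow_le_pow_right h1 (Nat.pow_le_pow_right two_pos (by omega))

theorem two_le_capacity (h2 : 2 ≤ capacity n 1) (i : ℕ) : 2 ≤ capacity n i :=
  h2.trans ((capacity_zero n).ge.trans (capacity_mono h2 (Nat.zero_le i)))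

theorem capacity_one_le (h2 : 2 ≤ capacity n 1) (i : ℕ) : capacity n 1 ≤ capacity n i :=
  (capacity_zero n).ge.trans (capacity_mono h2 (Nat.zero_le i))

theorem reach_le (h2 : 2 ≤ capacity n 1) (i : ℕ) : reach n i ≤ 2 * capacity n i := by
  induction i with
  | zero => have := two_le_capacity h2 0; simp only [reach]; omega
  | succ i ih =>
    simp only [reach]
    rcases Nat.eq_zero_or_pos i with rfl | hi
    · change capacity n 1 + 1 ≤ 2 * capacity n 1; omega
    · have h := two_le_capacity h2 i
      rw [capacity_succ n hi]
      nlinarith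

theorem Large.n_pos (h : Large n d t q B) : 0 < n :=
  (pow_pos (by have := two_le_capacity h.two_le t; omega) d).trans_le h.pow_le

theorem Large.lt_n (h : Large n d t q B) {s : ℕ} (hs : s ≤ q + reach n t) : s < n := by
  have h1 := h.room s hs
  have h2 : 0 < 1 / B := one_div_pos.2 h.pos
  have h3 : 0 ≤ 27 * n / (capacity n 1 : ℝ) ^ 3 := by positivity
  have : (s : ℝ) < n := by linarith
  exact_mod_cast this

theorem one_le_targetSize (hn : 0 < n) (h2 : 2 ≤ capacity n 1) (i : ℕ) :
    1 ≤ targetSize d n i :=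
  ceilDiv_pos (pow_pos (by have := two_le_capacity h2 i; omega) d) hn

theorem le_pow_mul_targetSize (h2 : 2 ≤ capacity n 1) (i : ℕ) :
    n ≤ capacity n i ^ d * targetSize d n i :=
  le_mul_ceilDiv (pow_pos (by have := two_le_capacity h2 i; omega) d)

/-- As the capacities are squared from level to level, descending by one target size is a factor
`α_i ^ d`, that is, `d` rounds with base `α_i`. -/
theorem targetSize_le (h2 : 2 ≤ capacity n 1) {i : ℕ} (hi : 1 ≤ i) :
    targetSize d n i ≤ targetSize d n (i + 1) * capacity n i ^ d := by
  have h := le_pow_mul_targetSize (d := d) h2 (i + 1)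
  have hpos : 0 < capacity n i ^ d := pow_pos (by have := two_le_capacity h2 i; omega) d
  rw [targetSize, ceilDiv_le_iff_le_mul hpos]
  refine h.trans_eq ?_
  rw [capacity_succ n hi]
  ring

theorem Large.targetSize_le (h : Large n d t q B) :
    targetSize d n t ≤ 1 * capacity n t ^ d := by
  have hpos : 0 < capacity n t ^ d := pow_pos (by have := two_le_capacity h.two_le t; omega) d
  rw [targetSize, ceilDiv_le_iff_le_mul hpos, one_mul]
  refine h.lt_pow.le.trans_eq ?_
  rw [capacity_succ n h.one_le]
  ring

theorem weight_nonneg (n δ : ℕ) : 0 ≤ weight n δ := by unfold weight; positivity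

/-- Telescoping: `1 / (A + i + 1) ^ 3` is at most `(1 / (A + i) - 1 / (A + i + 1)) / A`. -/
theorem sum_weight_le (h2 : 2 ≤ capacity n 1) (N : ℕ) :
    ∑ i ∈ Finset.range N, weight n (i + 1) ≤ 27 * n / (capacity n 1 : ℝ) ^ 2 := by
  set A : ℝ := ((capacity n 1 : ℕ) : ℝ) with hA
  have hA2 : 2 ≤ A := by rw [hA]; exact_mod_cast h2
  have h : ∑ i ∈ Finset.range N, weight n (i + 1) ≤ 27 * n / A * (1 / A - 1 / (A + N)) := by
    induction N with
    | zero => simp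
    | succ N ih =>
      rw [Finset.sum_range_succ]
      have hstep : weight n (N + 1) ≤ 27 * n / A * (1 / (A + N) - 1 / (A + (N + 1 : ℕ))) := by
        unfold weight
        rw [← hA]
        push_cast
        have e : 27 * n / A * (1 / (A + N) - 1 / (A + (N + 1))) =
            27 * n / (A * ((A + N) * (A + (N + 1)))) := by
          field_simp; ring
        rw [e]
        have hN : (0 : ℝ) ≤ N := Nat.cast_nonneg _
        have hAN : 0 < A + N := by positivity
        have : A * ((A + N) * (A + (N + 1))) ≤ (A + (N + 1)) ^ 3 := by
          have h1 : A * (A + N) ≤ (A + (N + 1)) * (A + (N + 1)) := by nlinarith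
          have h2 : 0 ≤ A + (N + 1) := by positivity
          nlinarith [mul_le_mul_of_nonneg_right h1 h2]
        gcongr
      calc _ ≤ 27 * n / A * (1 / A - 1 / (A + N)) +
            27 * n / A * (1 / (A + N) - 1 / (A + (N + 1 : ℕ))) := add_le_add ih hstep
        _ = _ := by ring
  refine h.trans ?_
  have h1 : 1 / A - 1 / (A + N) ≤ 1 / A := by
    have : 0 ≤ 1 / (A + N) := by positivity
    linarith
  calc _ ≤ 27 * n / A * (1 / A) := by gcongr
    _ = _ := by field_simp

theorem sum_weight_sub_le (h2 : 2 ≤ capacity n 1) (s : ℕ) :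
    ∑ j ∈ Finset.range s, weight n (s - j) ≤ 27 * n / (capacity n 1 : ℝ) ^ 2 := by
  rw [← Finset.sum_range_reflect]
  refine le_trans (le_of_eq (Finset.sum_congr rfl fun j hj => ?_)) (sum_weight_le h2 s)
  rw [Finset.mem_range] at hj
  congr 1
  omega

theorem sum_weight_gt_le (h2 : 2 ≤ capacity n 1) (s : ℕ) :
    ∑ p : Fin n, (if s < (p : ℕ) then weight n (p - s) else 0) ≤
      27 * n / (capacity n 1 : ℝ) ^ 2 := by
  rw [Fin.sum_univ_eq_sum_range (fun i => if s < i then weight n (i - s) else 0) n,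
    ← Finset.sum_filter]
  have e : (Finset.range n).filter (fun i => s < i) = Finset.Ico (s + 1) n := by
    ext i; simp only [Finset.mem_filter, Finset.mem_range, Finset.mem_Ico]; omega
  rw [e, Finset.sum_Ico_eq_sum_range]
  refine le_trans (le_of_eq (Finset.sum_congr rfl fun j _ => ?_)) (sum_weight_le h2 (n - (s + 1)))
  congr 1
  omega

/-- The candidate sets of the positions below `s` have the sizes of levels from `l` on. A set that
is no singleton belongs to a position from which position `e` is within the reach of its level. -/
def Sized (n d t l e s : ℕ) (V : Fin n → Finset (Fin n)) : Prop :=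
  ∀ j : Fin n, (j : ℕ) < s → (V j).card = 1 ∨
    ∃ i, l ≤ i ∧ i ≤ t ∧ (V j).card ≤ targetSize d n i ∧ e ≤ j + reach n i

/-- The weights are made for this inequality. A set of level `i` has `|V j| - 1 ≤ n / α_i ^ 4`, and
its distance `s - j` is at most `2 * α_i`, so its weight is at least `n / α_i ^ 3`, hence at least
`α_i * (|V j| - 1)`. -/
theorem Large.capacity_mul_le (h : Large n d t q B) {l s : ℕ} {V : Fin n → Finset (Fin n)}
    (hV : Sized n d t l s s V) {j : Fin n} (hj : (j : ℕ) < s) :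
    (capacity n l : ℝ) * (((V j).card : ℝ) - 1) ≤ weight n (s - j) := by
  rcases hV j hj with h1 | ⟨i, hli, hit, hcard, he⟩
  · rw [h1]; simpa using weight_nonneg n _
  have hr := reach_le h.two_le i
  have hle : (capacity n l : ℝ) ≤ capacity n i := by
    exact_mod_cast capacity_mono h.two_le hli
  have hA : (2 : ℝ) ≤ capacity n i := by exact_mod_cast two_le_capacity h.two_le i
  have h1i : (capacity n 1 : ℝ) ≤ capacity n i := by
    exact_mod_cast capacity_one_le h.two_le i
  have hδ : ((s - j : ℕ) : ℝ) ≤ 2 * capacity n i := by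
    have : s - j ≤ 2 * capacity n i := by omega
    exact_mod_cast this
  -- Subtracting `1` absorbs the rounding in the target size; here `d ≥ 4` is needed.
  have hc : (((V j).card : ℝ) - 1) * (capacity n i : ℝ) ^ 4 ≤ n := by
    have hpos : 0 < capacity n i ^ d :=
      pow_pos (by have := two_le_capacity h.two_le i; omega) d
    have h1 : targetSize d n i * capacity n i ^ d ≤ n + capacity n i ^ d := by
      rw [targetSize, Nat.ceilDiv_eq_add_pred_div]
      exact (Nat.div_mul_le_self _ _).trans (by omega)
    have h2 : (V j).card * capacity n i ^ d ≤ n + capacity n i ^ d :=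
      (Nat.mul_le_mul_right _ hcard).trans h1
    have h3 : ((V j).card : ℝ) * (capacity n i : ℝ) ^ d ≤ n + (capacity n i : ℝ) ^ d := by
      exact_mod_cast h2
    have h4 : (capacity n i : ℝ) ^ 4 ≤ (capacity n i : ℝ) ^ d :=
      pow_le_pow_right₀ (by linarith) h.four_le
    rcases le_or_gt ((V j).card : ℝ) 1 with h5 | h5
    · have : (((V j).card : ℝ) - 1) * (capacity n i : ℝ) ^ 4 ≤ 0 :=
        mul_nonpos_of_nonpos_of_nonneg (by linarith) (by positivity)
      exact this.trans (Nat.cast_nonneg _)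
    · have := mul_le_mul_of_nonneg_left h4 (by linarith : (0 : ℝ) ≤ ((V j).card : ℝ) - 1)
      nlinarith
  unfold weight
  set A : ℝ := ((capacity n i : ℕ) : ℝ)
  set v : ℝ := ((V j).card : ℝ) - 1
  rcases le_or_gt v 0 with hv | hv
  · refine le_trans (mul_nonpos_of_nonneg_of_nonpos (Nat.cast_nonneg _) hv) ?_
    positivity
  have hC : (2 : ℝ) ≤ capacity n 1 := by exact_mod_cast h.two_le
  rw [le_div_iff₀ (by positivity)]
  -- Since `α_1 ≤ α_i` and `s - j ≤ 2 * α_i`, the cube has base at most `3 * α_i`; this is the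
  -- origin of `27`.
  calc (capacity n l : ℝ) * v * ((capacity n 1 : ℝ) + (s - j : ℕ)) ^ 3
      ≤ A * v * (A + 2 * A) ^ 3 := by gcongr
    _ = 27 * (v * A ^ 4) := by ring
    _ ≤ 27 * n := by linarith

/-- At most a small fraction of the positions is covered by the candidate sets. -/
theorem Large.card_covered_le (h : Large n d t q B) {l : ℕ} {σ : State n}
    (hV : Sized n d t l σ.s σ.s σ.V) (hs : σ.s ≤ n) :
    (σ.covered.card : ℝ) ≤ σ.s + 27 * n / (capacity n 1 : ℝ) ^ 3 := by
  have hA : (2 : ℝ) ≤ capacity n 1 := by exact_mod_cast h.two_le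
  have hpt : ∀ j : Fin n, (j : ℕ) < σ.s →
      ((σ.V j).card : ℝ) ≤ 1 + weight n (σ.s - j) / capacity n 1 := fun j hj => by
    have h1 := h.capacity_mul_le hV hj
    have hle : (capacity n 1 : ℝ) ≤ capacity n l := by
      exact_mod_cast capacity_one_le h.two_le l
    rcases le_or_gt ((σ.V j).card : ℝ) 1 with h5 | h5
    · have : 0 ≤ weight n (σ.s - j) / capacity n 1 :=
        div_nonneg (weight_nonneg _ _) (Nat.cast_nonneg _)
      linarith
    · have h2 : ((σ.V j).card : ℝ) - 1 ≤ weight n (σ.s - j) / capacity n 1 := by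
        rw [le_div_iff₀ (by linarith), mul_comm]
        exact (mul_le_mul_of_nonneg_right hle (by linarith)).trans h1
      linarith
  have h0 : (σ.covered.card : ℝ) ≤
      ∑ j ∈ Finset.univ.filter (fun j : Fin n => (j : ℕ) < σ.s), ((σ.V j).card : ℝ) := by
    unfold State.covered
    exact_mod_cast Finset.card_biUnion_le
  refine h0.trans ((Finset.sum_le_sum fun j hj => hpt j (Finset.mem_filter.1 hj).2).trans ?_)
  have e : ∑ j ∈ Finset.univ.filter (fun j : Fin n => (j : ℕ) < σ.s),
      (1 + weight n (σ.s - j) / capacity n 1) =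
      ∑ j ∈ Finset.range σ.s, (1 + weight n (σ.s - j) / capacity n 1) := by
    rw [Finset.sum_filter, Fin.sum_univ_eq_sum_range
      (fun i => if i < σ.s then 1 + weight n (σ.s - i) / capacity n 1 else 0) n,
      ← Finset.sum_filter]
    congr 1
    ext i; simp only [Finset.mem_filter, Finset.mem_range]; omega
  rw [e, Finset.sum_add_distrib, Finset.sum_const, Finset.card_range, nsmul_eq_mul, mul_one,
    ← Finset.sum_div]
  refine add_le_add le_rfl ?_
  calc _ ≤ 27 * n / (capacity n 1 : ℝ) ^ 2 / capacity n 1 := by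
        gcongr; exact sum_weight_sub_le h.two_le _
    _ = _ := by rw [div_div, ← pow_succ]

end capacity

/-! ### The potential of a state -/

/-- The coefficients of the potential when the positions below `s` have been treated: the share
that `V j` has in `π s'` counts `top` times for `s' > s` and `cur` times for `s' = s`, in both cases
weighted according to `s' - j`. -/
noncomputable def coeff {n : ℕ} (π : Equiv.Perm (Fin n)) (top cur : ℝ) (s : ℕ) (j p : Fin n) : ℝ :=
  if (j : ℕ) < s then
    (if s < (π.symm p : ℕ) then top * weight n (π.symm p - j)
      else if s = (π.symm p : ℕ) then cur * weight n (s - j) else 0)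
  else 0

section potential

variable {n d t q : ℕ} {B top cur : ℝ} {π : Equiv.Perm (Fin n)} {s : ℕ}
  {V : Fin n → Finset (Fin n)}

theorem coeff_nonneg (ht : 0 ≤ top) (hc : 0 ≤ cur) (j p : Fin n) : 0 ≤ coeff π top cur s j p := by
  unfold coeff
  split_ifs
  · exact mul_nonneg ht (weight_nonneg _ _)
  · exact mul_nonneg hc (weight_nonneg _ _)
  · exact le_rfl
  · exact le_rfl

theorem potential_nonneg (ht : 0 ≤ top) (hc : 0 ≤ cur) :
    0 ≤ potential π (coeff π top cur s) V :=
  Finset.sum_nonneg fun j _ => Finset.sum_nonneg fun p _ =>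
    mul_nonneg (coeff_nonneg ht hc j p) share_nonneg

theorem share_eq_zero {a p : Fin n} {W : Finset (Fin n)} (h : p ∉ W) : share a p W = 0 :=
  if_neg fun h' => h h'.1

/-- If no candidate set contains `π s`, then the shares in it do not matter. -/
theorem potential_eq_of_fresh
    (h : ∀ hs : s < n, ∀ j : Fin n, (j : ℕ) < s → π ⟨s, hs⟩ ∉ V j) (cur' : ℝ) :
    potential π (coeff π top cur s) V = potential π (coeff π top cur' s) V := by
  refine Finset.sum_congr rfl fun j _ => Finset.sum_congr rfl fun p _ => ?_
  unfold coeff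
  by_cases hj : (j : ℕ) < s
  · by_cases hp : s = (π.symm p : ℕ)
    · have hs : s < n := hp ▸ (π.symm p).2
      have hp' : π ⟨s, hs⟩ = p := by
        rw [← Equiv.eq_symm_apply]; exact Fin.ext hp
      rw [share_eq_zero (hp' ▸ h hs j hj), mul_zero, mul_zero]
    · simp only [if_neg hp]
  · simp only [if_neg hj]

/-- A candidate set that contains `π s` pays for a failure at position `s`. -/
theorem potential_add_le (hs : s < n) {j : Fin n} (hj : (j : ℕ) < s) (hmem : π ⟨s, hs⟩ ∈ V j)
    {K a : ℝ} (hK : 0 ≤ K) (hπ : π j ∈ V j) (ha : a * (((V j).card : ℝ) - 1) ≤ weight n (s - j)) :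
    potential π (coeff π top cur s) V + K * a ≤ potential π (coeff π top (cur + K) s) V := by
  set p := π ⟨s, hs⟩ with hp
  have hne : p ≠ π j := by
    rw [hp]; intro h
    have := congrArg Fin.val (π.injective h)
    simp only at this
    omega
  have hcard : (1 : ℝ) < (V j).card := by
    exact_mod_cast Finset.one_lt_card.2 ⟨p, hmem, π j, hπ, hne⟩
  have hsym : (π.symm p : ℕ) = s := by rw [hp, Equiv.symm_apply_apply]
  have hle : ∀ j' p', coeff π top cur s j' p' ≤ coeff π top (cur + K) s j' p' := fun j' p' => by
    unfold coeff
    split_ifs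
    · exact le_rfl
    · exact mul_le_mul_of_nonneg_right (by linarith) (weight_nonneg _ _)
    · exact le_rfl
    · exact le_rfl
  have key : K * a ≤ ∑ j', ∑ p', (coeff π top (cur + K) s j' p' - coeff π top cur s j' p') *
      share (π j') p' (V j') := by
    have h0 : ∀ j' p', 0 ≤ (coeff π top (cur + K) s j' p' - coeff π top cur s j' p') *
        share (π j') p' (V j') := fun j' p' => mul_nonneg (sub_nonneg.2 (hle j' p')) share_nonneg
    refine le_trans ?_ (Finset.single_le_sum (fun j' _ => Finset.sum_nonneg fun p' _ => h0 j' p')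
      (Finset.mem_univ j))
    refine le_trans ?_ (Finset.single_le_sum (fun p' _ => h0 j p') (Finset.mem_univ p))
    have e : coeff π top (cur + K) s j p - coeff π top cur s j p = K * weight n (s - j) := by
      unfold coeff
      rw [if_pos hj, if_pos hj, hsym, if_neg (lt_irrefl s), if_pos rfl, if_neg (lt_irrefl s),
        if_pos rfl]
      ring
    rw [e, share, if_pos ⟨hmem, hne⟩, mul_one_div, mul_div_assoc]
    refine mul_le_mul_of_nonneg_left ?_ hK
    rw [le_div_iff₀ (by linarith)]
    exact ha
  unfold potential
  have : ∑ j', ∑ p', (coeff π top (cur + K) s j' p' - coeff π top cur s j' p') *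
      share (π j') p' (V j') = ∑ j', ∑ p', coeff π top (cur + K) s j' p' * share (π j') p' (V j') -
      ∑ j', ∑ p', coeff π top cur s j' p' * share (π j') p' (V j') := by
    simp only [sub_mul, Finset.sum_sub_distrib]
  linarith

/-- The coefficients of the candidate set of a position `s` that is about to be treated. -/
noncomputable def newCoeff (π : Equiv.Perm (Fin n)) (top : ℝ) (s : ℕ) (p : Fin n) : ℝ :=
  if s < (π.symm p : ℕ) then top * weight n (π.symm p - s) else 0

theorem newCoeff_nonneg (ht : 0 ≤ top) (p : Fin n) : 0 ≤ newCoeff π top s p := by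
  unfold newCoeff
  split_ifs
  · exact mul_nonneg ht (weight_nonneg _ _)
  · exact le_rfl

/-- When `s` grows, position `s + 1` changes from a later one to the current one, and both
coefficients are `top`. The shares in `π s` are dropped from the old sets, hence the `0` on the
right. -/
theorem potential_update (hs : s < n) (W : Finset (Fin n)) :
    potential π (coeff π top top (s + 1)) (Function.update V ⟨s, hs⟩ W) =
      potential π (coeff π top 0 s) V + ∑ p, newCoeff π top s p * share (π ⟨s, hs⟩) p W := by
  set i : Fin n := ⟨s, hs⟩ with hi
  unfold potential
  rw [← Finset.add_sum_erase _ _ (Finset.mem_univ i), add_comm]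
  have hcoeff : ∀ j p : Fin n, coeff π top top (s + 1) j p =
      if (j : ℕ) < s + 1 then (if s < (π.symm p : ℕ) then top * weight n (π.symm p - j) else 0)
      else 0 := by
    intro j p
    unfold coeff
    by_cases h1 : s + 1 < (π.symm p : ℕ)
    · rw [if_pos h1, if_pos (by omega : s < (π.symm p : ℕ))]
    · rw [if_neg h1]
      by_cases h2 : s + 1 = (π.symm p : ℕ)
      · rw [if_pos h2, if_pos (by omega : s < (π.symm p : ℕ)), h2]
      · rw [if_neg h2, if_neg (by omega : ¬ s < (π.symm p : ℕ))]
  congr 1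
  · rw [← Finset.add_sum_erase _ _ (Finset.mem_univ i)]
    have h0 : ∑ p, coeff π top 0 s i p * share (π i) p (V i) = 0 := by
      refine Finset.sum_eq_zero fun p _ => ?_
      rw [coeff, if_neg (lt_irrefl s), zero_mul]
    rw [h0, zero_add]
    refine Finset.sum_congr rfl fun j hj => Finset.sum_congr rfl fun p _ => ?_
    have hji := Finset.ne_of_mem_erase hj
    have hji' : (j : ℕ) ≠ s := fun h => hji (Fin.ext h)
    rw [Function.update_of_ne hji, hcoeff, coeff]
    congr 1
    by_cases h1 : (j : ℕ) < s
    · rw [if_pos (by omega), if_pos h1, zero_mul, ite_self]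
    · rw [if_neg (by omega), if_neg h1]
  · refine Finset.sum_congr rfl fun p _ => ?_
    rw [Function.update_self, hcoeff, if_pos (by simp [hi]), newCoeff]

/-- Before the search every element of `U` is a candidate, so each share is at most `B`; what
remains is the sum of the weights of the later positions. -/
theorem sum_newCoeff_le (h2 : 2 ≤ capacity n 1) (ht : 0 ≤ top) (hB : 0 ≤ B) (a : Fin n)
    {U : Finset (Fin n)} (hU : 1 / B ≤ (U.card : ℝ) - 1) (hB' : 0 < B) :
    ∑ p, newCoeff π top s p * share a p U ≤ top * B * (27 * n / (capacity n 1 : ℝ) ^ 2) := by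
  have hshare : ∀ p, share a p U ≤ B := fun p => by
    unfold share
    split_ifs
    · exact (one_div_le hB' (lt_of_lt_of_le (by positivity) hU)).1 hU
    · exact hB
  calc ∑ p, newCoeff π top s p * share a p U ≤ ∑ p, newCoeff π top s p * B :=
        Finset.sum_le_sum fun p _ => mul_le_mul_of_nonneg_left (hshare p) (newCoeff_nonneg ht p)
    _ = top * B * ∑ p : Fin n,
          (if s < (π.symm p : ℕ) then weight n (π.symm p - s) else 0) := by
        rw [Finset.mul_sum]
        refine Finset.sum_congr rfl fun p _ => ?_
        unfold newCoeff
        split_ifs <;> ring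
    _ = top * B * ∑ i : Fin n, (if s < (i : ℕ) then weight n (i - s) else 0) := by
        congr 1
        exact Equiv.sum_comp π.symm fun i : Fin n => if s < (i : ℕ) then weight n (i - s) else 0
    _ ≤ _ := mul_le_mul_of_nonneg_left (sum_weight_gt_le h2 s) (mul_nonneg ht hB)

end potential

/-! ### Invariants of the state -/

/-- The candidate sets are right, `x` is right in the first `s` positions, and its score is
known. -/
structure Inv {n : ℕ} (z : BitString n) (π : Equiv.Perm (Fin n)) (σ : State n) : Prop where
  cand : Cand π σ.s σ.V
  agree : ∀ j : Fin n, (j : ℕ) < σ.s → z (π j) = σ.x (π j)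
  fx : σ.fx = score z π σ.x

/-- The string `x` has score `s`, the string `y` has a larger score, and no candidate set contains
the next position. -/
structure Ready {n : ℕ} (z : BitString n) (π : Equiv.Perm (Fin n)) (σ : State n) : Prop
    extends Inv z π σ where
  lt : σ.s < n
  fx_eq : σ.fx = σ.s
  fy : σ.fy = score z π σ.y
  lt_fy : σ.s < σ.fy
  fresh : ∀ hs : σ.s < n, ∀ j : Fin n, (j : ℕ) < σ.s → π ⟨σ.s, hs⟩ ∉ σ.V j

section state

variable {n : ℕ} {z : BitString n} {π : Equiv.Perm (Fin n)} {σ : State n}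

theorem mem_covered {i : Fin n} : i ∈ σ.covered ↔ ∃ j : Fin n, (j : ℕ) < σ.s ∧ i ∈ σ.V j := by
  simp [State.covered]

@[simp] theorem orient_V : σ.orient.V = σ.V := by unfold State.orient; split_ifs <;> rfl
@[simp] theorem orient_s : σ.orient.s = σ.s := by unfold State.orient; split_ifs <;> rfl
@[simp] theorem orient_failures : σ.orient.failures = σ.failures := by
  unfold State.orient; split_ifs <;> rfl

/-- If no candidate set contains the next position, then exactly one of `x` and the string obtained
by flipping everything outside the candidate sets is right in that position. -/
theorem Inv.orient_ready (h : Inv z π σ) (hs : σ.s < n)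
    (hfresh : ∀ j : Fin n, (j : ℕ) < σ.s → π ⟨σ.s, hs⟩ ∉ σ.V j) {y : BitString n} {r : ℕ}
    (hr : r = score z π y) (hy : ∀ j : Fin n, (j : ℕ) < σ.s → z (π j) = y (π j))
    (hyx : y (π ⟨σ.s, hs⟩) = !(σ.x (π ⟨σ.s, hs⟩))) :
    ¬ ((σ.s < σ.fx ∧ σ.s < r) ∨ (σ.fx = σ.s ∧ r = σ.s)) ∧
      Ready z π { σ with y := y, fy := r }.orient := by
  set i : Fin n := ⟨σ.s, hs⟩ with hi
  have hlow : ∀ w : BitString n, (∀ j : Fin n, (j : ℕ) < σ.s → z (π j) = w (π j)) →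
      z (π i) = w (π i) → σ.s < (score z π w : ℕ) := fun w hw hwi => by
    have : (i : ℕ) < score z π w := by
      rw [lt_score_iff]
      intro j hj
      rcases hj.lt_or_eq with hj | rfl
      · exact hw j hj
      · exact hwi
    exact this
  have heq : ∀ w : BitString n, (∀ j : Fin n, (j : ℕ) < σ.s → z (π j) = w (π j)) →
      z (π i) ≠ w (π i) → (score z π w : ℕ) = σ.s := fun w hw hwi =>
    score_eq_of_ne i (fun j hj => hw j hj) hwi
  by_cases hz : z (π i) = σ.x (π i)
  · have h1 : σ.s < σ.fx := h.fx ▸ hlow σ.x h.agree hz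
    have h2 : r = σ.s := by
      rw [hr]
      refine heq y hy ?_
      rw [hyx, hz]
      cases σ.x (π i) <;> simp
    refine ⟨by omega, ?_⟩
    have e : ({ σ with y := y, fy := r } : State n).orient =
        { σ with x := y, fx := r, y := σ.x, fy := σ.fx } := by
      unfold State.orient
      rw [if_pos h1]
    rw [e]
    exact ⟨⟨h.cand, hy, hr⟩, hs, h2, h.fx, h1, fun _ => hfresh⟩
  · have h1 : σ.fx = σ.s := h.fx ▸ heq σ.x h.agree hz
    have h2 : σ.s < r := by
      rw [hr]
      refine hlow y hy ?_
      rw [hyx]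
      revert hz
      cases z (π i) <;> cases σ.x (π i) <;> simp
    refine ⟨by omega, ?_⟩
    have e : ({ σ with y := y, fy := r } : State n).orient = { σ with y := y, fy := r } := by
      unfold State.orient
      rw [if_neg (by simp only; omega)]
    rw [e]
    exact ⟨⟨h.cand, h.agree, h.fx⟩, hs, h1, hr, h2, fun _ => hfresh⟩

theorem Inv.agree_flip (h : Inv z π σ) (j : Fin n) (hj : (j : ℕ) < σ.s) :
    z (π j) = flipBits σ.x (Finset.univ \ σ.covered) (π j) := by
  rw [flipBits_of_notMem, h.agree j hj]
  simp only [Finset.mem_sdiff, Finset.mem_univ, true_and, not_not]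
  exact mem_covered.2 ⟨j, hj, h.cand.mem j hj⟩

/-- Querying `y` leads to a failure exactly if some candidate set contains the next position. -/
theorem Inv.check (h : Inv z π σ) (hs : σ.s < n) {y : BitString n} {r : ℕ}
    (hyd : y = flipBits σ.x (Finset.univ \ σ.covered)) (hr : r = score z π y) :
    (((σ.s < σ.fx ∧ σ.s < r) ∨ (σ.fx = σ.s ∧ r = σ.s)) ∧
        ∃ j : Fin n, (j : ℕ) < σ.s ∧ π ⟨σ.s, hs⟩ ∈ σ.V j) ∨
      (¬ ((σ.s < σ.fx ∧ σ.s < r) ∨ (σ.fx = σ.s ∧ r = σ.s)) ∧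
        Ready z π { σ with y := y, fy := r }.orient) := by
  have hy : ∀ j : Fin n, (j : ℕ) < σ.s → z (π j) = y (π j) := fun j hj => by
    rw [hyd]; exact h.agree_flip j hj
  by_cases hc : π ⟨σ.s, hs⟩ ∈ σ.covered
  · left
    refine ⟨?_, mem_covered.1 hc⟩
    have hyx : y (π ⟨σ.s, hs⟩) = σ.x (π ⟨σ.s, hs⟩) := by
      rw [hyd, flipBits_of_notMem]; simp [hc]
    have h1 : σ.s ≤ σ.fx := by rw [h.fx, le_score_iff hs.le]; exact h.agree
    have h2 : σ.s ≤ r := by rw [hr, le_score_iff hs.le]; exact hy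
    have h3 : ∀ w : BitString n, (∀ j : Fin n, (j : ℕ) < σ.s → z (π j) = w (π j)) →
        (σ.s < (score z π w : ℕ) ↔ z (π ⟨σ.s, hs⟩) = w (π ⟨σ.s, hs⟩)) := fun w hw => by
      have := lt_score_iff (z := z) (π := π) (x := w) ⟨σ.s, hs⟩
      simp only at this
      rw [this]
      constructor
      · exact fun h => h _ le_rfl
      · intro h j hj
        rcases hj.lt_or_eq with hj | rfl
        · exact hw j hj
        · exact h
    have h4 : σ.s < σ.fx ↔ σ.s < r := by
      rw [hr, h.fx, h3 σ.x h.agree, h3 y hy, hyx]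
    omega
  · right
    refine h.orient_ready hs (fun j hj hmem => hc (mem_covered.2 ⟨j, hj, hmem⟩)) hr hy ?_
    rw [hyd, flipBits_of_mem]
    simp [hc]

end state

/-! ### The levels of the strategy -/

/-- The passage from `σ` to `σ'` has treated the positions in `J`, at least one and at most `ρ`,
and their candidate sets have size at most `m`. -/
structure Advanced {n : ℕ} (z : BitString n) (π : Equiv.Perm (Fin n)) (ρ m : ℕ) (σ : State n)
    (J : Finset (Fin n)) (σ' : State n) : Prop where
  inv : Inv z π σ'
  lt : σ.s < σ'.s
  le : σ'.s ≤ σ.s + ρ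
  mem_iff : ∀ j : Fin n, j ∈ J ↔ σ.s ≤ j ∧ (j : ℕ) < σ'.s
  keep : ∀ j : Fin n, (j : ℕ) < σ.s → σ'.V j = σ.V j
  size : ∀ j ∈ J, (σ'.V j).card ≤ m

theorem card_of_mem_iff {n a b : ℕ} {J : Finset (Fin n)} (hb : b ≤ n)
    (h : ∀ j : Fin n, j ∈ J ↔ a ≤ j ∧ (j : ℕ) < b) : J.card = b - a := by
  rw [← Nat.card_Ico, ← Finset.card_map Fin.valEmbedding]
  congr 1
  ext i
  simp only [Finset.mem_map, Fin.valEmbedding_apply, Finset.mem_Ico]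
  constructor
  · rintro ⟨j, hj, rfl⟩
    exact (h j).1 hj
  · rintro ⟨h1, h2⟩
    exact ⟨⟨i, by omega⟩, (h _).2 ⟨h1, h2⟩, rfl⟩

/-- The factor in the cost of a size reduction. -/
noncomputable def reductionFactor (d : ℕ) (c : ℝ) : ℝ := d * (4 * c + 8)

/-- The factor in the amount that is charged to a failure. -/
noncomputable def failureFactor (d : ℕ) (c : ℝ) : ℝ := 6 * reductionFactor d c + 3

/-- The potential of a state before the next check of its position `s` for a failure, when this
position has passed through the checks on the levels up to `l`. -/
noncomputable def levelPotential {n : ℕ} (π : Equiv.Perm (Fin n)) (d t : ℕ) (c : ℝ) (l : ℕ)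
    (σ : State n) : ℝ :=
  potential π (coeff π (failureFactor d c * (t + 1)) (failureFactor d c * (t + 1 - l)) σ.s) σ.V

/-- The increase of the potential by the treatment of a position. -/
noncomputable def potentialCost (n d t : ℕ) (c B : ℝ) : ℝ :=
  failureFactor d c * (t + 1) * B * (27 * n / (capacity n 1 : ℝ) ^ 2)

/-- The cost per treated position of the parts of a loop on level `l + 1` that precede the
check. -/
noncomputable def slope (n d t : ℕ) (c B a : ℝ) : ℕ → ℝ
  | 0 => a * (d * Nat.clog 2 (capacity n 1) : ℕ) + potentialCost n d t c B
  | l + 1 => slope n d t c B a l + a + 2 * reductionFactor d c * a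

section levels

variable {n d t q : ℕ} {c B : ℝ} {κ : Bool → ℝ} {z : BitString n} {π : Equiv.Perm (Fin n)}

theorem reductionFactor_nonneg (hc : 0 ≤ c) : 0 ≤ reductionFactor d c := by
  unfold reductionFactor; positivity

theorem failureFactor_pos (hc : 0 ≤ c) : 0 < failureFactor d c := by
  have := reductionFactor_nonneg (d := d) hc
  unfold failureFactor; positivity

theorem levelPotential_nonneg (hc : 0 ≤ c) {l : ℕ} (hl : l ≤ t) (σ : State n) :
    0 ≤ levelPotential π d t c l σ := by
  have h := (failureFactor_pos (d := d) hc).le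
  have : (l : ℝ) ≤ t := by exact_mod_cast hl
  exact potential_nonneg (mul_nonneg h (by positivity)) (mul_nonneg h (by linarith))

/-- If no candidate set contains `π s`, the current coefficient multiplies only zero shares. So the
allowance for position `s` may be restored without cost after a passed check. -/
theorem Ready.levelPotential_eq {σ : State n} (h : Ready z π σ) (l l' : ℕ) :
    levelPotential π d t c l σ = levelPotential π d t c l' σ :=
  potential_eq_of_fresh h.fresh _

theorem Ready.ne {σ : State n} (h : Ready z π σ) :
    z (π ⟨σ.s, h.lt⟩) ≠ σ.x (π ⟨σ.s, h.lt⟩) := by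
  intro he
  have : ((⟨σ.s, h.lt⟩ : Fin n) : ℕ) < score z π σ.x := by
    rw [lt_score_iff]
    intro j hj
    rcases hj.lt_or_eq with hj | rfl
    · exact h.agree j hj
    · exact he
  rw [← h.fx, h.fx_eq] at this
  simp at this

theorem Sized.mono {l e s l' e' s' : ℕ} {V : Fin n → Finset (Fin n)} (h : Sized n d t l e s V)
    (hl : l' ≤ l) (he : e' ≤ e) (hs : s' ≤ s) : Sized n d t l' e' s' V := fun j hj => by
  rcases h j (hj.trans_le hs) with h | ⟨i, h1, h2, h3, h4⟩
  · exact Or.inl h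
  · exact Or.inr ⟨i, hl.trans h1, h2, h3, he.trans h4⟩

/-- The price of the binary search and the potential of the new candidate set together make up
`slope` at level `0`, charged to the one position that is treated. -/
theorem fillOne_bd (hκ : 0 ≤ κ false) (hc : 0 ≤ c) (hL : Large n d t q B) {N : ℕ} (hN : n < N)
    {σ : State n} (h : Ready z π σ) (hV : Sized n d t 1 (σ.s + 1) σ.s σ.V)
    (hs : σ.s + 1 ≤ q + reach n t) :
    Bd κ z π (fillOne N d σ) (fun w => Advanced z π 1 (targetSize d n 1) σ w.1 w.2)
      (fun w => w.2.failures + levelPotential π d t c 0 w.2 -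
        slope n d t c B (κ false) 0 * (w.2.s : ℝ))
      (σ.failures + levelPotential π d t c 0 σ - slope n d t c B (κ false) 0 * (σ.s : ℝ)) := by
  unfold fillOne
  rw [dif_pos h.lt]
  set i : Fin n := ⟨σ.s, h.lt⟩ with hi
  set U := Finset.univ \ σ.covered with hU
  set top : ℝ := failureFactor d c * (t + 1) with htop
  have htop0 : 0 ≤ top := mul_nonneg (failureFactor_pos hc).le (by positivity)
  have hUn : U.card ≤ n := by simpa using Finset.card_le_univ U
  have hn := hL.n_pos
  have hm := one_le_targetSize (d := d) hn hL.two_le 1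
  have hiU : π i ∈ U := by
    simp only [hU, Finset.mem_sdiff, Finset.mem_univ, true_and, mem_covered, not_exists, not_and]
    exact h.fresh h.lt
  have hlow : ∀ j : Fin n, j < i → π j ∉ U := fun j hj hmem => by
    simp only [hU, Finset.mem_sdiff, Finset.mem_univ, true_and, mem_covered] at hmem
    exact hmem ⟨j, hj, h.cand.mem j hj⟩
  -- The number of halvings: the size has to fall by a factor of at most `α_1 ^ d`, and `α_1 ≤ 2 ^
  -- ⌈log₂ α_1⌉`.
  have hpow : n ≤ 2 ^ (d * Nat.clog 2 (capacity n 1)) * targetSize d n 1 := by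
    refine (le_pow_mul_targetSize (d := d) hL.two_le 1).trans (Nat.mul_le_mul_right _ ?_)
    rw [mul_comm, pow_mul]
    exact Nat.pow_le_pow_left (Nat.le_pow_clog one_lt_two _) d
  have hUcard : 1 / B ≤ (U.card : ℝ) - 1 := by
    have h1 := hL.card_covered_le (hV.mono le_rfl (Nat.le_succ _) le_rfl) h.lt.le
    have h2 := hL.room σ.s (by omega)
    have h3 : (U.card : ℝ) = n - σ.covered.card := by
      rw [hU, Finset.card_sdiff_of_subset (Finset.subset_univ _), Finset.card_univ,
        Fintype.card_fin, Nat.cast_sub]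
      simpa using Finset.card_le_univ σ.covered
    linarith
  have hβ := sum_newCoeff_le (π := π) (s := σ.s) hL.two_le htop0 hL.pos.le (π i) hUcard hL.pos
  have hsearch := randBinSearch_bd hκ (fun j hj => h.agree j hj) h.ne hm
    (newCoeff_nonneg (π := π) (s := σ.s) htop0) N U (d * Nat.clog 2 (capacity n 1)) (by omega)
    (hUn.trans hpow) hiU hlow
  refine Bd.bind ((hsearch.add_const (σ.failures + potential π (coeff π top 0 σ.s) σ.V -
    slope n d t c B (κ false) 0 * ((σ.s : ℝ) + 1))).mono (fun _ h => h) (fun _ _ => le_rfl) ?_) ?_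
  · have e : levelPotential π d t c 0 σ = potential π (coeff π top 0 σ.s) σ.V :=
      potential_eq_of_fresh h.fresh _
    rw [e]
    have hsl : slope n d t c B (κ false) 0 = κ false * (d * Nat.clog 2 (capacity n 1) : ℕ) +
      top * B * (27 * n / (capacity n 1 : ℝ) ^ 2) := rfl
    rw [hsl]
    nlinarith
  · rintro W ⟨hWU, hiW, hWm⟩
    refine Bd.done ⟨⟨⟨fun j hj => ?_, ?_⟩, fun j hj => ?_, h.fy⟩, Nat.lt_succ_self _, le_rfl,
      fun j => ?_, fun j hj => ?_, fun j hj => ?_⟩ ?_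
    · rcases (Nat.lt_succ_iff_lt_or_eq.1 hj) with hj | hj
      · have : j ≠ i := fun h' => by rw [h'] at hj; simp [hi] at hj
        simp only [Function.update_of_ne this]
        exact h.cand.mem j hj
      · have : j = i := Fin.ext hj
        subst this
        simpa using hiW
    · have hWdisj : ∀ j : Fin n, (j : ℕ) < σ.s → Disjoint W (σ.V j) := fun j hj => by
        rw [Finset.disjoint_left]
        intro a ha ha'
        have := hWU ha
        simp only [hU, Finset.mem_sdiff, Finset.mem_univ, true_and, mem_covered] at this
        exact this ⟨j, hj, ha'⟩
      intro j j' hj hj' hne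
      simp only at hj hj' ⊢
      by_cases h1 : j = i
      · subst h1
        rw [Function.update_self, Function.update_of_ne hne.symm]
        refine hWdisj j' ?_
        have : (j' : ℕ) ≠ σ.s := fun h' => hne (Fin.ext h'.symm)
        omega
      · have h1' : (j : ℕ) ≠ σ.s := fun h' => h1 (Fin.ext h')
        rw [Function.update_of_ne h1]
        by_cases h2 : j' = i
        · subst h2
          rw [Function.update_self]
          exact (hWdisj j (by omega)).symm
        · have h2' : (j' : ℕ) ≠ σ.s := fun h' => h2 (Fin.ext h')
          rw [Function.update_of_ne h2]
          exact h.cand.disj j j' (by omega) (by omega) hne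
    -- The new `x` is the old `y`, whose score exceeds `s`, so it is right in one position more.
    · have h1 : σ.s + 1 ≤ (score z π σ.y : ℕ) := h.fy ▸ h.lt_fy
      exact (le_score_iff (Nat.succ_le_of_lt h.lt)).1 h1 j hj
    · simp only [Finset.mem_singleton, Fin.ext_iff, hi]
      omega
    · have : j ≠ i := fun h' => by rw [h'] at hj; simp [hi] at hj
      simp only [Function.update_of_ne this]
    · rw [Finset.mem_singleton] at hj
      subst hj
      simpa using hWm
    · simp only [levelPotential, Nat.cast_zero, sub_zero, ← htop]
      rw [potential_update h.lt W]
      push_cast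
      linarith

/-- The loop of `advance` on level `l + 1`, for any method of providing new indices. -/
theorem advanceLoop_bd (hκ : 0 ≤ κ false) (hc : 0 ≤ c) (hL : Large n d t q B) {l : ℕ}
    (hl : l + 1 ≤ t) {E : ℝ} {fill : State n → Prog n (Finset (Fin n) × State n)}
    (hfill : ∀ σ : State n, Ready z π σ → Sized n d t (l + 1) (σ.s + reach n l) σ.s σ.V →
      σ.s + reach n l ≤ q + reach n t →
      Bd κ z π (fill σ) (fun w => Advanced z π (reach n l) (targetSize d n (l + 1)) σ w.1 w.2)
        (fun w => w.2.failures + levelPotential π d t c l w.2 - E * (w.2.s : ℝ))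
        (σ.failures + levelPotential π d t c 0 σ - E * (σ.s : ℝ)))
    {σ₀ : State n} (hV₀ : Sized n d t (l + 2) (σ₀.s + reach n (l + 1)) σ₀.s σ₀.V)
    (hs₀ : σ₀.s + reach n (l + 1) ≤ q + reach n t) (N : ℕ) :
    ∀ (J : Finset (Fin n)) (σ : State n), 1 ≤ N →
      (J.card ≤ capacity n (l + 1) → capacity n (l + 1) + 2 ≤ N + J.card) →
      Ready z π σ → σ₀.s ≤ σ.s → σ.s ≤ σ₀.s + reach n (l + 1) →
      (∀ j : Fin n, j ∈ J ↔ σ₀.s ≤ j ∧ (j : ℕ) < σ.s) →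
      (∀ j : Fin n, (j : ℕ) < σ₀.s → σ.V j = σ₀.V j) →
      (∀ j ∈ J, (σ.V j).card ≤ targetSize d n (l + 1)) →
      Bd κ z π (advanceLoop (capacity n (l + 1)) fill N J σ)
        (fun w => Advanced z π (reach n (l + 1)) (targetSize d n (l + 1)) σ₀ w.1 w.2.2 ∧
          (w.2.1 = false → Ready z π w.2.2 ∧ capacity n (l + 1) < w.1.card))
        (fun w => w.2.2.failures + levelPotential π d t c (l + 1) w.2.2 +
          (if w.2.1 then (failureFactor d c - 1) * capacity n (l + 1) else 0) -
          (E + κ false) * (w.2.2.s : ℝ))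
        (σ.failures + levelPotential π d t c 0 σ - (E + κ false) * (σ.s : ℝ)) := by
  have hreach : reach n (l + 1) = capacity n (l + 1) + reach n l := rfl
  induction N with
  | zero => intro J σ h; omega
  | succ N ih =>
    intro J σ _ hN h hle hle' hJ hkeep hsize
    have hcardJ := card_of_mem_iff h.lt.le hJ
    unfold advanceLoop
    by_cases hcap : J.card ≤ capacity n (l + 1)
    · rw [if_pos hcap]
      -- The loop goes on only while at most `α_{l+1}` indices are collected, so even the first of
      -- them is within reach of wherever `fill` may lead.
      have hσ : Sized n d t (l + 1) (σ.s + reach n l) σ.s σ.V := by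
        intro j hj
        by_cases hj₀ : (j : ℕ) < σ₀.s
        · rw [hkeep j hj₀]
          rcases hV₀ j hj₀ with h1 | ⟨i, h1, h2, h3, h4⟩
          · exact Or.inl h1
          · exact Or.inr ⟨i, by omega, h2, h3, by omega⟩
        · exact Or.inr ⟨l + 1, le_rfl, hl, hsize j ((hJ j).2 ⟨by omega, hj⟩), by omega⟩
      refine Bd.bind (((hfill σ h hσ (by omega)).add_const (-(κ false * (σ.s : ℝ)))).mono
        (fun _ h => h) (fun _ _ => le_rfl) (by linarith)) ?_
      rintro ⟨J', τ⟩ hτ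
      simp only at hτ ⊢
      have hτs := hτ.lt
      have hτle := hτ.le
      have hτn : τ.s < n := hL.lt_n (by omega)
      have hsub : ∀ j : Fin n, j ∈ J ∪ J' ↔ σ₀.s ≤ j ∧ (j : ℕ) < τ.s := fun j => by
        rw [Finset.mem_union, hJ, hτ.mem_iff]; omega
      have hkeep' : ∀ j : Fin n, (j : ℕ) < σ₀.s → τ.V j = σ₀.V j := fun j hj => by
        rw [hτ.keep j (by omega), hkeep j hj]
      have hsize' : ∀ j ∈ J ∪ J', (τ.V j).card ≤ targetSize d n (l + 1) := fun j hj => by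
        by_cases hj' : j ∈ J'
        · exact hτ.size j hj'
        · have hjJ : j ∈ J := (Finset.mem_union.1 hj).resolve_right hj'
          rw [hτ.keep j ((hJ j).1 hjJ).2]
          exact hsize j hjJ
      have hτσ : Sized n d t (l + 1) τ.s τ.s τ.V := by
        intro j hj
        by_cases hjs : (j : ℕ) < σ.s
        · rw [hτ.keep j hjs]
          exact hσ.mono le_rfl hτle le_rfl j hjs
        · exact Or.inr ⟨l + 1, le_rfl, hl, hτ.size j ((hτ.mem_iff j).2 ⟨by omega, hj⟩),
            by omega⟩
      have hsd : (σ.s : ℝ) + 1 ≤ τ.s := by exact_mod_cast hτs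
      have hκs : κ false ≤ κ false * ((τ.s : ℝ) - σ.s) := by nlinarith
      have hcap1 : (1 : ℝ) ≤ capacity n (l + 1) := by
        have := two_le_capacity hL.two_le (l + 1)
        exact_mod_cast (by omega : 1 ≤ capacity n (l + 1))
      refine Bd.ask ?_
      set y := flipBits τ.x (Finset.univ \ τ.covered) with hy
      set r : ℕ := (score z π y).val with hr
      rcases hτ.inv.check hτn hy hr with ⟨hfail, j, hj, hmem⟩ | ⟨hok, hready⟩
      · rw [if_pos hfail]
        refine Bd.done ⟨⟨⟨hτ.inv.cand, hτ.inv.agree, hτ.inv.fx⟩, by simp only; omega,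
          by simp only; omega, hsub, hkeep', hsize'⟩, by simp⟩ ?_
        -- The candidate set containing the next position releases `failureFactor * α_{l+1}`. At
        -- least one unit counts the failure, and `failureFactor - 1` times the capacity is handed
        -- over to the size reduction that follows.
        have hpay := potential_add_le (top := failureFactor d c * (t + 1))
          (cur := failureFactor d c * (t + 1 - (l + 1 : ℕ))) hτn hj hmem
          (failureFactor_pos (d := d) hc).le (hτ.inv.cand.mem j hj) (hL.capacity_mul_le hτσ hj)
        have e : failureFactor d c * ((t : ℝ) + 1 - (l + 1 : ℕ)) + failureFactor d c =
            failureFactor d c * (t + 1 - l) := by push_cast; ring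
        rw [e] at hpay
        simp only [levelPotential, if_true]
        push_cast at hpay ⊢
        nlinarith
      · rw [if_neg hok]
        have hcard' : (J ∪ J').card = τ.s - σ₀.s := card_of_mem_iff hτn.le hsub
        refine (ih (J ∪ J') _ (by have := hN hcap; omega) (fun _ => by have := hN hcap; omega)
          hready ?_ ?_ ?_ ?_ ?_).mono (fun _ h => h) (fun _ _ => le_rfl) ?_
        · simp only [orient_s]; omega
        · simp only [orient_s]; omega
        · simpa only [orient_s] using hsub
        · simpa only [orient_V] using hkeep'
        · simpa only [orient_V] using hsize'
        · rw [hready.levelPotential_eq 0 l]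
          simp only [levelPotential, orient_s, orient_V, orient_failures]
          nlinarith
    · rw [if_neg hcap]
      have hpos : σ₀.s < σ.s := by omega
      refine Bd.done ⟨⟨h.toInv, hpos, hle', hJ, hkeep, hsize⟩, fun _ => ⟨h, not_le.1 hcap⟩⟩ ?_
      rw [h.levelPotential_eq 0 (l + 1)]
      simp

end levels

/-! ### Recursion over the levels, and the first phase -/

section phases

variable {n d t q : ℕ} {c B : ℝ} {κ : Bool → ℝ} {z : BitString n} {π : Equiv.Perm (Fin n)}

theorem Large.capacity_le (hL : Large n d t q B) {i : ℕ} (hi : i ≤ t) : capacity n i ≤ n := by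
  refine (capacity_mono hL.two_le hi).trans (le_trans ?_ hL.pow_le)
  exact Nat.le_self_pow (by have := hL.four_le; omega) _

theorem Large.ceil_le (hL : Large n d t q B) (hc : 0 ≤ c) {i : ℕ} (hi : i ≤ t) :
    ⌈c * capacity n i⌉₊ ≤ ⌈c * n⌉₊ := by
  refine Nat.ceil_mono (mul_le_mul_of_nonneg_left ?_ hc)
  exact_mod_cast hL.capacity_le hi

/-- The size reduction after a call of `advance` on level `l`. -/
theorem Advanced.sizeReduction_bd (hκ : ∀ tag, 0 ≤ κ tag) (hκ2 : κ true ≤ 2)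
    (hc : ∀ k : ℕ, 1 ≤ k → (1 - 1 / (k : ℝ)) ^ (c * (k : ℝ)) ≤ 1 / 2)
    (hL : Large n d t q B) {l m N : ℕ} (hl : l ≤ t) (hm : 1 ≤ m)
    (hml : targetSize d n l ≤ m * capacity n l ^ d) (hN : n * n + n + ⌈c * n⌉₊ < N)
    {σ τ : State n} {J : Finset (Fin n)} {flag : Bool}
    (h : Advanced z π (reach n l) (targetSize d n l) σ J τ)
    (hflag : flag = false → Ready z π τ ∧ capacity n l < J.card) (hτ : τ.s ≤ n) :
    Bd κ z π (sizeReduction N flag c (capacity n l) J m τ.x τ.V)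
      (fun V' => Advanced z π (reach n l) m σ J { τ with V := V' } ∧
        (flag = false → Ready z π { τ with V := V' }))
      (fun V' => levelPotential π d t c l { τ with V := V' })
      (levelPotential π d t c l τ + if flag then (failureFactor d c - 1) * capacity n l - 2
        else 2 * reductionFactor d c * κ false * ((τ.s : ℝ) - σ.s)) := by
  have hc0 := nonneg_of_pow_le_half hc
  have hK := reductionFactor_nonneg (d := d) hc0
  have hlt := h.lt
  have hle := h.le
  have hcard := card_of_mem_iff hτ h.mem_iff
  have hw : ∀ j p : Fin n, 0 ≤ coeff π (failureFactor d c * (t + 1))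
      (failureFactor d c * (t + 1 - l)) τ.s j p := fun j p => by
    have h1 := (failureFactor_pos (d := d) hc0).le
    have : (l : ℝ) ≤ t := by exact_mod_cast hl
    exact coeff_nonneg (mul_nonneg h1 (by positivity)) (mul_nonneg h1 (by linarith)) j p
  have hne : J.Nonempty := Finset.card_pos.1 (by omega)
  have hcapceil := hL.ceil_le hc0 hl
  refine (PermMastermind.sizeReduction_bd (κ := κ) (tag := flag) (D := d) (hκ flag) hc h.inv.agree hm hw
    (two_le_capacity hL.two_le l) h.inv.cand (fun j hj => ((h.mem_iff j).1 hj).2) hne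
    (fun j hj => (h.size j hj).trans hml) (by omega)).mono (fun V' hV' => ?_)
    (fun _ _ => le_rfl) ?_
  · have hinv : Inv z π { τ with V := V' } := ⟨hV'.1.cand h.inv.cand, h.inv.agree, h.inv.fx⟩
    refine ⟨⟨hinv, hlt, hle, h.mem_iff, fun j hj => ?_, hV'.2⟩, fun hf => ?_⟩
    · rw [← h.keep j hj]
      exact hV'.1.eq j fun hj' => by have := ((h.mem_iff j).1 hj').1; omega
    · have hr := (hflag hf).1
      exact ⟨hinv, hr.lt, hr.fx_eq, hr.fy, hr.lt_fy, fun hs j hj hmem =>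
        hr.fresh hs j hj (hV'.1.sub j hmem)⟩
  · rw [add_comm]
    refine add_le_add le_rfl ?_
    have hα2 : (2 : ℝ) ≤ capacity n l := by exact_mod_cast two_le_capacity hL.two_le l
    have hJs : (J.card : ℝ) = τ.s - σ.s := by rw [hcard, Nat.cast_sub hlt.le]
    rw [← mul_assoc (d : ℝ), show (d : ℝ) * (4 * c + 8) = reductionFactor d c from rfl]
    -- Without a failure there are more than `α_l` indices, and the reduction is charged to them.
    -- After a failure there may be few, so the credit of the failure is used: `6 = 2 * 3` comes
    -- from `κ true ≤ 2` and `α_l + |J| ≤ 3 * α_l`, and at least `2` units remain unspent.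
    cases flag
    · have h1 : (capacity n l : ℝ) ≤ J.card := by exact_mod_cast (hflag rfl).2.le
      simp only [Bool.false_eq_true, if_false]
      rw [← hJs]
      have h2 : reductionFactor d c * ((capacity n l : ℝ) + J.card) ≤
          reductionFactor d c * (2 * J.card) := by gcongr; linarith
      nlinarith [mul_le_mul_of_nonneg_left h2 (hκ false)]
    · simp only [if_true]
      have h1 : (J.card : ℝ) ≤ 2 * capacity n l := by
        have := reach_le hL.two_le l
        exact_mod_cast (by omega : J.card ≤ 2 * capacity n l)
      have h2 : reductionFactor d c * ((capacity n l : ℝ) + J.card) ≤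
          reductionFactor d c * (3 * capacity n l) := by gcongr; linarith
      have h3 : κ true * (reductionFactor d c * ((capacity n l : ℝ) + J.card)) ≤
          2 * (reductionFactor d c * (3 * capacity n l)) :=
        mul_le_mul hκ2 h2 (by positivity) (by norm_num)
      unfold failureFactor
      nlinarith

/-- A call on the level below followed by its size reduction is a `fill` for the loop above. The
slope rises by one check and one reduction per treated position; reductions after failures live on
the credit of the failure. -/
theorem advance_bd (hκ : ∀ tag, 0 ≤ κ tag) (hκ2 : κ true ≤ 2)
    (hc : ∀ k : ℕ, 1 ≤ k → (1 - 1 / (k : ℝ)) ^ (c * (k : ℝ)) ≤ 1 / 2)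
    (hL : Large n d t q B) {N : ℕ} (hN : n * n + n + ⌈c * n⌉₊ + 2 < N) (l : ℕ) :
    l + 1 ≤ t → ∀ σ : State n, Ready z π σ →
      Sized n d t (l + 2) (σ.s + reach n (l + 1)) σ.s σ.V →
      σ.s + reach n (l + 1) ≤ q + reach n t →
      Bd κ z π (advance N d c (l + 1) σ)
        (fun w => Advanced z π (reach n (l + 1)) (targetSize d n (l + 1)) σ w.1 w.2.2 ∧
          (w.2.1 = false → Ready z π w.2.2 ∧ capacity n (l + 1) < w.1.card))
        (fun w => w.2.2.failures + levelPotential π d t c (l + 1) w.2.2 +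
          (if w.2.1 then (failureFactor d c - 1) * capacity n (l + 1) else 0) -
          (slope n d t c B (κ false) l + κ false) * (w.2.2.s : ℝ))
        (σ.failures + levelPotential π d t c 0 σ -
          (slope n d t c B (κ false) l + κ false) * (σ.s : ℝ)) := by
  have hc0 := nonneg_of_pow_le_half hc
  induction l with
  | zero =>
    intro hl σ h hV hs
    have hcap := hL.capacity_le hl
    exact advanceLoop_bd (hκ false) hc0 hL hl
      (fun τ hτ hτV hτs => fillOne_bd (hκ false) hc0 hL (by omega) hτ hτV hτs) hV hs N ∅ σ
      (by omega) (fun _ => by simp only [zero_add] at hcap ⊢; omega) h le_rfl (by omega)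
      (fun j => by simp) (fun _ _ => rfl) (fun j hj => by simp at hj)
  | succ l ih =>
    intro hl σ h hV hs
    have hcap := hL.capacity_le hl
    unfold advance
    refine advanceLoop_bd (hκ false) hc0 hL hl (E := slope n d t c B (κ false) (l + 1))
      (fun τ hτ hτV hτs => ?_) hV hs N ∅ σ
      (by omega) (fun _ => by omega) h le_rfl (by omega)
      (fun j => by simp) (fun _ _ => rfl) (fun j hj => by simp at hj)
    refine Bd.bind (((ih (by omega) τ hτ hτV hτs).add_const
      (-(2 * reductionFactor d c * κ false * (τ.s : ℝ)))).mono (fun _ h => h) (fun _ _ => le_rfl)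
      ?_) ?_
    · simp only [slope]
      linarith
    · rintro ⟨J, flag, ρ⟩ ⟨hadv, hflag⟩
      simp only at hadv hflag ⊢
      have hρle := hadv.le
      have hρn : ρ.s < n := hL.lt_n (by omega)
      refine Bd.bind (((hadv.sizeReduction_bd hκ hκ2 hc hL (N := N) (by omega)
        (one_le_targetSize hL.n_pos hL.two_le (l + 1 + 1)) (targetSize_le hL.two_le (by omega))
        (by omega) hflag hρn.le).add_const
        (ρ.failures - slope n d t c B (κ false) (l + 1) * (ρ.s : ℝ))).mono
        (fun _ h => h) (fun _ _ => le_rfl) ?_) ?_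
      · simp only [slope]
        cases flag
        · simp only [Bool.false_eq_true, if_false]
          linarith
        · simp only [if_true]
          have h1 : (τ.s : ℝ) ≤ ρ.s := by exact_mod_cast hadv.lt.le
          have h2 : 0 ≤ 2 * reductionFactor d c * κ false * ((ρ.s : ℝ) - τ.s) :=
            mul_nonneg (mul_nonneg (mul_nonneg two_pos.le (reductionFactor_nonneg hc0)) (hκ false))
              (by linarith)
          linarith
      · rintro V' ⟨hV', -⟩
        exact Bd.done hV' (by simp only; linarith)

theorem potentialCost_nonneg (hc : 0 ≤ c) (hB : 0 < B) : 0 ≤ potentialCost n d t c B := by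
  have := (failureFactor_pos (d := d) hc).le
  unfold potentialCost
  positivity

theorem slope_nonneg (hc : 0 ≤ c) (hB : 0 < B) {a : ℝ} (ha : 0 ≤ a) (l : ℕ) :
    0 ≤ slope n d t c B a l := by
  have h1 := potentialCost_nonneg (n := n) (d := d) (t := t) hc hB
  have h2 := reductionFactor_nonneg (d := d) hc
  induction l with
  | zero => unfold slope; positivity
  | succ l ih => unfold slope; positivity

/-- At each iteration all candidate sets are singletons, so the size requirement of `advance_bd`
holds trivially. The last call may overshoot `q` by at most `reach n t`, which the room required in
`Large` permits. -/
theorem phaseOneLoop_bd (hκ : ∀ tag, 0 ≤ κ tag) (hκ2 : κ true ≤ 2)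
    (hc : ∀ k : ℕ, 1 ≤ k → (1 - 1 / (k : ℝ)) ^ (c * (k : ℝ)) ≤ 1 / 2)
    (hL : Large n d (numLevels d n) q B) {N : ℕ} (hN : n * n + n + ⌈c * n⌉₊ + 2 < N) (fuel : ℕ) :
    ∀ (J : Finset (Fin n)) (σ : State n), 1 ≤ fuel → (J.card < q → q + 1 ≤ fuel + J.card) →
      Ready z π σ → (∀ j : Fin n, j ∈ J ↔ (j : ℕ) < σ.s) →
      (∀ j : Fin n, (j : ℕ) < σ.s → (σ.V j).card = 1) →
      Bd κ z π (phaseOneLoop N d c q fuel J σ)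
        (fun σ' => Inv z π σ' ∧ q ≤ σ'.s ∧ σ'.s ≤ n ∧
          ∀ j : Fin n, (j : ℕ) < σ'.s → (σ'.V j).card = 1)
        (fun σ' => σ'.failures - slope n d (numLevels d n) c B (κ false) (numLevels d n) *
          (σ'.s : ℝ))
        (σ.failures + levelPotential π d (numLevels d n) c 0 σ -
          slope n d (numLevels d n) c B (κ false) (numLevels d n) * (σ.s : ℝ)) := by
  have hc0 := nonneg_of_pow_le_half hc
  induction fuel with
  | zero => intro J σ h; omega
  | succ fuel ih =>
    intro J σ _ hfuel h hJ hone
    have hcardJ : J.card = σ.s := by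
      simpa using card_of_mem_iff (a := 0) h.lt.le fun j => by simpa using hJ j
    unfold phaseOneLoop
    by_cases hq : J.card < q
    · rw [if_pos hq]
      generalize numLevels d n = t at *
      obtain ⟨l, rfl⟩ : ∃ l, t = l + 1 := ⟨t - 1, by have := hL.one_le; omega⟩
      refine Bd.bind (((advance_bd hκ hκ2 hc hL hN l le_rfl σ h
        (fun j hj => Or.inl (hone j hj)) (by omega)).add_const
        (-(2 * reductionFactor d c * κ false * (σ.s : ℝ)))).mono (fun _ h => h)
        (fun _ _ => le_rfl) ?_) ?_
      · simp only [slope]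
        linarith
      · rintro ⟨J', flag, ρ⟩ ⟨hadv, hflag⟩
        simp only at hadv hflag ⊢
        have hρlt := hadv.lt
        have hρle := hadv.le
        have hρn : ρ.s < n := hL.lt_n (by omega)
        have hsub : ∀ j : Fin n, j ∈ J ∪ J' ↔ (j : ℕ) < ρ.s := fun j => by
          rw [Finset.mem_union, hJ, hadv.mem_iff]; omega
        have hcard' : (J ∪ J').card = ρ.s := by
          simpa using card_of_mem_iff (a := 0) hρn.le fun j => by simpa using hsub j
        have hfuel' := hfuel hq
        have hαr : (2 : ℝ) ≤ capacity n (l + 1) := by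
          exact_mod_cast two_le_capacity hL.two_le (l + 1)
        -- The summand `2` after a failure is what the size reduction left of the credit; it pays
        -- for the renewal of `y`.
        refine Bd.bind (((hadv.sizeReduction_bd hκ hκ2 hc hL (N := N) le_rfl le_rfl
          hL.targetSize_le (by omega) hflag hρn.le).add_const
          (ρ.failures - slope n d (l + 1) c B (κ false) (l + 1) * (ρ.s : ℝ) +
            if flag then 2 else 0)).mono (fun _ h => h) (fun _ _ => le_rfl) ?_) ?_
        · simp only [slope]
          cases flag
          · simp only [Bool.false_eq_true, if_false]
            linarith
          · simp only [if_true]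
            have h1 : (σ.s : ℝ) ≤ ρ.s := by exact_mod_cast hadv.lt.le
            have h2 : 0 ≤ 2 * reductionFactor d c * κ false * ((ρ.s : ℝ) - σ.s) :=
              mul_nonneg (mul_nonneg (mul_nonneg two_pos.le (reductionFactor_nonneg hc0))
                (hκ false)) (by linarith)
            linarith
        · rintro V' ⟨hV', hready⟩
          have hone' : ∀ j : Fin n, (j : ℕ) < ρ.s → (V' j).card = 1 := fun j hj => by
            by_cases hjs : (j : ℕ) < σ.s
            · have := hV'.keep j hjs
              simp only at this
              rw [this]
              exact hone j hjs
            · exact le_antisymm (hV'.size j ((hV'.mem_iff j).2 ⟨by omega, hj⟩))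
                (Finset.card_pos.2 ⟨_, hV'.inv.cand.mem j hj⟩)
          cases flag
          · simp only [Bool.false_eq_true, if_false]
            refine (ih (J ∪ J') _ (by omega) (by omega) (hready rfl) hsub hone').mono
              (fun _ h => h) (fun _ _ => le_rfl) ?_
            rw [(hready rfl).levelPotential_eq 0 (l + 1)]
            simp only
            linarith
          · simp only [if_true]
            refine Bd.ask ?_
            set σ₁ : State n := { ρ with V := V' } with hσ₁
            -- A singleton `{π j}` cannot contain `π s`, so on the last level the renewed `y` always
            -- restores `Ready`.
            have hfresh : ∀ j : Fin n, (j : ℕ) < σ₁.s → π ⟨σ₁.s, hρn⟩ ∉ σ₁.V j :=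
              fun j hj hmem => by
                have h1 := hV'.inv.cand.mem j hj
                have h2 := Finset.card_le_one.1 (hone' j hj).le _ hmem _ h1
                have h3 := congrArg Fin.val (π.injective h2)
                simp only at h3
                omega
            have hr := (hV'.inv.orient_ready hρn hfresh rfl hV'.inv.agree_flip (by
              rw [flipBits_of_mem]
              simp only [Finset.mem_sdiff, Finset.mem_univ, true_and, mem_covered, not_exists,
                not_and]
              exact hfresh)).2
            refine (ih (J ∪ J') _ (by omega) (by omega) hr ?_ ?_).mono
              (fun _ h => h) (fun _ _ => le_rfl) ?_
            · simpa only [orient_s] using hsub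
            · simpa only [orient_s, orient_V] using hone'
            · rw [hr.levelPotential_eq 0 (l + 1)]
              simp only [levelPotential, orient_s, orient_V, orient_failures, hσ₁]
              linarith
    · rw [if_neg hq]
      refine Bd.done ⟨h.toInv, by omega, h.lt.le, hone⟩ ?_
      have := levelPotential_nonneg (π := π) (d := d) (t := numLevels d n) hc0 (Nat.zero_le _) σ
      linarith

theorem phaseOne_bd (hκ : ∀ tag, 0 ≤ κ tag) (hκ2 : κ true ≤ 2)
    (hc : ∀ k : ℕ, 1 ≤ k → (1 - 1 / (k : ℝ)) ^ (c * (k : ℝ)) ≤ 1 / 2)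
    (hL : Large n d (numLevels d n) q B) (hq : q ≤ n) {N : ℕ}
    (hN : n * n + n + ⌈c * n⌉₊ + 2 < N) :
    Bd κ z π (phaseOne n N d c q)
      (fun σ' => Inv z π σ' ∧ q ≤ σ'.s ∧ σ'.s ≤ n ∧
        ∀ j : Fin n, (j : ℕ) < σ'.s → (σ'.V j).card = 1)
      (fun σ' => σ'.failures)
      (2 * κ false + slope n d (numLevels d n) c B (κ false) (numLevels d n) * n) := by
  have hc0 := nonneg_of_pow_le_half hc
  have hS := slope_nonneg (n := n) (d := d) (t := numLevels d n) hc0 hL.pos (hκ false)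
    (numLevels d n)
  set S := slope n d (numLevels d n) c B (κ false) (numLevels d n)
  unfold phaseOne
  refine Bd.ask (Bd.ask ?_)
  set σ₀ : State n :=
    { V := fun _ => Finset.univ, s := 0, x := fun _ => false,
      fx := (score z π fun _ : Fin n => false).val,
      y := fun _ => true, fy := 0, failures := 0 } with hσ₀
  have hinv : Inv z π σ₀ := ⟨⟨fun j hj => absurd hj (Nat.not_lt_zero _),
    fun i j hi => absurd hi (Nat.not_lt_zero _)⟩, fun j hj => absurd hj (Nat.not_lt_zero _), rfl⟩
  have hr := (hinv.orient_ready hL.n_pos (fun j hj => absurd hj (Nat.not_lt_zero _))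
    (y := fun _ => true) rfl (fun j hj => absurd hj (Nat.not_lt_zero _)) rfl).2
  refine ((phaseOneLoop_bd hκ hκ2 hc hL hN N ∅ _ (by omega)
    (fun _ => by omega) hr (fun j => ?_) (fun j hj => ?_)).add_const (S * n)).mono
    (fun _ h => h) (fun σ' h => ?_) ?_
  · simp [hσ₀]
  · simp [hσ₀] at hj
  · have : (σ'.s : ℝ) ≤ n := by exact_mod_cast h.2.2.1
    have := mul_le_mul_of_nonneg_left this hS
    linarith
  · have h0 : levelPotential π d (numLevels d n) c 0
        (({ σ₀ with y := fun _ => true, fy := (score z π fun _ : Fin n => true).val } :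
          State n).orient) = 0 := by
      unfold levelPotential potential
      refine Finset.sum_eq_zero fun j _ => Finset.sum_eq_zero fun p _ => ?_
      rw [coeff, if_neg (by simp [hσ₀]), zero_mul]
    rw [h0]
    simp only [orient_failures, orient_s, hσ₀]
    simp
    linarith

end phases

/-! ### The second phase and the complete strategy -/

section phaseTwo

variable {n d q : ℕ} {c B : ℝ} {κ : Bool → ℝ} {z : BitString n} {π : Equiv.Perm (Fin n)}

/-- When all earlier sets are singletons, `U` consists exactly of the images of the positions from
`s` on. Flipping `U` in case of a score above `s` makes position `s` the first wrong one, as the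
binary search demands. Each position costs one query and one search. -/
theorem phaseTwo_bd (hκ : 0 ≤ κ false) {N : ℕ} (hN : n < N) (fuel : ℕ) :
    ∀ σ : State n, n - σ.s < fuel → σ.s ≤ n →
      (∀ j : Fin n, (j : ℕ) < σ.s → σ.V j = {π j}) →
      (∀ j : Fin n, (j : ℕ) < σ.s → z (π j) = σ.x (π j)) →
      Bd κ z π (phaseTwo N fuel σ) (Knows z π n) (fun _ => 0)
        (((n : ℝ) - σ.s) * (κ false * (1 + Nat.clog 2 n))) := by
  induction fuel with
  | zero => intro σ h; omega
  | succ fuel ih =>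
    intro σ hfuel hsn hV hx
    unfold phaseTwo
    by_cases hs : σ.s < n
    · rw [dif_pos hs]
      set i : Fin n := ⟨σ.s, hs⟩ with hi
      set U := Finset.univ \ σ.covered with hU
      have hmemU : ∀ j : Fin n, π j ∈ U ↔ σ.s ≤ (j : ℕ) := fun j => by
        simp only [hU, Finset.mem_sdiff, Finset.mem_univ, true_and, mem_covered, not_exists,
          not_and]
        constructor
        · intro h
          by_contra hlt
          exact h j (not_le.1 hlt) (by rw [hV j (not_le.1 hlt)]; simp)
        · intro h j' hj' hmem
          rw [hV j' hj', Finset.mem_singleton, π.injective.eq_iff] at hmem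
          omega
      refine Bd.ask ?_
      set r : ℕ := (score z π σ.x).val with hr
      set x' := if σ.s < r then flipBits σ.x U else σ.x with hx'
      have hlt : σ.s < r ↔ z (π i) = σ.x (π i) := by
        have := lt_score_iff (z := z) (π := π) (x := σ.x) i
        rw [hr]
        refine this.trans ⟨fun h => h i le_rfl, fun h j hj => ?_⟩
        rcases hj.lt_or_eq with hj | rfl
        · exact hx j hj
        · exact h
      have hlow : ∀ j : Fin n, j < i → z (π j) = x' (π j) := fun j hj => by
        rw [hx']
        split_ifs
        · rw [flipBits_of_notMem, hx j hj]
          rw [hmemU]; exact not_le.2 hj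
        · exact hx j hj
      have hne : z (π i) ≠ x' (π i) := by
        rw [hx']
        split_ifs with h
        · rw [flipBits_of_mem ((hmemU i).2 le_rfl), ← hlt.1 h]
          cases z (π i) <;> simp
        · exact fun h' => h (hlt.2 h')
      have hUn : U.card ≤ n := by simpa using Finset.card_le_univ U
      have hsearch := randBinSearch_bd (κ := κ) (w := fun _ => 0) hκ hlow hne le_rfl
        (fun _ => le_rfl) N U (Nat.clog 2 n) (by omega)
        (by rw [mul_one]; exact hUn.trans (Nat.le_pow_clog one_lt_two _)) ((hmemU i).2 le_rfl)
        fun j hj => by rw [hmemU]; exact not_le.2 hj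
      refine Bd.bind ((hsearch.add_const
        (((n : ℝ) - (σ.s + 1 : ℕ)) * (κ false * (1 + Nat.clog 2 n)))).mono (fun _ h => h)
        (fun _ _ => le_rfl) ?_) ?_
      · simp only [zero_mul, Finset.sum_const_zero]
        push_cast
        linarith
      · rintro W ⟨-, hiW, hW1⟩
        have hW : W = {π i} := Finset.eq_singleton_iff_unique_mem.2
          ⟨hiW, fun a ha => Finset.card_le_one.1 hW1 a ha _ hiW⟩
        refine (ih _ (by simp only; omega) (by simp only; omega) (fun j hj => ?_) fun j hj => ?_).mono (fun _ h => h)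
          (fun _ _ => le_rfl) ?_
        · by_cases hji : j = i
          · subst hji
            simp [hW]
          · have hji' : (j : ℕ) ≠ σ.s := fun h => hji (Fin.ext h)
            simp only at hj
            simp only [Function.update_of_ne hji]
            exact hV j (by omega)
        · by_cases hji : j = i
          · subst hji
            simp only
            rw [flipBits_of_mem hiW]
            revert hne
            generalize z (π i) = u
            generalize x' (π i) = v
            cases u <;> cases v <;> simp
          · have hji' : (j : ℕ) ≠ σ.s := fun h => hji (Fin.ext h)
            simp only at hj ⊢
            rw [flipBits_of_notMem]
            · exact hlow j (show (j : ℕ) < σ.s by omega)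
            · rw [hW, Finset.mem_singleton, π.injective.eq_iff]
              exact hji
        · simp
    · rw [dif_neg hs]
      have hs' : σ.s = n := by omega
      refine Bd.done (fun j hj => ⟨hV j (by omega), (hx j (by omega)).symm⟩) ?_
      rw [hs']
      simp

/-- After the first phase the candidate sets are singletons. -/
theorem eq_singleton_of_inv {σ : State n} (h : Inv z π σ)
    (hone : ∀ j : Fin n, (j : ℕ) < σ.s → (σ.V j).card = 1) (j : Fin n) (hj : (j : ℕ) < σ.s) :
    σ.V j = {π j} :=
  Finset.eq_singleton_iff_unique_mem.2 ⟨h.cand.mem j hj, fun a ha =>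
    Finset.card_le_one.1 (hone j hj).le a ha _ (h.cand.mem j hj)⟩

/-- The fuel with which no loop of the strategy runs out of iterations. -/
noncomputable def enoughFuel (n : ℕ) (c : ℝ) : ℕ := n * n + n + ⌈c * n⌉₊ + 3

/-- Only certainty is wanted here, so the bound is used with all queries free. -/
theorem phaseOne_sure
    (hc : ∀ k : ℕ, 1 ≤ k → (1 - 1 / (k : ℝ)) ^ (c * (k : ℝ)) ≤ 1 / 2)
    (hL : Large n d (numLevels d n) q B) (hq : q ≤ n) :
    Sure z π (phaseOne n (enoughFuel n c) d c q) (Knows z π q) :=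
  (phaseOne_bd (κ := fun _ => 0) (fun _ => le_rfl) zero_le_two hc hL hq
    (Nat.lt_succ_self _)).sure.mono fun _ h j hj =>
      ⟨eq_singleton_of_inv h.1 h.2.2.2 j (hj.trans_le h.2.1), (h.1.agree j (hj.trans_le h.2.1)).symm⟩

/-- The expected cost of the first phase is kept as an exact value, so that the excess over it can
be read off. -/
theorem multiLevel_bd (hκ : ∀ tag, 0 ≤ κ tag) (hκ2 : κ true ≤ 2)
    (hc : ∀ k : ℕ, 1 ≤ k → (1 - 1 / (k : ℝ)) ^ (c * (k : ℝ)) ≤ 1 / 2)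
    (hL : Large n d (numLevels d n) q B) (hq : q ≤ n) :
    Bd κ z π (multiLevel n (enoughFuel n c) d c q) (Knows z π n) (fun _ => 0)
      (wp κ z π (phaseOne n (enoughFuel n c) d c q) (fun _ => 0) +
        ((n : ℝ) - q) * (κ false * (1 + Nat.clog 2 n))) := by
  have h1 := phaseOne_bd (z := z) (π := π) hκ hκ2 hc hL hq (N := enoughFuel n c)
    (Nat.lt_succ_self _)
  have h2 : Bd κ z π (phaseOne n (enoughFuel n c) d c q) _ (fun _ => 0) _ := ⟨h1.sure, le_rfl⟩
  refine Bd.bind ((h2.add_const (((n : ℝ) - q) * (κ false * (1 + Nat.clog 2 n)))).mono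
    (fun _ h => h) (fun _ _ => le_rfl) le_rfl) ?_
  rintro σ ⟨hinv, hqs, hsn, hone⟩
  have hfuel : n < enoughFuel n c := by unfold enoughFuel; omega
  refine (phaseTwo_bd (hκ false) hfuel _ σ (by omega) hsn (eq_singleton_of_inv hinv hone)
    hinv.agree).mono (fun _ h => h) (fun _ _ => le_rfl) ?_
  rw [zero_add]
  refine mul_le_mul_of_nonneg_right ?_ (mul_nonneg (hκ false) (by positivity))
  have : (q : ℝ) ≤ σ.s := by exact_mod_cast hqs
  linarith

end phaseTwo

/-! ### Bounds for the expected numbers of queries for fixed n -/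

section fixed

variable {n d q : ℕ} {c B : ℝ} {z : BitString n} {π : Equiv.Perm (Fin n)}

theorem phaseOne_expectedQueries_le
    (hc : ∀ k : ℕ, 1 ≤ k → (1 - 1 / (k : ℝ)) ^ (c * (k : ℝ)) ≤ 1 / 2)
    (hL : Large n d (numLevels d n) q B) (hq : q ≤ n) :
    (phaseOne n (enoughFuel n c) d c q).expectedQueries z π ≤
      ENNReal.ofReal (2 + slope n d (numLevels d n) c B 1 (numLevels d n) * n) := by
  have h := phaseOne_bd (z := z) (π := π) (κ := fun _ => 1) (fun _ => zero_le_one) one_le_two hc hL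
    hq (N := enoughFuel n c) (Nat.lt_succ_self _)
  rw [h.sure.expectedQueries_eq]
  refine ENNReal.ofReal_le_ofReal ?_
  refine (h.sure.wp_le fun σ _ => Nat.cast_nonneg σ.failures).trans (h.le.trans ?_)
  linarith

/-- Untagged queries are free here, and the detecting query of each failure enters through the
counter `failures` in the terminal cost. With price `0` the slope reduces to the potential brought
in per position. -/
theorem expectedFailureQueries_le
    (hc : ∀ k : ℕ, 1 ≤ k → (1 - 1 / (k : ℝ)) ^ (c * (k : ℝ)) ≤ 1 / 2)
    (hL : Large n d (numLevels d n) q B) (hq : q ≤ n) :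
    expectedFailureQueries n (enoughFuel n c) d c q z π ≤
      ENNReal.ofReal (slope n d (numLevels d n) c B 0 (numLevels d n) * n) := by
  set κ : Bool → ℝ := fun tag => 0 + if tag then 1 else 0 with hκ
  have h := phaseOne_bd (z := z) (π := π) (κ := κ)
    (fun tag => by cases tag <;> simp [hκ]) (by simp [hκ]) hc hL
    hq (N := enoughFuel n c) (Nat.lt_succ_self _)
  have he := h.sure.expectation_run le_rfl zero_le_one (g := fun σ : State n => (σ.failures : ℝ))
    (fun _ => Nat.cast_nonneg _)
  have h0 : κ false = 0 := by simp [hκ]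
  rw [h0] at h
  have hle := h.le
  rw [mul_zero, zero_add] at hle
  refine le_trans (le_of_eq ?_) (he.trans_le (ENNReal.ofReal_le_ofReal hle))
  unfold expectedFailureQueries
  congr 1
  funext ω
  rcases ω with ⟨_ | σ, _, _⟩ <;> simp

theorem multiLevel_expectedQueries_le
    (hc : ∀ k : ℕ, 1 ≤ k → (1 - 1 / (k : ℝ)) ^ (c * (k : ℝ)) ≤ 1 / 2)
    (hL : Large n d (numLevels d n) q B) (hq : q ≤ n) :
    (multiLevel n (enoughFuel n c) d c q).expectedQueries z π ≤
      (phaseOne n (enoughFuel n c) d c q).expectedQueries z π +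
        ENNReal.ofReal (((n : ℝ) - q) * (1 + Nat.clog 2 n)) := by
  have h := multiLevel_bd (z := z) (π := π) (κ := fun _ => 1) (fun _ => zero_le_one) one_le_two hc
    hL hq
  have h1 := phaseOne_sure (z := z) (π := π) hc hL hq
  have hq' : (q : ℝ) ≤ n := by exact_mod_cast hq
  rw [h.sure.expectedQueries_eq, h1.expectedQueries_eq, ← ENNReal.ofReal_add
    (h1.wp_nonneg (fun _ => zero_le_one) fun _ _ => le_rfl)
    (mul_nonneg (by linarith) (by positivity))]
  refine ENNReal.ofReal_le_ofReal (h.le.trans_eq ?_)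
  rw [one_mul]

end fixed

/-! ### From programs to distributions over deterministic strategies -/

/-- The product of finitely many distributions. -/
noncomputable def piPMF {β : Type} : (k : ℕ) → (Fin k → PMF β) → PMF (Fin k → β)
  | 0, _ => PMF.pure Fin.elim0
  | k + 1, f => (f 0).bind fun b => (piPMF k fun i => f i.succ).map fun v =>
      (Fin.cons b v : Fin (k + 1) → β)

theorem piPMF_map_apply {β : Type} (k : ℕ) (f : Fin k → PMF β) (i : Fin k) :
    (piPMF k f).map (fun v => v i) = f i := by
  induction k with
  | zero => exact i.elim0
  | succ k ih =>
    unfold piPMF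
    rw [PMF.map_bind]
    simp only [PMF.map_comp, Function.comp_def]
    refine Fin.cases ?_ (fun i => ?_) i
    · simp only [Fin.cons_zero]
      have : ∀ b : β, (piPMF k fun i => f i.succ).map (fun _ => b) = PMF.pure b := fun b =>
        PMF.map_const _ b
      simp only [this, PMF.bind_pure]
    · simp only [Fin.cons_succ]
      rw [ih (fun i => f i.succ) i, PMF.bind_const]

/-- A deterministic program. -/
inductive Tree (n : ℕ) (α : Type) : Type
  | done (a : α) : Tree n α
  | abort : Tree n α
  | query (x : BitString n) (next : Fin (n + 1) → Tree n α) : Tree n α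

/-- The strategy that a deterministic program follows (after its end, it continues arbitrarily). -/
def Tree.strategy {n : ℕ} {α : Type} : Tree n α → DetStrategy n
  | .done _ => fun _ _ => false
  | .abort => fun _ _ => false
  | .query x next => fun l => match l with
    | [] => x
    | r :: l => Tree.strategy (next r) l

/-- The result of a deterministic program and its number of queries. -/
def Tree.out {n : ℕ} {α : Type} (z : BitString n) (π : Equiv.Perm (Fin n)) :
    Tree n α → Option α × ℕ
  | .done a => (some a, 0)
  | .abort => (none, 0)
  | .query x next =>
      ((Tree.out z π (next (score z π x))).1, (Tree.out z π (next (score z π x))).2 + 1)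

/-- The distribution over deterministic programs that results when all random choices are made in
advance. -/
noncomputable def Prog.derandomize {n : ℕ} {α : Type} : Prog n α → PMF (Tree n α)
  | .done a => PMF.pure (.done a)
  | .abort => PMF.pure .abort
  | .query _ x next => (piPMF (n + 1) fun r => Prog.derandomize (next r)).map (Tree.query x)
  | .sample S next => (uniformOn S).bind fun F => Prog.derandomize (next F)

section derandomize

variable {n : ℕ} {α : Type} {z : BitString n} {π : Equiv.Perm (Fin n)}

/-- The subtrees for the `n + 1` possible answers are drawn independently, but a given secret
selects only one, whose marginal is the distribution of the continuation. -/
theorem derandomize_map_out (P : Prog n α) :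
    P.derandomize.map (Tree.out z π) = (P.run z π).map fun ω => (ω.1, ω.2.1) := by
  induction P with
  | done a => simp [Prog.derandomize, Prog.run, Tree.out, PMF.pure_map]
  | abort => simp [Prog.derandomize, Prog.run, Tree.out, PMF.pure_map]
  | query tag x next ih =>
    have h := congrArg (PMF.map (Tree.out z π))
      (piPMF_map_apply (n + 1) (fun r => (next r).derandomize) (score z π x))
    rw [ih] at h
    have h' := congrArg (PMF.map fun w : Option α × ℕ => (w.1, w.2 + 1)) h
    simp only [PMF.map_comp, Function.comp_def] at h'
    simp only [Prog.derandomize, Prog.run, PMF.map_comp, Function.comp_def, Tree.out]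
    exact h'
  | sample S next ih =>
    simp only [Prog.derandomize, Prog.run, PMF.map_bind, ih]

theorem Tree.strategy_nil (x : BitString n) (next : Fin (n + 1) → Tree n α) :
    (Tree.query x next).strategy [] = x := by simp [Tree.strategy]

theorem Tree.strategy_cons (x : BitString n) (next : Fin (n + 1) → Tree n α) (r : Fin (n + 1))
    (l : List (Fin (n + 1))) : (Tree.query x next).strategy (r :: l) = (next r).strategy l := by
  simp [Tree.strategy]

theorem scores_succ (T : DetStrategy n) (t : ℕ) :
    T.scores z π (t + 1) =
      score z π (T []) :: DetStrategy.scores (fun l => T (score z π (T []) :: l)) z π t := by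
  induction t with
  | zero => rfl
  | succ t ih =>
    rw [DetStrategy.scores, ih]
    rfl

/-- A secret that produces the same answers is led along the same path of the tree. -/
theorem Tree.out_eq_of_consistent (D : Tree n α) {z' : BitString n} {π' : Equiv.Perm (Fin n)}
    (h : ∀ i < (D.out z π).2, score z' π' (D.strategy (D.strategy.scores z π i)) =
      score z π (D.strategy (D.strategy.scores z π i))) :
    D.out z' π' = D.out z π := by
  induction D with
  | done a => rfl
  | abort => rfl
  | query x next ih =>
    have h0 : score z' π' x = score z π x := by
      have := h 0 (Nat.succ_pos _)
      rwa [show (Tree.query x next).strategy.scores z π 0 = [] from rfl,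
        Tree.strategy_nil] at this
    simp only [Tree.out]
    rw [h0, ih (score z π x)]
    intro i hi
    have h1 := h (i + 1) (Nat.succ_lt_succ hi)
    simp only [scores_succ, Tree.strategy_nil, Tree.strategy_cons] at h1
    exact h1

theorem Knows.eq {σ : State n} {z' : BitString n} {π' : Equiv.Perm (Fin n)}
    (h : Knows z π n σ) (h' : Knows z' π' n σ) : z' = z ∧ π' = π := by
  have hπ : π' = π := by
    ext j
    have h1 := (h j j.2).1
    rw [(h' j j.2).1, Finset.singleton_inj] at h1
    rw [h1]
  refine ⟨funext fun i => ?_, hπ⟩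
  have h1 := (h (π.symm i) (π.symm i).2).2
  have h2 := (h' (π.symm i) (π.symm i).2).2
  rw [hπ] at h2
  rw [Equiv.apply_symm_apply] at h1 h2
  rw [← h1, ← h2]

/-- Consistent secrets end in one common final state; this state shows each of them completely, so
they coincide. -/
theorem queriesNeeded_le (D : Tree n (State n))
    (h : ∀ (z : BitString n) (π : Equiv.Perm (Fin n)),
      ∃ σ, (D.out z π).1 = some σ ∧ Knows z π n σ) :
    D.strategy.queriesNeeded z π ≤ ((D.out z π).2 : ℝ≥0∞) := by
  refine iInf₂_le_of_le (D.out z π).2 (fun z' π' hcons => ?_) le_rfl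
  have he := D.out_eq_of_consistent hcons
  obtain ⟨σ, h1, h2⟩ := h z π
  obtain ⟨σ', h1', h2'⟩ := h z' π'
  rw [he, h1] at h1'
  obtain rfl := Option.some.inj h1'
  exact h2.eq h2'

/-- A program that always identifies the secret yields a randomized strategy. -/
theorem randomizedQueryComplexity_le (P : Prog n (State n)) {C : ℝ≥0∞}
    (h : ∀ (z : BitString n) (π : Equiv.Perm (Fin n)), P.AlwaysReturns z π (Knows z π n))
    (hC : ∀ (z : BitString n) (π : Equiv.Perm (Fin n)), P.expectedQueries z π ≤ C) :
    randomizedQueryComplexity n ≤ C := by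
  set p : PMF (DetStrategy n) := P.derandomize.map Tree.strategy
  -- A sum of point masses, so the integral becomes a series and `queriesNeeded` need not be shown
  -- to be measurable.
  set μ : Measure (DetStrategy n) := Measure.sum fun T => p T • Measure.dirac T with hμ
  have hprob : IsProbabilityMeasure μ := ⟨by
    rw [hμ, Measure.sum_apply _ MeasurableSet.univ]
    simp [p.tsum_coe]⟩
  refine iInf₂_le_of_le μ hprob (iSup₂_le fun z π => ?_)
  have h1 : ∫⁻ T, T.queriesNeeded z π ∂μ = expectation p fun T => T.queriesNeeded z π := by
    rw [hμ, lintegral_sum_measure]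
    unfold expectation
    refine tsum_congr fun T => ?_
    rw [lintegral_smul_measure, lintegral_dirac, smul_eq_mul]
  rw [h1, expectation_map]
  -- A tree that may be drawn has to be right for all secrets at once, because the competing secrets
  -- must be excluded too.
  have hsupp : ∀ D ∈ P.derandomize.support, ∀ (z : BitString n) (π : Equiv.Perm (Fin n)),
      ∃ σ, (D.out z π).1 = some σ ∧ Knows z π n σ := by
    intro D hD z π
    have h2 : D.out z π ∈ (P.derandomize.map (Tree.out z π)).support := by
      rw [PMF.support_map]; exact ⟨D, hD, rfl⟩
    rw [derandomize_map_out, PMF.support_map] at h2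
    obtain ⟨ω, hω, he⟩ := h2
    obtain ⟨σ, h3, h4⟩ := h z π ω hω
    exact ⟨σ, by rw [← he]; exact h3, h4⟩
  refine (expectation_mono _ fun D hD => queriesNeeded_le D (hsupp D hD)).trans ?_
  have h5 : expectation P.derandomize (fun D => ((D.out z π).2 : ℝ≥0∞)) =
      P.expectedQueries z π := by
    have h6 := expectation_map P.derandomize (Tree.out z π) fun w => (w.2 : ℝ≥0∞)
    rw [← h6, derandomize_map_out, expectation_map]
    rfl
  rw [h5]
  exact hC z π

end derandomize

/-! ### Asymptotics -/

theorem log_le_clog {n : ℕ} (hn : 1 ≤ n) : Real.log n ≤ Nat.clog 2 n := by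
  have h1 : (n : ℝ) ≤ 2 ^ Nat.clog 2 n := by exact_mod_cast Nat.le_pow_clog one_lt_two n
  have h2 := Real.log_le_log (by exact_mod_cast hn) h1
  rw [Real.log_pow] at h2
  have h3 : Real.log 2 ≤ 1 := by linarith [Real.log_two_lt_d9]
  nlinarith [Nat.cast_nonneg (α := ℝ) (Nat.clog 2 n)]

theorem clog_le_log {n : ℕ} (hn : 2 ≤ n) : (Nat.clog 2 n : ℝ) ≤ 1 + 2 * Real.log n := by
  have h0 := Nat.clog_pos one_lt_two hn
  have h1 : (2 : ℝ) ^ (Nat.clog 2 n - 1) ≤ n := by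
    exact_mod_cast (Nat.pow_pred_clog_lt_self one_lt_two hn).le
  have h2 := Real.log_le_log (by positivity) h1
  rw [Real.log_pow, Nat.cast_sub h0, Nat.cast_one] at h2
  have h3 : 1 / 2 ≤ Real.log 2 := by linarith [Real.log_two_gt_d9]
  have h4 : (1 : ℝ) ≤ Nat.clog 2 n := by exact_mod_cast h0
  nlinarith

theorem capacity_one (n : ℕ) : capacity n 1 = Nat.clog 2 n := by simp [capacity]

theorem tendsto_log_natCast : Tendsto (fun n : ℕ => Real.log n) atTop atTop :=
  Real.tendsto_log_atTop.comp tendsto_natCast_atTop_atTop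

theorem tendsto_log_log_natCast : Tendsto (fun n : ℕ => Real.log (Real.log n)) atTop atTop :=
  Real.tendsto_log_atTop.comp tendsto_log_natCast

theorem eventually_mul_log_le_sqrt (C : ℝ) :
    ∀ᶠ x : ℝ in atTop, C * Real.log x ≤ Real.sqrt x := by
  have h := isLittleO_log_rpow_atTop (r := 1 / 2) (by norm_num)
  have h1 := h.def (c := 1 / (|C| + 1)) (by positivity)
  filter_upwards [h1, eventually_ge_atTop 1] with x hx hx1
  rw [← Real.sqrt_eq_rpow, Real.norm_of_nonneg (Real.log_nonneg hx1),
    Real.norm_of_nonneg (Real.sqrt_nonneg x)] at hx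
  have h0 := Real.log_nonneg hx1
  calc C * Real.log x ≤ (|C| + 1) * Real.log x := by
        have := le_abs_self C
        gcongr
        linarith
    _ ≤ (|C| + 1) * (1 / (|C| + 1) * Real.sqrt x) := by gcongr
    _ = Real.sqrt x := by field_simp

/-- For large `n`, the number of levels is determined by the two inequalities that say that it is
maximal. -/
theorem numLevels_spec {d n : ℕ} (hd : 1 ≤ d) (h2 : 2 ≤ capacity n 1)
    (hn : capacity n 1 ^ d ≤ n) :
    1 ≤ numLevels d n ∧ capacity n (numLevels d n) ^ d ≤ n ∧
      n < capacity n (numLevels d n + 1) ^ d := by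
  have hn1 : 1 ≤ n := (Nat.one_le_pow _ _ (by omega)).trans hn
  have h1 : 1 ≤ numLevels d n := Nat.le_findGreatest hn1 hn
  have hspec : capacity n (numLevels d n) ^ d ≤ n :=
    Nat.findGreatest_spec (P := fun i => capacity n i ^ d ≤ n) hn1 hn
  refine ⟨h1, hspec, ?_⟩
  -- `numLevels` searches only up to `n`; maximality among all levels needs that `t + 1` is still in
  -- this range.
  have hlt : numLevels d n + 1 ≤ n := by
    have h3 : numLevels d n < 2 ^ (2 ^ (numLevels d n - 1)) := by
      have h4 : numLevels d n - 1 < 2 ^ (numLevels d n - 1) := Nat.lt_two_pow_self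
      have h5 : 2 ^ (numLevels d n - 1) < 2 ^ (2 ^ (numLevels d n - 1)) := Nat.lt_two_pow_self
      omega
    have h6 : 2 ^ (2 ^ (numLevels d n - 1)) ≤ capacity n (numLevels d n) := by
      rw [capacity_one] at h2
      exact Nat.pow_le_pow_left h2 _
    have h7 : capacity n (numLevels d n) ≤ capacity n (numLevels d n) ^ d :=
      Nat.le_self_pow (by omega) _
    omega
  by_contra hcon
  have := Nat.le_findGreatest (P := fun i => capacity n i ^ d ≤ n) hlt (not_lt.1 hcon)
  exact absurd this (by unfold numLevels; omega)

theorem eventually_capacity (d : ℕ) :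
    ∀ᶠ n : ℕ in atTop, 2 ≤ capacity n 1 ∧ capacity n 1 ^ d ≤ n := by
  have h1 := tendsto_log_natCast.eventually (eventually_mul_log_le_sqrt (d * 3))
  filter_upwards [h1, tendsto_log_natCast.eventually_ge_atTop 3, eventually_ge_atTop 2,
    tendsto_log_log_natCast.eventually_ge_atTop 1] with n h1 h2 hn h3
  have h4 := log_le_clog (n := n) (by omega)
  have h5 := clog_le_log hn
  rw [capacity_one]
  have h6 : (3 : ℝ) ≤ Nat.clog 2 n := h2.trans h4
  have h6' : 3 ≤ Nat.clog 2 n := by exact_mod_cast h6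
  refine ⟨by omega, ?_⟩
  set L := Real.log n
  have hL : 0 < L := by linarith
  have h7 : Real.log (Nat.clog 2 n : ℝ) ≤ 3 * Real.log L := by
    calc Real.log (Nat.clog 2 n : ℝ) ≤ Real.log (3 * L) :=
          Real.log_le_log (by linarith) (by linarith)
      _ = Real.log 3 + Real.log L := Real.log_mul (by norm_num) hL.ne'
      _ ≤ 3 * Real.log L := by
          have : Real.log 3 ≤ 3 - 1 := Real.log_le_sub_one_of_pos (by norm_num)
          linarith
  have h8 : (d : ℝ) * Real.log (Nat.clog 2 n : ℝ) ≤ L := by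
    have h9 : Real.sqrt L ≤ L := by
      rw [Real.sqrt_le_left hL.le]; nlinarith
    calc (d : ℝ) * Real.log (Nat.clog 2 n : ℝ) ≤ d * (3 * Real.log L) := by gcongr
      _ = d * 3 * Real.log L := by ring
      _ ≤ Real.sqrt L := h1
      _ ≤ L := h9
  have h9 : ((Nat.clog 2 n : ℝ)) ^ d ≤ n := by
    rw [← Real.log_le_log_iff (by positivity) (by exact_mod_cast (by omega : 0 < n)), Real.log_pow]
    exact h8
  exact_mod_cast h9

/-- The capacities grow doubly exponentially: `2 ^ 2 ^ (t - 1) ≤ α_t ≤ n`. -/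
theorem numLevels_le {d n : ℕ} (h2 : 2 ≤ capacity n 1) (hd : 1 ≤ d)
    (hn : capacity n 1 ^ d ≤ n) (hL : 1 ≤ Real.log (Real.log n)) (hL' : 1 ≤ Real.log n) :
    (numLevels d n : ℝ) ≤ 4 * Real.log (Real.log n) := by
  obtain ⟨h1, h3, -⟩ := numLevels_spec hd h2 hn
  set t := numLevels d n
  have h4 : 2 ^ (2 ^ (t - 1)) ≤ n := by
    refine le_trans ?_ ((Nat.le_self_pow (by omega : d ≠ 0) _).trans h3)
    rw [capacity_one] at h2
    exact Nat.pow_le_pow_left h2 _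
  have h5 : ((2 : ℝ) ^ (2 ^ (t - 1))) ≤ n := by exact_mod_cast h4
  have h6 := Real.log_le_log (by positivity) h5
  rw [Real.log_pow] at h6
  push_cast at h6
  have hl2 := Real.log_two_gt_d9
  have h7 : (2 : ℝ) ^ (t - 1) ≤ 2 * Real.log n := by
    have : (0 : ℝ) ≤ (2 : ℝ) ^ (t - 1) := by positivity
    nlinarith
  have h8 := Real.log_le_log (by positivity) h7
  rw [Real.log_pow, Real.log_mul two_ne_zero (by linarith), Nat.cast_sub h1, Nat.cast_one] at h8
  have h9 : (1 : ℝ) ≤ t := by exact_mod_cast h1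
  nlinarith [Real.log_two_lt_d9]

/-- By maximality `log n ≤ d * 2 ^ t * log ⌈log₂ n⌉ ≤ 2 ^ t * √(log n)`, hence `2 ^ t ≥ √(log n)`.
-/
theorem le_numLevels {d n : ℕ} (h2 : 2 ≤ capacity n 1) (hd : 1 ≤ d)
    (hn : capacity n 1 ^ d ≤ n) (hn2 : 2 ≤ n) (hL : 1 ≤ Real.log (Real.log n))
    (hL' : 1 ≤ Real.log n)
    (hs : (d * 3 : ℝ) * Real.log (Real.log n) ≤ Real.sqrt (Real.log n)) :
    Real.log (Real.log n) ≤ 2 * numLevels d n := by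
  obtain ⟨-, -, h3⟩ := numLevels_spec hd h2 hn
  set t := numLevels d n
  set L := Real.log n with hLdef
  have h5 := clog_le_log hn2
  rw [capacity_one] at h2
  have hA : (2 : ℝ) ≤ Nat.clog 2 n := by exact_mod_cast h2
  have h4 : (n : ℝ) ≤ (((Nat.clog 2 n : ℝ)) ^ (2 ^ t)) ^ d := by
    have : n ≤ ((Nat.clog 2 n) ^ (2 ^ t)) ^ d := by
      have := h3.le
      unfold capacity at this
      rwa [Nat.add_sub_cancel] at this
    exact_mod_cast this
  have h6 := Real.log_le_log (by exact_mod_cast (by omega : 0 < n)) h4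
  rw [Real.log_pow, Real.log_pow, ← hLdef] at h6
  push_cast at h6
  have h7 : Real.log (Nat.clog 2 n : ℝ) ≤ 3 * Real.log L := by
    calc Real.log (Nat.clog 2 n : ℝ) ≤ Real.log (3 * L) :=
          Real.log_le_log (by linarith) (by linarith)
      _ = Real.log 3 + Real.log L := Real.log_mul (by norm_num) (by linarith)
      _ ≤ 3 * Real.log L := by
          have : Real.log 3 ≤ 3 - 1 := Real.log_le_sub_one_of_pos (by norm_num)
          linarith
  have h8 : L ≤ (2 : ℝ) ^ t * Real.sqrt L := by
    calc L ≤ d * ((2 : ℝ) ^ t * Real.log (Nat.clog 2 n : ℝ)) := h6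
      _ ≤ d * ((2 : ℝ) ^ t * (3 * Real.log L)) := by gcongr
      _ = (2 : ℝ) ^ t * (d * 3 * Real.log L) := by ring
      _ ≤ _ := by gcongr
  have hLpos : 0 < L := by linarith
  have h9 : Real.sqrt L ≤ (2 : ℝ) ^ t := by
    have hsq : 0 < Real.sqrt L := Real.sqrt_pos.2 hLpos
    refine le_of_mul_le_mul_right ?_ hsq
    rwa [Real.mul_self_sqrt hLpos.le]
  have h10 := Real.log_le_log (Real.sqrt_pos.2 hLpos) h9
  rw [Real.log_pow, Real.log_sqrt hLpos.le] at h10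
  have h11 : (t : ℝ) * Real.log 2 ≤ t * 1 := by
    have := Real.log_two_lt_d9
    gcongr
    linarith
  linarith

theorem numLevels_isTheta {d : ℕ} (hd : 1 ≤ d) :
    (fun n : ℕ => (numLevels d n : ℝ)) =Θ[atTop] fun n : ℕ => Real.log (Real.log n) := by
  constructor
  · refine IsBigO.of_bound 4 ?_
    filter_upwards [eventually_capacity d, tendsto_log_log_natCast.eventually_ge_atTop 1,
      tendsto_log_natCast.eventually_ge_atTop 1] with n h1 h2 h3
    rw [Real.norm_of_nonneg (Nat.cast_nonneg _), Real.norm_of_nonneg (by linarith)]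
    exact numLevels_le h1.1 hd h1.2 h2 h3
  · refine IsBigO.of_bound 2 ?_
    filter_upwards [eventually_capacity d, tendsto_log_log_natCast.eventually_ge_atTop 1,
      tendsto_log_natCast.eventually_ge_atTop 1, eventually_ge_atTop 2,
      tendsto_log_natCast.eventually (eventually_mul_log_le_sqrt (d * 3))] with n h1 h2 h3 h4 h5
    rw [Real.norm_of_nonneg (by linarith), Real.norm_of_nonneg (Nat.cast_nonneg _)]
    exact le_numLevels h1.1 hd h1.2 h4 h2 h3 h5

/-- The numerical assumptions of the analysis hold for large `n`. -/
theorem eventually_large {d : ℕ} (hd : 4 ≤ d) {q : ℕ → ℕ} {c₀ : ℝ} (hc₀ : 0 < c₀)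
    (hq : ∀ᶠ n : ℕ in atTop, c₀ * ((n : ℝ) / Real.log n) ≤ (n : ℝ) - q n) :
    ∀ᶠ n : ℕ in atTop,
      Large n d (numLevels d n) (q n) (4 * Real.log n / (c₀ * n)) := by
  have hsqrt := tendsto_natCast_atTop_atTop.eventually (eventually_mul_log_le_sqrt (12 / c₀))
  filter_upwards [hq, eventually_capacity d, tendsto_log_natCast.eventually_ge_atTop 1,
    tendsto_log_natCast.eventually_ge_atTop (108 / c₀), eventually_ge_atTop 2, hsqrt]
    with n hq hcap hL1 hL2 hn2 hsq
  obtain ⟨h1, h2, h3⟩ := numLevels_spec (by omega) hcap.1 hcap.2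
  set t := numLevels d n
  set L := Real.log n with hLdef
  have hnpos : (0 : ℝ) < n := by exact_mod_cast (by omega : 0 < n)
  -- With this `B`, the term `1 / B` is a quarter of `c₀ * n / log n`, a lower bound for `n - q`.
  -- The covered surplus and the overshoot of at most `2 * √n`, together with `1`, take at most a
  -- quarter each.
  refine ⟨hcap.1, hd, h1, h2, h3, by positivity, fun s hs => ?_⟩
  have hA : L ≤ capacity n 1 := by
    rw [capacity_one]; exact log_le_clog (by omega)
  have hreach : (reach n t : ℝ) ≤ 2 * capacity n t := by exact_mod_cast reach_le hcap.1 t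
  have hct : (2 : ℝ) ≤ capacity n t := by exact_mod_cast two_le_capacity hcap.1 t
  have hcsqrt : (capacity n t : ℝ) ≤ Real.sqrt n := by
    apply Real.le_sqrt_of_sq_le
    have : (capacity n t : ℝ) ^ d ≤ n := by exact_mod_cast h2
    exact (pow_le_pow_right₀ (by linarith) (by omega)).trans this
  have hs' : (s : ℝ) ≤ q n + reach n t := by exact_mod_cast hs
  -- the four summands
  have e1 : 1 / (4 * L / (c₀ * n)) = c₀ / 4 * (n / L) := by field_simp
  have e2 : 27 * n / (capacity n 1 : ℝ) ^ 3 ≤ c₀ / 4 * (n / L) := by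
    have h4 : 27 * (n : ℝ) / (capacity n 1 : ℝ) ^ 3 ≤ 27 * n / L ^ 3 := by gcongr
    refine h4.trans ?_
    have h5 : 27 ≤ c₀ / 4 * L ^ 2 := by
      rw [div_le_iff₀ hc₀] at hL2
      nlinarith
    rw [div_le_iff₀ (by positivity)]
    have h6 : c₀ / 4 * (n / L) * L ^ 3 = n * (c₀ / 4 * L ^ 2) := by field_simp
    rw [h6]
    nlinarith
  have e3 : 2 * (capacity n t : ℝ) + 1 ≤ c₀ / 4 * (n / L) := by
    have h4 : 12 / c₀ * L * Real.sqrt n ≤ n := by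
      calc 12 / c₀ * L * Real.sqrt n ≤ Real.sqrt n * Real.sqrt n := by gcongr
        _ = n := Real.mul_self_sqrt hnpos.le
    have h5 : 3 * Real.sqrt n ≤ c₀ / 4 * (n / L) := by
      rw [← mul_div_assoc, le_div_iff₀ (by linarith)]
      have h6 : 12 / c₀ * L * Real.sqrt n * c₀ ≤ n * c₀ := by gcongr
      have h7 : 12 / c₀ * L * Real.sqrt n * c₀ = 12 * L * Real.sqrt n := by field_simp
      linarith
    linarith
  have hpos : 0 ≤ n / L := by positivity
  rw [e1]
  nlinarith

theorem slope_eq (n d t : ℕ) (c B a : ℝ) (l : ℕ) :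
    slope n d t c B a l = a * (d * Nat.clog 2 (capacity n 1) : ℕ) + potentialCost n d t c B +
      l * (a + 2 * reductionFactor d c * a) := by
  induction l with
  | zero => simp [slope]
  | succ l ih => rw [slope, ih]; push_cast; ring

/-- Here `t + 1 ≤ log n ≤ α_1`, so the two logarithms in `t + 1` and `B` are cancelled by `α_1 ^ 2`;
the constant is `4 * 27 = 108`. -/
theorem eventually_potentialCost_le {d : ℕ} (hd : 4 ≤ d) {c c₀ : ℝ} (hc : 0 ≤ c) (hc₀ : 0 < c₀) :
    ∀ᶠ n : ℕ in atTop, potentialCost n d (numLevels d n) c (4 * Real.log n / (c₀ * n)) ≤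
      108 * failureFactor d c / c₀ := by
  have hsqrt := tendsto_log_natCast.eventually (eventually_mul_log_le_sqrt 5)
  filter_upwards [eventually_capacity d, tendsto_log_log_natCast.eventually_ge_atTop 1,
    tendsto_log_natCast.eventually_ge_atTop 1, eventually_ge_atTop 2, hsqrt] with n h1 h2 h3 h4 h5
  have ht := numLevels_le h1.1 (by omega : 1 ≤ d) h1.2 h2 h3
  have hK := (failureFactor_pos (d := d) hc).le
  set L := Real.log n with hLdef
  have hnpos : (0 : ℝ) < n := by exact_mod_cast (by omega : 0 < n)
  have hA : L ≤ capacity n 1 := by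
    rw [capacity_one]; exact log_le_clog (by omega)
  have htL : (numLevels d n : ℝ) + 1 ≤ L := by
    have : Real.sqrt L ≤ L := by rw [Real.sqrt_le_left (by linarith)]; nlinarith
    linarith
  unfold potentialCost
  calc failureFactor d c * ((numLevels d n : ℝ) + 1) * (4 * L / (c₀ * n)) *
        (27 * n / (capacity n 1 : ℝ) ^ 2)
      ≤ failureFactor d c * L * (4 * L / (c₀ * n)) * (27 * n / L ^ 2) := by gcongr
    _ = 108 * failureFactor d c / c₀ := by field_simp; ring

/-- The three contributions are the binary search with `d * ⌈log₂ α_1⌉` queries, the bounded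
potential, and a constant for each of the levels. -/
theorem eventually_slope_le {d : ℕ} (hd : 4 ≤ d) {c c₀ : ℝ} (hc : 0 ≤ c) (hc₀ : 0 < c₀) :
    ∀ᶠ n : ℕ in atTop,
      slope n d (numLevels d n) c (4 * Real.log n / (c₀ * n)) 1 (numLevels d n) ≤
      (7 * d + 108 * failureFactor d c / c₀ + 4 * (1 + 2 * reductionFactor d c)) *
        Real.log (Real.log n) := by
  filter_upwards [eventually_potentialCost_le hd hc hc₀, eventually_capacity d,
    tendsto_log_log_natCast.eventually_ge_atTop 1, tendsto_log_natCast.eventually_ge_atTop 1,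
    eventually_ge_atTop 2] with n hpc h1 h2 h3 h4
  have ht := numLevels_le h1.1 (by omega : 1 ≤ d) h1.2 h2 h3
  have hK := reductionFactor_nonneg (d := d) hc
  have hF := (failureFactor_pos (d := d) hc).le
  have hlog : (Nat.clog 2 (capacity n 1) : ℝ) ≤ 7 * Real.log (Real.log n) := by
    have h5 := clog_le_log h1.1
    have h6 : Real.log (capacity n 1 : ℝ) ≤ 3 * Real.log (Real.log n) := by
      have h7 := clog_le_log h4
      have hpos : (0 : ℝ) < capacity n 1 := by exact_mod_cast (by have := h1.1; omega)
      rw [← capacity_one] at h7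
      calc Real.log (capacity n 1 : ℝ) ≤ Real.log (3 * Real.log n) :=
            Real.log_le_log hpos (by linarith)
        _ = Real.log 3 + Real.log (Real.log n) := Real.log_mul (by norm_num) (by linarith)
        _ ≤ 3 * Real.log (Real.log n) := by
            have : Real.log 3 ≤ 3 - 1 := Real.log_le_sub_one_of_pos (by norm_num)
            linarith
    linarith
  rw [slope_eq]
  push_cast
  have a1 : (1 : ℝ) * (d * Nat.clog 2 (capacity n 1)) ≤ d * (7 * Real.log (Real.log n)) := by
    rw [one_mul]; gcongr
  have a2 : 108 * failureFactor d c / c₀ ≤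
      108 * failureFactor d c / c₀ * Real.log (Real.log n) :=
    le_mul_of_one_le_right (by positivity) h2
  have a3 : (numLevels d n : ℝ) * (1 + 2 * reductionFactor d c * 1) ≤
      4 * Real.log (Real.log n) * (1 + 2 * reductionFactor d c) := by
    rw [mul_one]; gcongr
  linarith

/-- The strategy for given parameters. -/
theorem multiLevel_analysis {d : ℕ} (hd : 4 ≤ d) {c : ℝ}
    (hc : ∀ k : ℕ, 1 ≤ k → (1 - 1 / (k : ℝ)) ^ (c * (k : ℝ)) ≤ 1 / 2) {q : ℕ → ℕ}
    (hqn : ∀ n, q n ≤ n)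
    (hq : (fun n : ℕ => (n : ℝ) - (q n : ℝ)) =Θ[atTop] fun n : ℕ => (n : ℝ) / Real.log n) :
    ∃ C : ℝ, ∀ᶠ n : ℕ in atTop, ∃ N : ℕ,
      ∀ (z : BitString n) (π : Equiv.Perm (Fin n)),
        (phaseOne n N d c (q n)).AlwaysReturns z π (Knows z π (q n)) ∧
        (phaseOne n N d c (q n)).expectedQueries z π ≤
          ENNReal.ofReal (C * ((n : ℝ) * Real.log (Real.log n))) ∧
        expectedFailureQueries n N d c (q n) z π ≤ ENNReal.ofReal (C * (n : ℝ)) ∧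
        (multiLevel n N d c (q n)).AlwaysReturns z π (Knows z π n) ∧
        (multiLevel n N d c (q n)).expectedQueries z π ≤
          (phaseOne n N d c (q n)).expectedQueries z π + ENNReal.ofReal (C * (n : ℝ)) ∧
        (multiLevel n N d c (q n)).expectedQueries z π ≤
          ENNReal.ofReal (C * ((n : ℝ) * Real.log (Real.log n))) := by
  have hc0 := nonneg_of_pow_le_half hc
  obtain ⟨c₁, hc₁, hup⟩ := hq.1.exists_pos
  obtain ⟨c₂, hc₂, hlow⟩ := hq.2.exists_pos
  have hup' := hup.bound
  have hlow' := hlow.bound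
  set c₀ : ℝ := 1 / c₂ with hc₀def
  have hc₀ : 0 < c₀ := by positivity
  have hqc : ∀ᶠ n : ℕ in atTop, c₀ * ((n : ℝ) / Real.log n) ≤ (n : ℝ) - q n := by
    filter_upwards [hlow', tendsto_log_natCast.eventually_ge_atTop 1] with n h hL
    have hqn' : (q n : ℝ) ≤ n := by exact_mod_cast hqn n
    rw [Real.norm_of_nonneg (by positivity), Real.norm_of_nonneg (by linarith)] at h
    rw [hc₀def, one_div_mul_eq_div, div_le_iff₀ hc₂]
    linarith
  set C₁ : ℝ := 7 * d + 108 * failureFactor d c / c₀ + 4 * (1 + 2 * reductionFactor d c) with hC₁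
  set C₂ : ℝ := 108 * failureFactor d c / c₀ with hC₂
  have hF := (failureFactor_pos (d := d) hc0).le
  have hK := reductionFactor_nonneg (d := d) hc0
  have hC₁0 : 0 ≤ C₁ := by positivity
  have hC₂0 : 0 ≤ C₂ := by positivity
  refine ⟨2 + C₁ + C₂ + 4 * c₁, ?_⟩
  filter_upwards [eventually_large hd hc₀ hqc, eventually_slope_le hd hc0 hc₀,
    eventually_potentialCost_le hd hc0 hc₀, hup', tendsto_log_log_natCast.eventually_ge_atTop 1,
    tendsto_log_natCast.eventually_ge_atTop 1, eventually_ge_atTop 2]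
    with n hL hslope hpc hup hLL hL1 hn2
  have hn1 : (1 : ℝ) ≤ n := by exact_mod_cast (by omega : 1 ≤ n)
  have hqn' : (q n : ℝ) ≤ n := by exact_mod_cast hqn n
  have hphase : 2 + slope n d (numLevels d n) c (4 * Real.log n / (c₀ * n)) 1 (numLevels d n) * n ≤
      (2 + C₁) * ((n : ℝ) * Real.log (Real.log n)) := by
    have h1 : (1 : ℝ) ≤ n * Real.log (Real.log n) := one_le_mul_of_one_le_of_one_le hn1 hLL
    have h2 := mul_le_mul_of_nonneg_right hslope (by linarith : (0 : ℝ) ≤ n)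
    nlinarith
  have hfail : slope n d (numLevels d n) c (4 * Real.log n / (c₀ * n)) 0 (numLevels d n) * n ≤
      C₂ * n := by
    rw [slope_eq]
    simp only [zero_mul, zero_add, mul_zero, add_zero]
    gcongr
  -- The factor `4` comes from `1 + ⌈log₂ n⌉ ≤ 2 + 2 * log n ≤ 4 * log n`.
  have hextra : ((n : ℝ) - q n) * (1 + Nat.clog 2 n) ≤ 4 * c₁ * n := by
    rw [Real.norm_of_nonneg (by linarith), Real.norm_of_nonneg (by positivity)] at hup
    have h1 := clog_le_log hn2
    calc ((n : ℝ) - q n) * (1 + Nat.clog 2 n)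
        ≤ (c₁ * (n / Real.log n)) * (4 * Real.log n) := by
          gcongr
          linarith
      _ = 4 * c₁ * n := by field_simp
  have hX : 0 ≤ (n : ℝ) * Real.log (Real.log n) := by positivity
  have hnX : (n : ℝ) ≤ n * Real.log (Real.log n) := le_mul_of_one_le_right (by linarith) hLL
  refine ⟨enoughFuel n c, fun z π => ?_⟩
  have h1 := phaseOne_expectedQueries_le (z := z) (π := π) hc hL (hqn n)
  have h2 := multiLevel_expectedQueries_le (z := z) (π := π) hc hL (hqn n)
  have h1' := h1.trans (ENNReal.ofReal_le_ofReal hphase)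
  have h2' := h2.trans (add_le_add le_rfl (ENNReal.ofReal_le_ofReal hextra))
  refine ⟨(phaseOne_sure hc hL (hqn n)).alwaysReturns, h1'.trans (ENNReal.ofReal_le_ofReal ?_),
    (expectedFailureQueries_le hc hL (hqn n)).trans (ENNReal.ofReal_le_ofReal (hfail.trans ?_)),
    (multiLevel_bd (κ := fun _ => 0) (fun _ => le_rfl) zero_le_two hc hL
      (hqn n)).sure.alwaysReturns,
    h2'.trans (add_le_add le_rfl (ENNReal.ofReal_le_ofReal ?_)),
    h2'.trans ((add_le_add h1' le_rfl).trans ?_)⟩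
  · exact mul_le_mul_of_nonneg_right (by linarith) hX
  · exact mul_le_mul_of_nonneg_right (by linarith) (by linarith)
  · exact mul_le_mul_of_nonneg_right (by linarith) (by linarith)
  · rw [← ENNReal.ofReal_add (by positivity) (by positivity)]
    refine ENNReal.ofReal_le_ofReal ?_
    have h3 : 4 * c₁ * (n : ℝ) ≤ 4 * c₁ * (n * Real.log (Real.log n)) := by gcongr
    have h4 := mul_nonneg hC₂0 hX
    linarith

theorem one_sub_inv_rpow_le_half (k : ℕ) (hk : 1 ≤ k) :
    (1 - 1 / (k : ℝ)) ^ ((1 : ℝ) * (k : ℝ)) ≤ 1 / 2 := by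
  have hk' : (1 : ℝ) ≤ k := by exact_mod_cast hk
  have h0 : 0 ≤ 1 - 1 / (k : ℝ) := by
    rw [sub_nonneg, div_le_one (by linarith)]; exact hk'
  have h1 : 1 - 1 / (k : ℝ) ≤ Real.exp (-(1 / (k : ℝ))) := by
    have := Real.add_one_le_exp (-(1 / (k : ℝ)))
    linarith
  rw [one_mul, Real.rpow_natCast]
  calc (1 - 1 / (k : ℝ)) ^ k ≤ Real.exp (-(1 / (k : ℝ))) ^ k := by gcongr
    _ = Real.exp (-1) := by
        rw [← Real.exp_nat_mul]
        congr 1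
        field_simp
    _ ≤ 1 / 2 := by
        rw [Real.exp_neg, one_div]
        have := Real.add_one_le_exp (1 : ℝ)
        exact inv_anti₀ two_pos (by linarith)

/-- The strategy is used with `d = 4`, `c = 1` and `q = n - ⌊n / log n⌋`. -/
theorem randomizedQueryComplexity_isBigO :
    ∃ C : ℝ, ∀ᶠ n : ℕ in atTop, randomizedQueryComplexity n ≤
      ENNReal.ofReal (C * ((n : ℝ) * Real.log (Real.log n))) := by
  have hΘ : (fun n : ℕ => (n : ℝ) - ((n - ⌊(n : ℝ) / Real.log n⌋₊ : ℕ) : ℝ)) =Θ[atTop]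
      fun n : ℕ => (n : ℝ) / Real.log n := by
    have hev : ∀ᶠ n : ℕ in atTop, 0 ≤ (n : ℝ) / Real.log n ∧
        (n : ℝ) - ((n - ⌊(n : ℝ) / Real.log n⌋₊ : ℕ) : ℝ) = (⌊(n : ℝ) / Real.log n⌋₊ : ℝ) ∧
        1 ≤ (n : ℝ) / Real.log n := by
      have hsq := tendsto_natCast_atTop_atTop.eventually (eventually_mul_log_le_sqrt 1)
      filter_upwards [tendsto_log_natCast.eventually_ge_atTop 1, eventually_ge_atTop 2, hsq]
        with n hL hn hsq
      have hn1 : (1 : ℝ) ≤ n := by exact_mod_cast (by omega : 1 ≤ n)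
      have h0 : 0 ≤ (n : ℝ) / Real.log n := by positivity
      refine ⟨h0, ?_, ?_⟩
      · rw [Nat.cast_sub, sub_sub_cancel]
        have : (n : ℝ) / Real.log n ≤ n := div_le_self (by linarith) hL
        exact (Nat.floor_le_floor this).trans_eq (Nat.floor_natCast n)
      · rw [le_div_iff₀ (by linarith), one_mul]
        have : Real.sqrt n ≤ n := by rw [Real.sqrt_le_left (by linarith)]; nlinarith
        linarith
    constructor
    · refine IsBigO.of_bound 1 ?_
      filter_upwards [hev] with n h
      rw [h.2.1, Real.norm_of_nonneg (Nat.cast_nonneg _), Real.norm_of_nonneg h.1, one_mul]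
      exact Nat.floor_le h.1
    · refine IsBigO.of_bound 2 ?_
      filter_upwards [hev] with n h
      rw [h.2.1, Real.norm_of_nonneg (Nat.cast_nonneg _), Real.norm_of_nonneg h.1]
      have h1 := Nat.lt_floor_add_one ((n : ℝ) / Real.log n)
      have h2 : (1 : ℝ) ≤ (⌊(n : ℝ) / Real.log n⌋₊ : ℝ) := by
        exact_mod_cast Nat.le_floor (by exact_mod_cast h.2.2)
      linarith
  obtain ⟨C, hC⟩ := multiLevel_analysis (d := 4) le_rfl one_sub_inv_rpow_le_half
    (fun n => Nat.sub_le n _) hΘ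
  refine ⟨C, hC.mono fun n ⟨N, hN⟩ => ?_⟩
  exact randomizedQueryComplexity_le _ (fun z π => (hN z π).2.2.2.1)
    fun z π => (hN z π).2.2.2.2.2

end PermMastermind

theorem mainTheorem2 :
    (∃ C : ℝ, ∀ᶠ n : ℕ in atTop, PermMastermind.randomizedQueryComplexity n ≤
        ENNReal.ofReal (C * ((n : ℝ) * Real.log (Real.log n)))) ∧
    (∀ d : ℕ, 4 ≤ d →
      ((fun n : ℕ => (PermMastermind.numLevels d n : ℝ)) =Θ[atTop]
        fun n : ℕ => Real.log (Real.log n)) ∧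
      ∀ c : ℝ, (∀ k : ℕ, 1 ≤ k → (1 - 1 / (k : ℝ)) ^ (c * (k : ℝ)) ≤ 1 / 2) →
      ∀ q : ℕ → ℕ, (∀ n, q n ≤ n) →
        ((fun n : ℕ => (n : ℝ) - (q n : ℝ)) =Θ[atTop] fun n : ℕ => (n : ℝ) / Real.log n) →
      ∃ C : ℝ, ∀ᶠ n : ℕ in atTop, ∃ N : ℕ,
        ∀ (z : PermMastermind.BitString n) (π : Equiv.Perm (Fin n)),
          (PermMastermind.phaseOne n N d c (q n)).AlwaysReturns z π
            (PermMastermind.Knows z π (q n)) ∧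
          (PermMastermind.phaseOne n N d c (q n)).expectedQueries z π ≤
            ENNReal.ofReal (C * ((n : ℝ) * Real.log (Real.log n))) ∧
          PermMastermind.expectedFailureQueries n N d c (q n) z π ≤
            ENNReal.ofReal (C * (n : ℝ)) ∧
          (PermMastermind.multiLevel n N d c (q n)).AlwaysReturns z π
            (PermMastermind.Knows z π n) ∧
          (PermMastermind.multiLevel n N d c (q n)).expectedQueries z π ≤
            (PermMastermind.phaseOne n N d c (q n)).expectedQueries z π +
              ENNReal.ofReal (C * (n : ℝ)) ∧
          (PermMastermind.multiLevel n N d c (q n)).expectedQueries z π ≤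
            ENNReal.ofReal (C * ((n : ℝ) * Real.log (Real.log n)))) := by
  exact ⟨PermMastermind.randomizedQueryComplexity_isBigO, fun _ hd =>
    ⟨PermMastermind.numLevels_isTheta (by omega), fun _ hc _ hqn hq =>
      PermMastermind.multiLevel_analysis hd hc hqn hq⟩⟩
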